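/- Let $P_{XY}$ be a probability distribution on a product $\mathcal X\times\mathcal Y$ of measurable spaces, with $X$-marginal $P_X$ and $(X,Y)\sim P_{XY}$. Let $\ell:\mathcal Y^r\to\mathbb R$ be a measurable symmetric kernel of order $r\ge 1$, and for i.i.d. copies $Y_1,\dots,Y_r$ of $Y$ put $$\psi=\mathbb E\{\ell(Y_1,\dots,Y_r)\},\quad \ell_1(y)=\mathbb E\{\ell(Y_1,\dots,Y_r)\mid Y_1=y\},\quad \psi_1(x)=\mathbb E\{\ell_1(Y)\mid X=x\}.$$ Suppose $\sigma_\ell^2:=\mathrm{Var}\{\ell(Y_1,\dots,Y_r)\}<\infty$ and $\sigma_1^2:=\mathbb E[\mathrm{Var}\{\ell_1(Y)\mid X\}]>0$, and let $f:\mathcal X\to\mathbb R$ be a fixed measurable function with $\mathrm{Var}\{f(X)\}<\infty$. Let $n>r$ and $m\ge 0$ be integers, let $\mathcal D_{XY}=\{(X_i,Y_i)\}_{i=1}^n$ be i.i.d. from $P_{XY}$ and, independently, let $\{X_i\}_{i=n+1}^{n+m}$ be i.i.d. from $P_X$. Let $\widehat f_1$ and $\widehat f_2$ be real-valued functions on $\mathcal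 X$ trained on $\{(X_i,Y_i)\}_{i\le\lfloor n/2\rfloor}$ and on $\{(X_i,Y_i)\}_{\lfloor n/2\rfloor<i\le n}$, respectively (that is, $\widehat f_k(x)$ is a jointly measurable function of the respective data and of $x$). Put $\widehat f_{\mathrm{cross}}(X_i)=\widehat f_2(X_i)$ if $i\le\lfloor n/2\rfloor$ or $n<i\le n+\lfloor m/2\rfloor$, and $\widehat f_{\mathrm{cross}}(X_i)=\widehat f_1(X_i)$ otherwise, and $$U_{\mathrm{cross}}=\binom nr^{-1}\sum_{1\le i_1<\dots<i_r\le n}\ell(Y_{i_1},\dots,Y_{i_r})-\frac rn\sum_{i=1}^n\widehat f_{\mathrm{cross}}(X_i)+\frac r{n+m}\sum_{i=1}^{n+m}\widehat f_{\mathrm{cross}}(X_i),$$ $$\Lambda_{n,m,f}=r^2\,\mathrm{Var}\{\ell_1(Y)\}+\frac{r^2m}{n+m}\bigl[\mathrm{Var}\{f(X)\}-2\,\mathrm{Cov}\{f(X),\psi_1(X)\}\bigr].$$ Let $M_{p,\ell_1}=\mathbb E\{|\ell_1(Y)-\mathbb E\,\ell_1(Y)|^p\}$ and $M_{p,f}=\mathbb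 E\{|f(X)-\mathbb E f(X)|^p\}$. With $(X,Y)$ independent of all the data, and with $\widehat f_k^{(-i)}$ denoting $\widehat f_k$ trained after $(X_i,Y_i)$ has been replaced by an independent copy (so $\widehat f_k^{(-i)}=\widehat f_k$ if $\widehat f_k$ does not use the $i$th observation), let $$\Delta_{\mathrm{MSPE}}=\mathbb E[\{\widehat f_1(X)-f(X)\}^2]+\mathbb E[\{\widehat f_2(X)-f(X)\}^2],$$ $$\Delta_{\mathrm{Stability}}=\min\{m,n\}\Bigl(\frac1n\sum_{i=1}^n\mathbb E[\{\widehat f_1(X)-\widehat f_1^{(-i)}(X)\}^2]+\frac1n\sum_{i=1}^n\mathbb E[\{\widehat f_2(X)-\widehat f_2^{(-i)}(X)\}^2]\Bigr).$$ These moments may be $+\infty$. Then there is a constant $C_r>0$, depending only on $r$, such that in every such setting $$\sup_{t\in\mathbb R}\Bigl|\mathbb P\Bigl\{\frac{\sqrt n\,(U_{\mathrm{cross}}-\psi)}{\sqrt{\Lambda_{n,m,f}}}\le t\Bigr\}-\Phi(t)\Bigr|\le C_r(\Omega_1+\Omega_2),$$ where $\Phi$ is the standard normal distribution function and $$\Omega_1=\frac{M_{3,\ell_1}+M_{3,f}}{\sqrt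 n\,\sigma_1^3}+\frac{(M_{2,\ell_1}^{1/2}+M_{2,f}^{1/2}+\sigma_1)\,\sigma_\ell}{\sqrt{n-r}\,\sigma_1^2},$$ $$\Omega_2=\min\Bigl\{\frac{\Delta_{\mathrm{MSPE}}^{1/3}}{\sigma_1^{2/3}},\ \frac{M_{2,\ell_1}^{1/2}+M_{2,f}^{1/2}+\sigma_1}{\sigma_1^2}\bigl(\Delta_{\mathrm{MSPE}}^{1/2}+\Delta_{\mathrm{Stability}}^{1/2}\bigr)\Bigr\}.$$ -/

import Mathlib

open MeasureTheory ProbabilityTheory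
open scoped ENNReal

universe u v w

namespace SemiU

noncomputable section

/-! ### The kernel and its projections

`P` is the law of a labeled observation `(X, Y)` on `𝒳 × 𝒴`; its marginals are `P.fst` (the law of
`X`) and `P.snd` (the law of `Y`). The kernel `ℓ` is a function of `r` arguments in `𝒴`. -/

/-- The target parameter `ψ = E ℓ(Y₁, …, Y_r)`. -/
def psi {𝒳 : Type u} {𝒴 : Type v} [MeasurableSpace 𝒳] [MeasurableSpace 𝒴] {r : ℕ}
    (P : Measure (𝒳 × 𝒴)) (ℓ : (Fin r → 𝒴) → ℝ) : ℝ :=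
  ∫ y, ℓ y ∂(Measure.pi fun _ : Fin r => P.snd)

/-- The projection `ℓ₁(y) = E[ℓ(Y₁, …, Y_r) | Y₁ = y]`: the first argument is frozen at `y` and the
remaining ones are integrated out. -/
def ell1 {𝒳 : Type u} {𝒴 : Type v} [MeasurableSpace 𝒳] [MeasurableSpace 𝒴] {r : ℕ} [NeZero r]
    (P : Measure (𝒳 × 𝒴)) (ℓ : (Fin r → 𝒴) → ℝ) (y : 𝒴) : ℝ :=
  ∫ v, ℓ (Function.update v 0 y) ∂(Measure.pi fun _ : Fin r => P.snd)

/-- The σ-algebra on `𝒳 × 𝒴` generated by the covariate `X`. -/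
abbrev sigmaX (𝒳 : Type u) (𝒴 : Type v) [MeasurableSpace 𝒳] : MeasurableSpace (𝒳 × 𝒴) :=
  MeasurableSpace.comap Prod.fst inferInstance

/-- The random variable `ψ₁(X) = E[ℓ₁(Y) | X]` on `(𝒳 × 𝒴, P)`. -/
def psi1 {𝒳 : Type u} {𝒴 : Type v} [MeasurableSpace 𝒳] [MeasurableSpace 𝒴] {r : ℕ} [NeZero r]
    (P : Measure (𝒳 × 𝒴)) (ℓ : (Fin r → 𝒴) → ℝ) : 𝒳 × 𝒴 → ℝ :=
  P[fun z => ell1 P ℓ z.2 | sigmaX 𝒳 𝒴]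

/-- `σ₁² = E[Var(ℓ₁(Y) | X)]`. -/
def sigma1Sq {𝒳 : Type u} {𝒴 : Type v} [MeasurableSpace 𝒳] [MeasurableSpace 𝒴] {r : ℕ} [NeZero r]
    (P : Measure (𝒳 × 𝒴)) (ℓ : (Fin r → 𝒴) → ℝ) : ℝ :=
  ∫ z, (Var[fun z => ell1 P ℓ z.2; P | sigmaX 𝒳 𝒴]) z ∂P

/-- `σ₁`. -/
def sigma1 {𝒳 : Type u} {𝒴 : Type v} [MeasurableSpace 𝒳] [MeasurableSpace 𝒴] {r : ℕ} [NeZero r]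
    (P : Measure (𝒳 × 𝒴)) (ℓ : (Fin r → 𝒴) → ℝ) : ℝ :=
  √(sigma1Sq P ℓ)

/-- `σ_ℓ`, the standard deviation of `ℓ(Y₁, …, Y_r)`. -/
def sigmaEll {𝒳 : Type u} {𝒴 : Type v} [MeasurableSpace 𝒳] [MeasurableSpace 𝒴] {r : ℕ}
    (P : Measure (𝒳 × 𝒴)) (ℓ : (Fin r → 𝒴) → ℝ) : ℝ :=
  √(Var[ℓ; Measure.pi fun _ : Fin r => P.snd])

/-- `Λ_{n,m,f} = r² Var(ℓ₁(Y)) + r² m / (n + m) * (Var(f(X)) - 2 Cov(f(X), ψ₁(X)))`. -/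
def Lam {𝒳 : Type u} {𝒴 : Type v} [MeasurableSpace 𝒳] [MeasurableSpace 𝒴] {r : ℕ} [NeZero r]
    (P : Measure (𝒳 × 𝒴)) (ℓ : (Fin r → 𝒴) → ℝ) (f : 𝒳 → ℝ) (n m : ℕ) : ℝ :=
  (r : ℝ) ^ 2 * Var[ell1 P ℓ; P.snd] +
    (r : ℝ) ^ 2 * m / (n + m) *
      (Var[f; P.fst] - 2 * cov[fun z => f z.1, psi1 P ℓ; P])

/-! ### The sample and the statistic -/

/-- `Z 0, …, Z (n-1)` are i.i.d. labeled observations from `P`, `X' 0, …, X' (m-1)` are i.i.d.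
unlabeled observations from the first marginal of `P`, and the two samples are independent. -/
structure IsSample {𝒳 : Type u} {𝒴 : Type v} {Ω : Type w} [MeasurableSpace 𝒳] [MeasurableSpace 𝒴]
    [MeasurableSpace Ω] (μ : Measure Ω) (P : Measure (𝒳 × 𝒴)) {n m : ℕ}
    (Z : Fin n → Ω → 𝒳 × 𝒴) (X' : Fin m → Ω → 𝒳) : Prop where
  law_labeled : ∀ i, HasLaw (Z i) P μ
  law_unlabeled : ∀ j, HasLaw (X' j) P.fst μ
  indep_labeled : iIndepFun Z μ
  indep_unlabeled : iIndepFun X' μ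
  indep : IndepFun (fun ω i => Z i ω) (fun ω j => X' j ω) μ

/-- The indices of the first `⌊n/2⌋` observations. -/
abbrev Fold1 (n : ℕ) : Type := {i : Fin n // (i : ℕ) < n / 2}

/-- The indices of the remaining observations. -/
abbrev Fold2 (n : ℕ) : Type := {i : Fin n // ¬ (i : ℕ) < n / 2}

/-- The first half of a data set. -/
def half1 {α : Type u} {n : ℕ} (D : Fin n → α) : Fold1 n → α := fun i => D i

/-- The second half of a data set. -/
def half2 {α : Type u} {n : ℕ} (D : Fin n → α) : Fold2 n → α := fun i => D i

open Classical in
/-- The U-statistic `(n choose r)⁻¹ ∑_{i₁ < ⋯ < i_r} ℓ(y_{i₁}, …, y_{i_r})`. -/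
def UStat {𝒴 : Type v} {r n : ℕ} (ℓ : (Fin r → 𝒴) → ℝ) (y : Fin n → 𝒴) : ℝ :=
  ((n.choose r : ℕ) : ℝ)⁻¹ * ∑ i : Fin r → Fin n with StrictMono i, ℓ (fun k => y (i k))

/-- The value `f̂_cross(xᵢ)` on the `i`-th of `k` observations: the function trained on the other
fold is used. Here `g₁` and `g₂` are the functions trained on the first and on the second fold. -/
def crossFit {𝒳 : Type u} {k : ℕ} (g₁ g₂ : 𝒳 → ℝ) (x : Fin k → 𝒳) (i : Fin k) : ℝ :=
  if (i : ℕ) < k / 2 then g₂ (x i) else g₁ (x i)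

/-- The cross-fit semi-supervised U-statistic
`U - (r/n) ∑_{i ≤ n} f̂_cross(Xᵢ) + (r/(n+m)) ∑_{i ≤ n+m} f̂_cross(Xᵢ)`,
computed from the labeled data `D` and the unlabeled data `x'`. -/
def UCross {𝒳 : Type u} {𝒴 : Type v} {r n m : ℕ} (ℓ : (Fin r → 𝒴) → ℝ)
    (fhat1 : (Fold1 n → 𝒳 × 𝒴) → 𝒳 → ℝ) (fhat2 : (Fold2 n → 𝒳 × 𝒴) → 𝒳 → ℝ)
    (D : Fin n → 𝒳 × 𝒴) (x' : Fin m → 𝒳) : ℝ :=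
  let g₁ := fhat1 (half1 D)
  let g₂ := fhat2 (half2 D)
  UStat ℓ (fun i => (D i).2)
    - (r : ℝ) / n * ∑ i, crossFit g₁ g₂ (fun i => (D i).1) i
    + (r : ℝ) / (n + m) *
        (∑ i, crossFit g₁ g₂ (fun i => (D i).1) i + ∑ j, crossFit g₁ g₂ x' j)

/-! ### The quantities in the bound, as elements of `[0, ∞]` -/

/-- The `p`-th absolute central moment `E|g - E g|^p` under `ν`. -/
def centralMoment {α : Type u} [MeasurableSpace α] (ν : Measure α) (g : α → ℝ) (p : ℕ) : ℝ≥0∞ :=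
  ∫⁻ a, ‖g a - ∫ b, g b ∂ν‖ₑ ^ p ∂ν

/-- `M_{p,ℓ₁}`. -/
def Mell {𝒳 : Type u} {𝒴 : Type v} [MeasurableSpace 𝒳] [MeasurableSpace 𝒴] {r : ℕ} [NeZero r]
    (P : Measure (𝒳 × 𝒴)) (ℓ : (Fin r → 𝒴) → ℝ) (p : ℕ) : ℝ≥0∞ :=
  centralMoment P.snd (ell1 P ℓ) p

/-- `M_{p,f}`. -/
def Mf {𝒳 : Type u} {𝒴 : Type v} [MeasurableSpace 𝒳] [MeasurableSpace 𝒴]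
    (P : Measure (𝒳 × 𝒴)) (f : 𝒳 → ℝ) (p : ℕ) : ℝ≥0∞ :=
  centralMoment P.fst f p

/-- `Δ_MSPE = E[(f̂₁(X) - f(X))²] + E[(f̂₂(X) - f(X))²]`, with `X` independent of the data `D`. -/
def mspe {𝒳 : Type u} {𝒴 : Type v} [MeasurableSpace 𝒳] [MeasurableSpace 𝒴] {n : ℕ}
    (P : Measure (𝒳 × 𝒴)) (f : 𝒳 → ℝ)
    (fhat1 : (Fold1 n → 𝒳 × 𝒴) → 𝒳 → ℝ) (fhat2 : (Fold2 n → 𝒳 × 𝒴) → 𝒳 → ℝ) : ℝ≥0∞ :=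
  (∫⁻ D, ∫⁻ x, ‖fhat1 (half1 D) x - f x‖ₑ ^ 2 ∂P.fst ∂(Measure.pi fun _ : Fin n => P)) +
    ∫⁻ D, ∫⁻ x, ‖fhat2 (half2 D) x - f x‖ₑ ^ 2 ∂P.fst ∂(Measure.pi fun _ : Fin n => P)

/-- `E[(f̂(X) - f̂^{(-i)}(X))²]`, where `f̂` is computed from the whole data set `D`, `f̂^{(-i)}` from
`D` with its `i`-th entry replaced by an independent copy `z`, and `X` is independent of
`(D, z)`. -/
def looError {𝒳 : Type u} {𝒴 : Type v} [MeasurableSpace 𝒳] [MeasurableSpace 𝒴] {n : ℕ}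
    (P : Measure (𝒳 × 𝒴)) (fhat : (Fin n → 𝒳 × 𝒴) → 𝒳 → ℝ) (i : Fin n) : ℝ≥0∞ :=
  ∫⁻ D, ∫⁻ z, ∫⁻ x, ‖fhat D x - fhat (Function.update D i z) x‖ₑ ^ 2 ∂P.fst ∂P
    ∂(Measure.pi fun _ : Fin n => P)

/-- `Δ_Stability`. -/
def stability {𝒳 : Type u} {𝒴 : Type v} [MeasurableSpace 𝒳] [MeasurableSpace 𝒴] {n : ℕ}
    (P : Measure (𝒳 × 𝒴)) (m : ℕ)
    (fhat1 : (Fold1 n → 𝒳 × 𝒴) → 𝒳 → ℝ) (fhat2 : (Fold2 n → 𝒳 × 𝒴) → 𝒳 → ℝ) : ℝ≥0∞ :=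
  ((min m n : ℕ) : ℝ≥0∞) *
    ((∑ i : Fin n, looError P (fun D => fhat1 (half1 D)) i) / n +
      (∑ i : Fin n, looError P (fun D => fhat2 (half2 D)) i) / n)

/-- `Ω₁`. -/
def Omega1 {𝒳 : Type u} {𝒴 : Type v} [MeasurableSpace 𝒳] [MeasurableSpace 𝒴] {r : ℕ} [NeZero r]
    (P : Measure (𝒳 × 𝒴)) (ℓ : (Fin r → 𝒴) → ℝ) (f : 𝒳 → ℝ) (n : ℕ) : ℝ≥0∞ :=
  let s₁ := ENNReal.ofReal (sigma1 P ℓ)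
  (Mell P ℓ 3 + Mf P f 3) / (ENNReal.ofReal (√(n : ℝ)) * s₁ ^ 3) +
    (Mell P ℓ 2 ^ (1 / 2 : ℝ) + Mf P f 2 ^ (1 / 2 : ℝ) + s₁) * ENNReal.ofReal (sigmaEll P ℓ) /
      (ENNReal.ofReal (√((n : ℝ) - r)) * s₁ ^ 2)

/-- `Ω₂`. -/
def Omega2 {𝒳 : Type u} {𝒴 : Type v} [MeasurableSpace 𝒳] [MeasurableSpace 𝒴] {r n : ℕ} [NeZero r]
    (P : Measure (𝒳 × 𝒴)) (ℓ : (Fin r → 𝒴) → ℝ) (f : 𝒳 → ℝ) (m : ℕ)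
    (fhat1 : (Fold1 n → 𝒳 × 𝒴) → 𝒳 → ℝ) (fhat2 : (Fold2 n → 𝒳 × 𝒴) → 𝒳 → ℝ) : ℝ≥0∞ :=
  let s₁ := ENNReal.ofReal (sigma1 P ℓ)
  min
    (mspe P f fhat1 fhat2 ^ (1 / 3 : ℝ) / s₁ ^ (2 / 3 : ℝ))
    ((Mell P ℓ 2 ^ (1 / 2 : ℝ) + Mf P f 2 ^ (1 / 2 : ℝ) + s₁) / s₁ ^ 2 *
      (mspe P f fhat1 fhat2 ^ (1 / 2 : ℝ) + stability P m fhat1 fhat2 ^ (1 / 2 : ℝ)))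

end

end SemiU

namespace SemiU

noncomputable section

/-! Give the unlabeled covariates fictitious responses. All `n + m` observations are then i.i.d.
from `P`, and the problem lives on a product space (`IsSample.measure_eq`). The fitted values enter
the statistic as `-r ∑ cᵢ f̂_cross(Xᵢ)`, where the weights `cw` are `m / (n (n + m))` on labeled and
`-1 / (n + m)` on unlabeled observations. Adding and subtracting `f`, and splitting the U-statistic
into its Hoeffding projection and a degenerate rest, gives (`UCross_sub_eq`) a sum of independent
centered terms `linPart`, the rest `uRem`, and a term `fitRem` due to the errors of the trained
functions.

After multiplication by `r √n` the linear part has variance exactly `Λ` (`sum_integral_linPart_sq`).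
Moreover `Λ ≥ r² σ₁²` (`sigma1Sq_mul_le_Lam`): with `κ = m / (n + m) ≤ 1`, lowering `κ Var f` to `κ²
Var f` leaves the mean squared error of an affine function of `f(X)` as a predictor of `ℓ₁(Y)`, and
no function of `X` beats the conditional expectation. So `√Λ` in a denominator can be traded for `r
σ₁`.

The normal approximation of a sum `W` of independent terms is Stein's method
(`StdSummands.berry_esseen`). For `W + Δ` with nonlinear `Δ`, the events `W + Δ ≤ t` and `W ≤ t`
differ only where `|W - t| ≤ |Δ|`. The randomized concentration inequality
`StdSummands.concentration` bounds the probability of that event, and `berry_esseen_nonlinear`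
expresses the bound through the `L²` norm of `Δ` and of its increments when one observation is
resampled.

Degenerate terms that share at most one observation are uncorrelated, so counting index sets gives
`uRem` a second moment of order `n⁻²` and squared increments of order `n⁻³` (`uRem_second_moment`,
`uRem_increment`). For `fitRem`, each trained function is independent of the points where it is
evaluated, and the weights over each fold cancel up to rounding. Its second moment is therefore at
most a constant times `Δ_MSPE / n` (`fitRem_second_moment`), and its increments split into the
effect of moving an evaluation point and the effect of retraining (`fitRem_increment`).

The two expressions in `Ω₂` are two treatments of `fitRem`: as an additive perturbation, by
Chebyshev's inequality and the Lipschitz continuity of `Φ` (`abs_measureReal_sub_ncdf_le`), or as a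
part of `Δ` (`normal_approx_stdDeg_add_stdFit`). -/

/-! ### The Stein equation for half-lines -/

/-- The standard normal density. -/
def npdf (x : ℝ) : ℝ := gaussianPDFReal 0 1 x

/-- The standard normal distribution function. -/
def ncdf (x : ℝ) : ℝ := cdf (gaussianReal 0 1) x

lemma npdf_eq (x : ℝ) : npdf x = (√(2 * Real.pi))⁻¹ * Real.exp (-x ^ 2 / 2) := by
  simp [npdf, gaussianPDFReal]

lemma npdf_pos (x : ℝ) : 0 < npdf x := gaussianPDFReal_pos _ _ _ one_ne_zero

lemma npdf_neg (x : ℝ) : npdf (-x) = npdf x := by simp [npdf_eq]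

lemma hasDerivAt_npdf (x : ℝ) : HasDerivAt npdf (-x * npdf x) x := by
  have h : npdf = fun x => (√(2 * Real.pi))⁻¹ * Real.exp (-x ^ 2 / 2) := funext npdf_eq
  rw [h]
  have h1 : HasDerivAt (fun x : ℝ => -x ^ 2 / 2) (-x) x := by
    have := ((hasDerivAt_pow 2 x).neg).div_const 2
    refine this.congr_deriv ?_
    simp; ring
  refine (h1.exp.const_mul _).congr_deriv ?_
  ring

lemma continuous_npdf : Continuous npdf :=
  continuous_iff_continuousAt.2 fun x => (hasDerivAt_npdf x).continuousAt

lemma npdf_le_one (x : ℝ) : npdf x ≤ 1 := by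
  rw [npdf_eq]
  have h1 : Real.exp (-x ^ 2 / 2) ≤ 1 := Real.exp_le_one_iff.2 (by nlinarith [sq_nonneg x])
  have h2 : 1 ≤ √(2 * Real.pi) := by
    rw [Real.one_le_sqrt]; nlinarith [Real.pi_gt_three]
  have h3 : (√(2 * Real.pi))⁻¹ ≤ 1 := inv_le_one_of_one_le₀ h2
  exact mul_le_one₀ h3 (Real.exp_pos _).le h1

lemma integrable_npdf : Integrable npdf := integrable_gaussianPDFReal 0 1

lemma ncdf_eq_integral (x : ℝ) : ncdf x = ∫ t in Set.Iic x, npdf t := by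
  rw [ncdf, cdf_eq_real, measureReal_def, gaussianReal_apply_eq_integral 0 one_ne_zero,
    ENNReal.toReal_ofReal]
  · rfl
  · exact integral_nonneg fun t => (npdf_pos t).le

lemma hasDerivAt_ncdf (x : ℝ) : HasDerivAt ncdf (npdf x) x := by
  have h : ncdf = fun x => ncdf 0 + ∫ t in (0 : ℝ)..x, npdf t := by
    ext x
    rw [intervalIntegral.integral_Iic_sub_Iic integrable_npdf.integrableOn
      integrable_npdf.integrableOn |>.symm, ← ncdf_eq_integral, ← ncdf_eq_integral]
    ring
  rw [h]
  exact (intervalIntegral.integral_hasDerivAt_right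
    (continuous_npdf.intervalIntegrable _ _) (continuous_npdf.stronglyMeasurableAtFilter _ _)
    continuous_npdf.continuousAt).const_add _

lemma ncdf_nonneg (x : ℝ) : 0 ≤ ncdf x := cdf_nonneg _ _

lemma ncdf_le_one (x : ℝ) : ncdf x ≤ 1 := cdf_le_one _ _

lemma ncdf_mono : Monotone ncdf := monotone_cdf _

lemma ncdf_neg (x : ℝ) : ncdf (-x) = 1 - ncdf x := by
  have h : (gaussianReal 0 1).map (fun x => -x) = gaussianReal 0 1 := by
    rw [gaussianReal_map_neg, neg_zero]
  have := nullSingletonClass_gaussianReal (μ := 0) (v := 1) one_ne_zero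
  rw [ncdf, ncdf, cdf_eq_real, cdf_eq_real, ← probReal_compl_eq_one_sub measurableSet_Iic]
  nth_rewrite 1 [← h]
  rw [map_measureReal_apply measurable_neg measurableSet_Iic]
  simp only [Set.neg_preimage, Set.neg_Iic, neg_neg, Set.compl_Iic]
  exact measureReal_congr Ioi_ae_eq_Ici.symm

/-- Mills' inequality. -/
lemma neg_mul_ncdf_le (x : ℝ) : -(x * ncdf x) ≤ npdf x := by
  have hT : Filter.Tendsto npdf Filter.atBot (nhds 0) := by
    have h : npdf = fun x => (√(2 * Real.pi))⁻¹ * Real.exp (-x ^ 2 / 2) := funext npdf_eq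
    rw [h, ← mul_zero (√(2 * Real.pi))⁻¹]
    refine Filter.Tendsto.const_mul _ (Real.tendsto_exp_atBot.comp ?_)
    have h1 : Filter.Tendsto (fun x : ℝ => x ^ 2) Filter.atBot Filter.atTop :=
      Filter.Tendsto.congr (fun x => by simp [sq]) (Filter.tendsto_id.atBot_mul_atBot₀ Filter.tendsto_id)
    have h2 := (Filter.tendsto_neg_atTop_atBot.comp h1).atBot_div_const (r := 2) (by norm_num)
    exact h2
  have hint : Integrable (fun t => -t * npdf t) := by
    have h := (integrable_mul_exp_neg_mul_sq (b := 1 / 2) (by norm_num)).const_mul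
      (-(√(2 * Real.pi))⁻¹)
    refine h.congr (Filter.Eventually.of_forall fun t => ?_)
    simp only [npdf_eq]
    have : -(1 / 2) * t ^ 2 = -t ^ 2 / 2 := by ring
    rw [this]; ring
  -- The density has derivative `-t * npdf t` and vanishes at `-∞`. For `t ≤ x` the factor `-t` is
  -- at least `-x`, which turns this identity into the inequality.
  have hI : ∫ t in Set.Iic x, -t * npdf t = npdf x := by
    have := integral_Iic_of_hasDerivAt_of_tendsto' (a := x) (f := npdf) (m := 0)
      (fun t _ => hasDerivAt_npdf t) hint.integrableOn hT
    simpa using this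
  rw [← hI, ncdf_eq_integral, ← integral_const_mul, ← integral_neg]
  refine setIntegral_mono_on ((integrable_npdf.const_mul x).neg).integrableOn
    hint.integrableOn measurableSet_Iic fun t ht => ?_
  have ht : t ≤ x := ht
  nlinarith [npdf_pos t]

/-- The Mills ratio of the lower tail. -/
def mills (x : ℝ) : ℝ := ncdf x / npdf x

lemma mills_nonneg (x : ℝ) : 0 ≤ mills x := div_nonneg (ncdf_nonneg x) (npdf_pos x).le

/-- Mills' inequality divided by the density. The expression is also the derivative of `mills`. -/
lemma mul_mills_ge (x : ℝ) : 0 ≤ 1 + x * mills x := by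
  have h := neg_mul_ncdf_le x
  have hp := npdf_pos x
  have : 1 + x * mills x = (npdf x + x * ncdf x) / npdf x := by
    rw [mills]; field_simp
  rw [this]
  exact div_nonneg (by linarith) hp.le

/-- Left of `-1`, Mills' inequality already bounds the ratio by `1`. On `(-1, 0]` the density is at
least `1 / 6` and the distribution function at most `1`; this is where the constant comes from. -/
lemma mills_le {x : ℝ} (hx : x ≤ 0) : mills x ≤ 6 := by
  rcases le_or_gt x (-1) with h | h
  · have h1 := mul_mills_ge x
    have h2 := mills_nonneg x
    nlinarith
  · have hp : 1 / 6 ≤ npdf x := by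
      rw [npdf_eq]
      have h1 : √(2 * Real.pi) ≤ 2.51 := by
        rw [Real.sqrt_le_left (by norm_num)]; nlinarith [Real.pi_lt_d2]
      have h2 : (2.51 : ℝ)⁻¹ ≤ (√(2 * Real.pi))⁻¹ :=
        inv_anti₀ (Real.sqrt_pos.2 (by positivity)) h1
      have h3 : 1 / 2 ≤ Real.exp (-x ^ 2 / 2) := by
        have := Real.add_one_le_exp (-x ^ 2 / 2)
        nlinarith
      have h4 : (2.51 : ℝ)⁻¹ * (1 / 2) ≤ _ := mul_le_mul h2 h3 (by norm_num) (by positivity)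
      exact le_trans (by norm_num) h4
    rw [mills, div_le_iff₀ (npdf_pos x)]
    linarith [ncdf_le_one x]

lemma hasDerivAt_mills (x : ℝ) : HasDerivAt mills (1 + x * mills x) x := by
  have h := (hasDerivAt_ncdf x).div (hasDerivAt_npdf x) (npdf_pos x).ne'
  refine h.congr_deriv ?_
  have := (npdf_pos x).ne'
  rw [mills]; field_simp; ring

/-- The slope of the Stein solution left of the jump. -/
lemma mills_slope {x z : ℝ} (h : x ≤ z) :
    0 ≤ (1 + x * mills x) * (1 - ncdf z) ∧ (1 + x * mills x) * (1 - ncdf z) ≤ 1 := by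
  have hz := ncdf_le_one z
  have hz0 := ncdf_nonneg z
  have h1 := mul_mills_ge x
  refine ⟨mul_nonneg h1 (by linarith), ?_⟩
  rcases le_or_gt x 0 with hx | hx
  · have := mul_nonpos_of_nonpos_of_nonneg hx (mills_nonneg x)
    nlinarith
  -- For `x > 0`, replace `z` by the smaller `x` and reflect: `mills x * (1 - ncdf x) = ncdf x *
  -- mills (-x)`. Since `x * mills (-x) ≤ 1`, the product is at most `1 - ncdf x + ncdf x`.
  · have h2 := mul_mills_ge (-x)
    have h3 := ncdf_mono h
    have h4 : (1 + x * mills x) * (1 - ncdf z) ≤ (1 + x * mills x) * (1 - ncdf x) := by gcongr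
    refine h4.trans ?_
    have h5 : mills x * (1 - ncdf x) = ncdf x * mills (-x) := by
      rw [mills, mills, npdf_neg, ncdf_neg]; ring
    nlinarith [ncdf_nonneg x]

lemma mills_mul_le {x z : ℝ} (h : x ≤ z) : mills x * (1 - ncdf z) ≤ 6 := by
  have hz := ncdf_le_one z
  have hz0 := ncdf_nonneg z
  rcases le_or_gt x 0 with hx | hx
  · nlinarith [mills_le hx, mills_nonneg x]
  · have h3 := ncdf_mono h
    have h4 : mills x * (1 - ncdf z) ≤ mills x * (1 - ncdf x) := by
      gcongr; exact mills_nonneg x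
    have h5 : mills x * (1 - ncdf x) = ncdf x * mills (-x) := by
      rw [mills, mills, npdf_neg, ncdf_neg]; ring
    have h6 := mills_le (x := -x) (by linarith)
    nlinarith [ncdf_nonneg x, mills_nonneg (-x), ncdf_le_one x]

/-- The bounded solution of the Stein equation for the half-line `(-∞, z]`. -/
def stein (z x : ℝ) : ℝ :=
  if x ≤ z then mills x * (1 - ncdf z) else ncdf z * mills (-x)

/-- The derivative of `stein z` (away from `z`). -/
def steinDeriv (z x : ℝ) : ℝ := x * stein z x + (if x ≤ z then 1 else 0) - ncdf z

lemma stein_of_ge {z x : ℝ} (h : z ≤ x) : stein z x = ncdf z * mills (-x) := by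
  rcases h.eq_or_lt with rfl | h
  · rw [stein, if_pos le_rfl, mills, mills, npdf_neg, ncdf_neg]; ring
  · rw [stein, if_neg (by linarith)]

/-- Right of the jump the solution is the mirror image of the left branch for `-z`, so every
estimate on the left transfers by reflection. -/
lemma stein_of_ge' {z x : ℝ} (h : z ≤ x) : stein z x = mills (-x) * (1 - ncdf (-z)) := by
  rw [stein_of_ge h, ncdf_neg]; ring

lemma stein_nonneg (z x : ℝ) : 0 ≤ stein z x := by
  rw [stein]
  split_ifs
  · exact mul_nonneg (mills_nonneg _) (by linarith [ncdf_le_one z])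
  · exact mul_nonneg (ncdf_nonneg _) (mills_nonneg _)

lemma stein_le (z x : ℝ) : stein z x ≤ 6 := by
  rcases le_total x z with h | h
  · rw [stein, if_pos h]; exact mills_mul_le h
  · rw [stein_of_ge' h]; exact mills_mul_le (neg_le_neg h)

lemma steinDeriv_of_le {z x : ℝ} (h : x ≤ z) :
    steinDeriv z x = (1 + x * mills x) * (1 - ncdf z) := by
  rw [steinDeriv, stein, if_pos h, if_pos h]; ring

lemma steinDeriv_of_gt {z x : ℝ} (h : z < x) :
    steinDeriv z x = -((1 + -x * mills (-x)) * (1 - ncdf (-z))) := by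
  rw [steinDeriv, stein_of_ge' h.le, if_neg (by linarith), ncdf_neg]; ring

lemma abs_steinDeriv_le (z x : ℝ) : |steinDeriv z x| ≤ 1 := by
  rcases le_or_gt x z with h | h
  · rw [steinDeriv_of_le h, abs_le]
    have := mills_slope h
    constructor <;> linarith
  · rw [steinDeriv_of_gt h, abs_neg, abs_le]
    have := mills_slope (neg_le_neg h.le)
    constructor <;> linarith

lemma hasDerivWithinAt_stein_Iic {z x : ℝ} (h : x ≤ z) :
    HasDerivWithinAt (stein z) (steinDeriv z x) (Set.Iic z) x := by
  rw [steinDeriv_of_le h]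
  refine ((hasDerivAt_mills x).mul_const _).hasDerivWithinAt.congr (fun y hy => ?_) ?_
  · rw [stein, if_pos (show y ≤ z from hy)]
  · rw [stein, if_pos h]

/-- The slope is written out because at `x = z` it is the right derivative, whereas `steinDeriv z z`
is the left one; the two differ by `1`. -/
lemma hasDerivWithinAt_stein_Ici {z x : ℝ} (h : z ≤ x) :
    HasDerivWithinAt (stein z) (-((1 + -x * mills (-x)) * (1 - ncdf (-z)))) (Set.Ici z) x := by
  have h1 : HasDerivAt (fun y => mills (-y) * (1 - ncdf (-z)))
      (-((1 + -x * mills (-x)) * (1 - ncdf (-z)))) x := by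
    have := ((hasDerivAt_mills (-x)).scomp x (hasDerivAt_neg x)).mul_const (1 - ncdf (-z))
    refine this.congr_deriv ?_
    simp; ring
  refine h1.hasDerivWithinAt.congr (fun y hy => ?_) ?_
  · exact stein_of_ge' hy
  · exact stein_of_ge' h

lemma hasDerivAt_stein {z x : ℝ} (h : x ≠ z) : HasDerivAt (stein z) (steinDeriv z x) x := by
  rcases lt_or_gt_of_ne h with h | h
  · exact (hasDerivWithinAt_stein_Iic h.le).hasDerivAt (Iic_mem_nhds h)
  · rw [steinDeriv_of_gt h]
    exact (hasDerivWithinAt_stein_Ici h.le).hasDerivAt (Ici_mem_nhds h)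

lemma stein_lipschitz_of_le {z x y : ℝ} (hxy : x ≤ y) :
    |stein z y - stein z x| ≤ y - x := by
  have hL : ∀ x y, x ≤ y → y ≤ z → |stein z y - stein z x| ≤ y - x := by
    intro x y hxy hy
    have := (convex_Iic z).norm_image_sub_le_of_norm_hasDerivWithin_le (C := 1)
      (fun w hw => hasDerivWithinAt_stein_Iic hw) (fun w _ => abs_steinDeriv_le z w)
      (show x ∈ Set.Iic z from hxy.trans hy) (show y ∈ Set.Iic z from hy)
    simpa [abs_of_nonneg (sub_nonneg.2 hxy)] using this
  have hR : ∀ x y, x ≤ y → z ≤ x → |stein z y - stein z x| ≤ y - x := by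
    intro x y hxy hx
    have := (convex_Ici z).norm_image_sub_le_of_norm_hasDerivWithin_le (C := 1)
      (fun w hw => hasDerivWithinAt_stein_Ici hw) (fun w hw => by
        have := mills_slope (neg_le_neg (show z ≤ w from hw))
        rw [norm_neg, Real.norm_eq_abs, abs_le]
        constructor <;> linarith)
      (show x ∈ Set.Ici z from hx) (show y ∈ Set.Ici z from hx.trans hxy)
    simpa [abs_of_nonneg (sub_nonneg.2 hxy)] using this
  rcases le_total y z with h | h
  · exact hL x y hxy h
  rcases le_total z x with h' | h'
  · exact hR x y hxy h'
  · have h1 := hL x z h' le_rfl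
    have h2 := hR z y h le_rfl
    calc |stein z y - stein z x| ≤ |stein z y - stein z z| + |stein z z - stein z x| :=
          abs_sub_le _ _ _
      _ ≤ y - x := by linarith

lemma stein_lipschitz (z x t : ℝ) : |stein z (x + t) - stein z x| ≤ |t| := by
  rcases le_total 0 t with h | h
  · have := stein_lipschitz_of_le (z := z) (x := x) (y := x + t) (by linarith)
    rw [abs_of_nonneg h]; linarith
  · have := stein_lipschitz_of_le (z := z) (x := x + t) (y := x) (by linarith)
    rw [abs_of_nonpos h, abs_sub_comm]; linarith

lemma continuous_stein (z : ℝ) : Continuous (stein z) := by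
  refine (LipschitzWith.of_dist_le_mul (K := 1) fun x y => ?_).continuous
  have := stein_lipschitz z y (x - y)
  simpa [Real.dist_eq] using this

lemma measurable_steinDeriv (z : ℝ) : Measurable (steinDeriv z) := by
  unfold steinDeriv
  refine ((measurable_id.mul (continuous_stein z).measurable).add ?_).sub_const _
  exact Measurable.ite measurableSet_Iic measurable_const measurable_const

/-- By the Stein equation the derivative is `x * stein z x` plus an indicator minus a constant. The
product has increments of order `|t| (6 + |x|)`, because `stein z` is bounded by `6` and
1-Lipschitz; the indicator can only change when `z` is within `|t|` of `x`. -/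
lemma steinDeriv_sub_le (z x t : ℝ) :
    |steinDeriv z (x + t) - steinDeriv z x|
      ≤ |t| * (6 + |x|) + (if |x - z| ≤ |t| then 1 else 0) := by
  have h1 : |(x + t) * stein z (x + t) - x * stein z x| ≤ |t| * (6 + |x|) := by
    have e : (x + t) * stein z (x + t) - x * stein z x
        = t * stein z (x + t) + x * (stein z (x + t) - stein z x) := by ring
    rw [e]
    refine (abs_add_le _ _).trans ?_
    rw [abs_mul, abs_mul, abs_of_nonneg (stein_nonneg z (x + t))]
    have a := stein_le z (x + t)
    have b := stein_lipschitz z x t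
    nlinarith [abs_nonneg t, abs_nonneg x]
  have h2 : |(if x + t ≤ z then (1 : ℝ) else 0) - (if x ≤ z then 1 else 0)|
      ≤ if |x - z| ≤ |t| then 1 else 0 := by
    by_cases hc : |x - z| ≤ |t|
    · rw [if_pos hc]
      split_ifs <;> norm_num
    · rw [if_neg hc]
      have : (x + t ≤ z) ↔ (x ≤ z) := by
        push Not at hc
        constructor
        · intro h; by_contra h'
          push Not at h'
          rw [abs_of_pos (a := x - z) (by linarith)] at hc
          linarith [neg_abs_le t]
        · intro h
          rw [abs_of_nonpos (a := x - z) (by linarith)] at hc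
          linarith [le_abs_self t]
      simp [this]
  have e : steinDeriv z (x + t) - steinDeriv z x
      = ((x + t) * stein z (x + t) - x * stein z x)
        + ((if x + t ≤ z then (1 : ℝ) else 0) - (if x ≤ z then 1 else 0)) := by
    rw [steinDeriv, steinDeriv]; ring
  rw [e]
  exact (abs_add_le _ _).trans (add_le_add h1 h2)

/-- Away from the jump this is the mean value inequality with `steinDeriv_sub_le` along the segment.
Near the jump no smoothness is available, but the increment and its linear approximation are each at
most `|t|`, hence the `2`. -/
lemma stein_taylor (z x t : ℝ) :
    |stein z (x + t) - stein z x - t * steinDeriv z x|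
      ≤ |t| * (|t| * (6 + |x|) + (if |x - z| ≤ |t| then 2 else 0)) := by
  by_cases hc : |x - z| ≤ |t|
  · rw [if_pos hc]
    have h1 := stein_lipschitz z x t
    have h2 : |t * steinDeriv z x| ≤ |t| := by
      rw [abs_mul]; nlinarith [abs_steinDeriv_le z x, abs_nonneg t]
    have h3 := abs_sub (stein z (x + t) - stein z x) (t * steinDeriv z x)
    have h4 : 0 ≤ |t| * (|t| * (6 + |x|)) := by positivity
    nlinarith
  · rw [if_neg hc, add_zero]
    have key := (convex_uIcc x (x + t)).norm_image_sub_le_of_norm_hasDerivWithin_le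
      (f := fun y => stein z y - y * steinDeriv z x)
      (f' := fun y => steinDeriv z y - 1 * steinDeriv z x) (C := |t| * (6 + |x|))
      (fun y hy => ?_) (fun y hy => ?_) Set.left_mem_uIcc Set.right_mem_uIcc
    · have e : stein z (x + t) - stein z x - t * steinDeriv z x
        = stein z (x + t) - (x + t) * steinDeriv z x - (stein z x - x * steinDeriv z x) := by ring
      rw [e]
      refine key.trans (le_of_eq ?_)
      rw [add_sub_cancel_left, Real.norm_eq_abs]; ring
    · have hyt : |y - x| ≤ |t| := by
        have := Set.abs_sub_left_of_mem_uIcc hy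
        simpa using this
      have hne : y ≠ z := by
        rintro rfl
        rw [abs_sub_comm] at hyt
        exact hc hyt
      exact ((hasDerivAt_stein hne).sub
        ((hasDerivAt_id y).mul_const (steinDeriv z x))).hasDerivWithinAt
    · have hyt : |y - x| ≤ |t| := by
        have := Set.abs_sub_left_of_mem_uIcc hy
        simpa using this
      have h := steinDeriv_sub_le z x (y - x)
      rw [if_neg (fun h' => hc (h'.trans hyt)), add_zero, add_sub_cancel] at h
      rw [one_mul, Real.norm_eq_abs]
      refine h.trans ?_
      gcongr

/-! ### A randomized concentration inequality -/

/-- Truncation of `x` to `[-d, d]`. -/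
def clip (d x : ℝ) : ℝ := max (-d) (min d x)

lemma abs_clip_le {d : ℝ} (hd : 0 ≤ d) (x : ℝ) : |clip d x| ≤ d := by
  rw [clip, abs_le]
  exact ⟨le_max_left _ _, max_le (by linarith) (min_le_left _ _)⟩

lemma abs_clip_sub_le (d d' x : ℝ) : |clip d x - clip d' x| ≤ |d - d'| := by
  rw [clip, clip]
  refine (abs_max_sub_max_le_max _ _ _ _).trans (max_le ?_ ?_)
  · rw [neg_sub_neg, abs_sub_comm]
  · exact (abs_min_sub_min_le_max _ _ _ _).trans (max_le le_rfl (by simp))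

lemma clip_mono (d : ℝ) : Monotone (clip d) := fun _ _ h =>
  max_le_max le_rfl (min_le_min le_rfl h)

lemma clip_of_abs_le {d x : ℝ} (h : |x| ≤ d) : clip d x = x := by
  rw [abs_le] at h
  rw [clip, min_eq_right h.2, max_eq_right h.1]

/-- `clip (D + δ)` is nondecreasing, so the right side is never negative. Its slope is `1` on a
window extending `δ` beyond `[-D, D]`, so a step `x` from a point of `[-D, D]` changes it by at
least `min |x| δ`. -/
lemma clip_increment {D δ w x : ℝ} (hD : 0 ≤ D) (hδ : 0 ≤ δ) :
    (if |w| ≤ D then |x| * min |x| δ else 0) ≤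
      x * (clip (D + δ) w - clip (D + δ) (w - x)) := by
  split_ifs with h
  · have hw : clip (D + δ) w = w := clip_of_abs_le (by linarith)
    rw [hw]
    rw [abs_le] at h
    rcases le_total 0 x with hx | hx
    · rw [abs_of_nonneg hx]
      refine mul_le_mul_of_nonneg_left ?_ hx
      rw [clip, min_eq_right (show w - x ≤ D + δ by linarith)]
      rcases le_total (-(D + δ)) (w - x) with h1 | h1
      · rw [max_eq_right h1]; linarith [min_le_left x δ]
      · rw [max_eq_left h1]; linarith [min_le_right x δ]
    · rw [abs_of_nonpos hx]
      have : min (-x) δ ≤ clip (D + δ) (w - x) - w := by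
        rw [clip, max_eq_right (le_min (by linarith) (by linarith))]
        rcases le_total (D + δ) (w - x) with h1 | h1
        · rw [min_eq_left h1]; linarith [min_le_right (-x) δ]
        · rw [min_eq_right h1]; linarith [min_le_left (-x) δ]
      nlinarith
  · rcases le_total 0 x with hx | hx
    · exact mul_nonneg hx (sub_nonneg.2 (clip_mono _ (by linarith)))
    · exact mul_nonneg_of_nonpos_of_nonpos hx (sub_nonpos.2 (clip_mono _ (by linarith)))

lemma measurable_clip {Ω : Type*} [MeasurableSpace Ω] {f g : Ω → ℝ} (hf : Measurable f)
    (hg : Measurable g) : Measurable fun ω => clip (f ω) (g ω) :=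
  hf.neg.max (hf.min hg)

section abstract_sum

variable {Ω : Type*} {mΩ : MeasurableSpace Ω} {μ : Measure Ω}

lemma integral_abs_le_sqrt [IsProbabilityMeasure μ] {X : Ω → ℝ} (hX : MemLp X 2 μ) :
    ∫ ω, |X ω| ∂μ ≤ √(∫ ω, X ω ^ 2 ∂μ) := by
  have h := variance_nonneg (fun ω => |X ω|) μ
  rw [variance_eq_sub (X := fun ω => |X ω|) hX.abs] at h
  refine Real.le_sqrt_of_sq_le ?_
  simpa [Pi.pow_def] using h

lemma integrable_mul_of_memLp_two {X Y : Ω → ℝ} (hX : MemLp X 2 μ) (hY : MemLp Y 2 μ) :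
    Integrable (fun ω => X ω * Y ω) μ := hX.integrable_mul hY

/-- Independent centered summands with finite third moments whose variances add up to `1`. -/
structure StdSummands {ι : Type*} [Fintype ι] (μ : Measure Ω) (ξ : ι → Ω → ℝ) : Prop where
  meas : ∀ i, Measurable (ξ i)
  memLp : ∀ i, MemLp (ξ i) 3 μ
  mean : ∀ i, ∫ ω, ξ i ω ∂μ = 0
  indep : iIndepFun ξ μ
  var : ∑ i, ∫ ω, ξ i ω ^ 2 ∂μ = 1

namespace StdSummands

variable {ι : Type*} [Fintype ι] {ξ : ι → Ω → ℝ}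

lemma measurable_sum (h : StdSummands μ ξ) : Measurable fun ω => ∑ i, ξ i ω :=
  Finset.measurable_fun_sum _ fun i _ => h.meas i

lemma variance_eq (h : StdSummands μ ξ) (i : ι) : Var[ξ i; μ] = ∫ ω, ξ i ω ^ 2 ∂μ :=
  variance_of_integral_eq_zero (h.meas i).aemeasurable (h.mean i)

lemma integrable_cube (h : StdSummands μ ξ) (i : ι) : Integrable (fun ω => |ξ i ω| ^ 3) μ := by
  simpa using (h.memLp i).integrable_norm_pow (by norm_num)

/-- If the third moments vanished, so would all summands, against the total variance `1`. Positivity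
lets half of this sum serve as the margin `δ`, which occurs in denominators. -/
lemma beta_pos (h : StdSummands μ ξ) : 0 < ∑ i, ∫ ω, |ξ i ω| ^ 3 ∂μ := by
  have hnn : ∀ i, 0 ≤ ∫ ω, |ξ i ω| ^ 3 ∂μ := fun i => integral_nonneg fun ω => by positivity
  refine (Finset.sum_nonneg fun i _ => hnn i).lt_of_ne fun h0 => ?_
  have h1 := (Finset.sum_eq_zero_iff_of_nonneg fun i _ => hnn i).1 h0.symm
  have h2 : ∑ i, ∫ ω, ξ i ω ^ 2 ∂μ = 0 := by
    refine Finset.sum_eq_zero fun i hi => ?_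
    have h3 := (integral_eq_zero_iff_of_nonneg (fun ω => by positivity)
      (h.integrable_cube i)).1 (h1 i hi)
    rw [← integral_zero Ω ℝ (μ := μ)]
    refine integral_congr_ae (h3.mono fun ω hω => ?_)
    have : ξ i ω = 0 := by simpa using hω
    simp [this]
  rw [h.var] at h2
  exact one_ne_zero h2

variable [IsProbabilityMeasure μ]

lemma memLp_two (h : StdSummands μ ξ) (i : ι) : MemLp (ξ i) 2 μ :=
  (h.memLp i).mono_exponent (by norm_num)

lemma memLp_sum (h : StdSummands μ ξ) : MemLp (fun ω => ∑ i, ξ i ω) 2 μ :=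
  memLp_finsetSum _ fun i _ => h.memLp_two i

lemma integrable (h : StdSummands μ ξ) (i : ι) : Integrable (ξ i) μ :=
  (h.memLp_two i).integrable one_le_two

lemma integral_sum_sq (h : StdSummands μ ξ) (s : Finset ι) :
    ∫ ω, (∑ i ∈ s, ξ i ω) ^ 2 ∂μ = ∑ i ∈ s, ∫ ω, ξ i ω ^ 2 ∂μ := by
  have h0 : ∫ ω, (∑ i ∈ s, ξ i) ω ∂μ = 0 := by
    simp only [Finset.sum_apply]
    rw [integral_finsetSum _ fun i _ => h.integrable i]
    exact Finset.sum_eq_zero fun i _ => h.mean i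
  have h1 := IndepFun.variance_sum (s := s) (fun i _ => h.memLp_two i)
    (fun i _ j _ hij => h.indep.indepFun hij)
  rw [variance_of_integral_eq_zero
    (Finset.aemeasurable_sum _ fun i _ => (h.meas i).aemeasurable) h0] at h1
  simp only [Finset.sum_apply] at h1
  rw [h1]
  exact Finset.sum_congr rfl fun i _ => h.variance_eq i

lemma integral_abs_sum_le (h : StdSummands μ ξ) (s : Finset ι) :
    ∫ ω, |∑ i ∈ s, ξ i ω| ∂μ ≤ 1 := by
  refine (integral_abs_le_sqrt (memLp_finsetSum _ fun i _ => h.memLp_two i)).trans ?_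
  rw [h.integral_sum_sq]
  refine Real.sqrt_le_one.2 (le_trans ?_ h.var.le)
  exact Finset.sum_le_univ_sum_of_nonneg fun i => integral_nonneg fun ω => sq_nonneg _

/-- The expectation of `W * clip (|Δ| + δ) (W - z)` is estimated in two ways. From above, the
clipped factor is at most `|Δ| + δ` in absolute value. From below, write `W` as the sum of the `ξ i`
and remove `ξ i` from the argument of the `i`-th clip: the cost is controlled by `B i`, and by
`clip_increment` the gain is at least `η i = |ξ i| * min |ξ i| δ` on the event `A` in question. The
sum `H` of the `η i` has mean at least `1 / 2` and standard deviation at most `δ`, so its integral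
over `A` is at least `μ A / 2 - δ`. -/
theorem concentration (h : StdSummands μ ξ) {Δ : Ω → ℝ} (hΔm : Measurable Δ)
    (hΔ : MemLp Δ 2 μ) (z : ℝ) {δ : ℝ} (hδ : δ = (∑ i, ∫ ω, |ξ i ω| ^ 3 ∂μ) / 2) {B : ι → ℝ}
    (hB : ∀ i, -B i ≤ ∫ ω, ξ i ω * clip (|Δ ω| + δ) ((∑ j, ξ j ω) - ξ i ω - z) ∂μ) :
    μ.real {ω | |(∑ j, ξ j ω) - z| ≤ |Δ ω|} ≤
      2 * (∫ ω, |(∑ j, ξ j ω) * Δ ω| ∂μ + ∑ i, B i + 2 * δ) := by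
  set W : Ω → ℝ := fun ω => ∑ j, ξ j ω with hW
  have hβ := h.beta_pos
  have hδ0 : 0 < δ := by rw [hδ]; positivity
  have hWm : Measurable W := h.measurable_sum
  have hW2 : MemLp W 2 μ := h.memLp_sum
  set A : Set Ω := {ω | |W ω - z| ≤ |Δ ω|} with hA
  have hAm : MeasurableSet A := measurableSet_le (hWm.sub_const z).abs hΔm.abs
  have hdom : MemLp (fun ω => |Δ ω| + δ) 2 μ := hΔ.abs.add (memLp_const δ)
  have hclip : ∀ g : Ω → ℝ, Measurable g → MemLp (fun ω => clip (|Δ ω| + δ) (g ω)) 2 μ := by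
    intro g hg
    refine hdom.mono (measurable_clip (hΔm.abs.add_const δ) hg).aestronglyMeasurable
      (Filter.Eventually.of_forall fun ω => ?_)
    have hp : 0 ≤ |Δ ω| + δ := by positivity
    rw [Real.norm_eq_abs, Real.norm_eq_abs, abs_of_nonneg hp]
    exact abs_clip_le hp _
  set η : ι → Ω → ℝ := fun i ω => |ξ i ω| * min |ξ i ω| δ with hη
  have hηm : ∀ i, Measurable (η i) := fun i =>
    (h.meas i).abs.mul ((h.meas i).abs.min measurable_const)
  have hη0 : ∀ i ω, 0 ≤ η i ω := fun i ω =>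
    mul_nonneg (abs_nonneg _) (le_min (abs_nonneg _) hδ0.le)
  have hηδ : ∀ i ω, η i ω ≤ δ * |ξ i ω| := fun i ω => by
    rw [mul_comm δ]
    exact mul_le_mul_of_nonneg_left (min_le_right _ _) (abs_nonneg _)
  have hηL : ∀ i, MemLp (η i) 2 μ := fun i => by
    refine ((h.memLp_two i).const_mul δ).mono (hηm i).aestronglyMeasurable
      (Filter.Eventually.of_forall fun ω => ?_)
    rw [Real.norm_eq_abs, Real.norm_eq_abs, abs_mul δ, abs_of_pos hδ0, abs_of_nonneg (hη0 i ω)]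
    exact hηδ i ω
  have hηI : ∀ i, Integrable (η i) μ := fun i => (hηL i).integrable one_le_two
  -- upper bound
  have hup : ∫ ω, W ω * clip (|Δ ω| + δ) (W ω - z) ∂μ ≤ ∫ ω, |W ω * Δ ω| ∂μ + δ := by
    have hi1 : Integrable (fun ω => |W ω * Δ ω|) μ := (hW2.integrable_mul hΔ).abs
    have hi2 : Integrable (fun ω => δ * |W ω|) μ :=
      ((hW2.integrable one_le_two).abs).const_mul δ
    calc ∫ ω, W ω * clip (|Δ ω| + δ) (W ω - z) ∂μ
        ≤ ∫ ω, (|W ω * Δ ω| + δ * |W ω|) ∂μ := by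
          refine integral_mono (hW2.integrable_mul (hclip _ (hWm.sub_const z))) (hi1.add hi2)
            fun ω => ?_
          have hp : 0 ≤ |Δ ω| + δ := by positivity
          refine (le_abs_self _).trans ?_
          simp only [abs_mul]
          nlinarith [abs_clip_le hp (W ω - z), abs_nonneg (W ω)]
      _ = ∫ ω, |W ω * Δ ω| ∂μ + δ * ∫ ω, |W ω| ∂μ := by
          rw [integral_add hi1 hi2, integral_const_mul]
      _ ≤ _ := by
          have := h.integral_abs_sum_le Finset.univ
          have : ∫ ω, |W ω| ∂μ ≤ 1 := this
          nlinarith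
  -- lower bound
  have hlow : ∑ i, ∫ ω in A, η i ω ∂μ - ∑ i, B i ≤
      ∫ ω, W ω * clip (|Δ ω| + δ) (W ω - z) ∂μ := by
    have e : ∫ ω, W ω * clip (|Δ ω| + δ) (W ω - z) ∂μ
        = ∑ i, ∫ ω, ξ i ω * clip (|Δ ω| + δ) (W ω - z) ∂μ := by
      rw [← integral_finsetSum _ fun i _ =>
        integrable_mul_of_memLp_two (h.memLp_two i) (hclip _ (hWm.sub_const z))]
      simp only [hW, Finset.sum_mul]
    rw [e, ← Finset.sum_sub_distrib]
    refine Finset.sum_le_sum fun i _ => ?_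
    have m2 : Measurable fun ω => W ω - ξ i ω - z := (hWm.sub (h.meas i)).sub_const z
    have i1 := integrable_mul_of_memLp_two (h.memLp_two i) (hclip _ (hWm.sub_const z))
    have i2 := integrable_mul_of_memLp_two (h.memLp_two i) (hclip _ m2)
    have h1 : ∫ ω in A, η i ω ∂μ ≤ ∫ ω, ξ i ω * clip (|Δ ω| + δ) (W ω - z) ∂μ
        - ∫ ω, ξ i ω * clip (|Δ ω| + δ) (W ω - ξ i ω - z) ∂μ := by
      rw [← integral_sub i1 i2, ← integral_indicator hAm]
      refine integral_mono ((hηI i).indicator hAm) (i1.sub i2) fun ω => ?_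
      have := clip_increment (D := |Δ ω|) (δ := δ) (w := W ω - z) (x := ξ i ω)
        (abs_nonneg _) hδ0.le
      have e2 : W ω - z - ξ i ω = W ω - ξ i ω - z := by ring
      rw [e2] at this
      simp only [Set.indicator_apply, hA, Set.mem_ofPred_eq]
      simpa [mul_sub] using this
    linarith [hB i]
  -- fluctuations
  set H : Ω → ℝ := fun ω => ∑ i, η i ω with hH
  have hHL : MemLp H 2 μ := memLp_finsetSum _ fun i _ => hηL i
  have hHI : Integrable H μ := hHL.integrable one_le_two
  have hEH : 1 / 2 ≤ ∫ ω, H ω ∂μ := by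
    have e : ∫ ω, H ω ∂μ = ∑ i, ∫ ω, η i ω ∂μ := integral_finsetSum _ fun i _ => hηI i
    -- `(x - 2 * δ) ^ 2 ≥ 0` gives `min x δ ≥ x - x ^ 2 / (4 * δ)`. With `δ` half the sum of the
    -- third moments, the total loss is exactly half of the total variance `1`.
    have h1 : ∀ i, ∫ ω, ξ i ω ^ 2 ∂μ - (∫ ω, |ξ i ω| ^ 3 ∂μ) / (4 * δ) ≤ ∫ ω, η i ω ∂μ := by
      intro i
      rw [← integral_div, ← integral_sub (h.memLp_two i).integrable_sq
        ((h.integrable_cube i).div_const _)]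
      refine integral_mono ((h.memLp_two i).integrable_sq.sub
        ((h.integrable_cube i).div_const _)) (hηI i) fun ω => ?_
      simp only [hη]
      have hx := abs_nonneg (ξ i ω)
      rw [← sq_abs]
      generalize |ξ i ω| = x at hx
      have h3 : x - x ^ 2 / (4 * δ) ≤ min x δ := by
        refine le_min ?_ ?_
        · have : 0 ≤ x ^ 2 / (4 * δ) := by positivity
          linarith
        · rw [sub_le_iff_le_add, ← sub_le_iff_le_add', le_div_iff₀ (by positivity)]
          nlinarith [sq_nonneg (x - 2 * δ)]
      calc x ^ 2 - x ^ 3 / (4 * δ) = x * (x - x ^ 2 / (4 * δ)) := by ring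
        _ ≤ _ := mul_le_mul_of_nonneg_left h3 hx
    have h2 := Finset.sum_le_sum fun i (_ : i ∈ Finset.univ) => h1 i
    rw [Finset.sum_sub_distrib, h.var, ← Finset.sum_div] at h2
    rw [e]
    have h3 : (∑ i, ∫ ω, |ξ i ω| ^ 3 ∂μ) / (4 * δ) = 1 / 2 := by
      rw [hδ]; field_simp; norm_num
    linarith
  -- The `η i` are independent and `η i ≤ δ * |ξ i|`, so the variance of `H` is at most `δ ^ 2`
  -- times the total variance `1`.
  have hfl : ∫ ω, |H ω - ∫ ω', H ω' ∂μ| ∂μ ≤ δ := by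
    refine (integral_abs_le_sqrt (hHL.sub (memLp_const _))).trans ?_
    refine Real.sqrt_le_iff.2 ⟨hδ0.le, ?_⟩
    have e1 : ∫ ω, (H ω - ∫ ω', H ω' ∂μ) ^ 2 ∂μ = Var[H; μ] :=
      (variance_eq_integral hHL.aestronglyMeasurable.aemeasurable).symm
    have e2 : H = ∑ i, η i := by ext ω; simp [hH]
    have hind : iIndepFun η μ := h.indep.comp (fun _ x => |x| * min |x| δ)
      fun _ => by fun_prop
    have e3 := IndepFun.variance_sum (s := Finset.univ) (fun i _ => hηL i)
      (fun i _ j _ hij => hind.indepFun hij)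
    refine le_trans (le_of_eq e1) ?_
    rw [e2, e3]
    calc ∑ i, Var[η i; μ] ≤ ∑ i, δ ^ 2 * ∫ ω, ξ i ω ^ 2 ∂μ := by
          refine Finset.sum_le_sum fun i _ => ?_
          refine (variance_le_expectation_sq (hηm i).aestronglyMeasurable).trans ?_
          rw [← integral_const_mul]
          refine integral_mono (hηL i).integrable_sq
            ((h.memLp_two i).integrable_sq.const_mul _) fun ω => ?_
          have := hηδ i ω
          have h0 := hη0 i ω
          simp only [Pi.pow_apply]
          rw [← sq_abs (ξ i ω), ← mul_pow]
          exact pow_le_pow_left₀ h0 this 2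
      _ = δ ^ 2 := by rw [← Finset.mul_sum, h.var, mul_one]
  have hAH : μ.real A / 2 - δ ≤ ∑ i, ∫ ω in A, η i ω ∂μ := by
    rw [← integral_finsetSum _ fun i _ => (hηI i).integrableOn]
    have i3 : Integrable (fun ω => |H ω - ∫ ω', H ω' ∂μ|) μ :=
      (hHI.sub (integrable_const _)).abs
    have h1 : ∫ ω in A, (1 / 2 - |H ω - ∫ ω', H ω' ∂μ|) ∂μ ≤ ∫ ω in A, H ω ∂μ := by
      refine setIntegral_mono ((integrable_const _).sub i3).integrableOn hHI.integrableOn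
        fun ω => ?_
      linarith [neg_abs_le (H ω - ∫ ω', H ω' ∂μ)]
    rw [integral_sub (integrable_const _).integrableOn i3.integrableOn] at h1
    simp only [setIntegral_const, smul_eq_mul] at h1
    have h2 : ∫ ω in A, |H ω - ∫ ω', H ω' ∂μ| ∂μ ≤ ∫ ω, |H ω - ∫ ω', H ω' ∂μ| ∂μ :=
      setIntegral_le_integral i3 (Filter.Eventually.of_forall fun ω => abs_nonneg _)
    have h3 : ∫ ω in A, H ω ∂μ = ∫ ω in A, ∑ i, η i ω ∂μ := rfl
    linarith
  linarith

end StdSummands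

end abstract_sum

/-! ### The Berry–Esseen theorem for independent summands -/

namespace StdSummands

variable {Ω : Type*} {mΩ : MeasurableSpace Ω} {μ : Measure Ω} {ι : Type*}

/-- The standard deviation of a summand. -/
def sd (μ : Measure Ω) (ξ : ι → Ω → ℝ) (i : ι) : ℝ := √(∫ ω, ξ i ω ^ 2 ∂μ)

lemma sd_sq {ξ : ι → Ω → ℝ} (i : ι) : sd μ ξ i ^ 2 = ∫ ω, ξ i ω ^ 2 ∂μ :=
  Real.sq_sqrt (integral_nonneg fun _ => sq_nonneg _)

variable [Fintype ι] {ξ : ι → Ω → ℝ}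

lemma sum_sub_eq [DecidableEq ι] (ξ : ι → Ω → ℝ) (i : ι) (ω : Ω) :
    (∑ j, ξ j ω) - ξ i ω = ∑ j ∈ Finset.univ.erase i, ξ j ω := by
  rw [← Finset.add_sum_erase _ _ (Finset.mem_univ i)]; ring

lemma indepFun_rest (h : StdSummands μ ξ) (i : ι) :
    IndepFun (ξ i) (fun ω => (∑ j, ξ j ω) - ξ i ω) μ := by
  classical
  have h1 := (h.indep.indepFun_finsetSum_of_notMem h.meas
    (Finset.notMem_erase i Finset.univ)).symm
  convert h1 using 1
  ext ω
  rw [sum_sub_eq, Finset.sum_apply]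

lemma measurable_rest (h : StdSummands μ ξ) (i : ι) :
    Measurable (fun ω => (∑ j, ξ j ω) - ξ i ω) := h.measurable_sum.sub (h.meas i)

variable [IsProbabilityMeasure μ]

lemma integral_abs_rest_le (h : StdSummands μ ξ) (i : ι) :
    ∫ ω, |(∑ j, ξ j ω) - ξ i ω| ∂μ ≤ 1 := by
  classical
  simp only [sum_sub_eq]
  exact h.integral_abs_sum_le _

lemma memLp_rest (h : StdSummands μ ξ) (i : ι) :
    MemLp (fun ω => (∑ j, ξ j ω) - ξ i ω) 2 μ := h.memLp_sum.sub (h.memLp_two i)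

/-- The concentration of the sum itself. -/
lemma concentration_const (h : StdSummands μ ξ) (z : ℝ) {c : ℝ} (hc : 0 ≤ c) :
    μ.real {ω | |(∑ j, ξ j ω) - z| ≤ c} ≤ 2 * c + 2 * ∑ i, ∫ ω, |ξ i ω| ^ 3 ∂μ := by
  -- For constant `Δ` the clipped factor depends on the remaining sum only. It is independent of the
  -- centered `ξ i`, so `B` can be taken to be zero.
  have h1 := h.concentration (Δ := fun _ => c) measurable_const (memLp_const c) z rfl
    (B := fun _ => 0) (fun i => by
      have h2 := ((h.indepFun_rest i).comp (φ := id)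
        (ψ := fun x => clip (|c| + (∑ i, ∫ ω, |ξ i ω| ^ 3 ∂μ) / 2) (x - z)) measurable_id
        (measurable_clip measurable_const (measurable_id.sub_const z))).integral_mul_eq_mul_integral
        (h.meas i).aestronglyMeasurable ((measurable_clip measurable_const
          (measurable_id.sub_const z)).comp (h.measurable_rest i)).aestronglyMeasurable
      simp only [neg_zero]
      refine le_of_eq (Eq.trans ?_ h2.symm)
      simp [h.mean i])
  rw [abs_of_nonneg hc] at h1
  refine h1.trans ?_
  have h2 : ∫ ω, |(∑ j, ξ j ω) * c| ∂μ ≤ c := by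
    simp only [abs_mul, integral_mul_const, abs_of_nonneg hc]
    have := h.integral_abs_sum_le Finset.univ
    nlinarith
  simp only [Finset.sum_const_zero]
  linarith

/-- Lyapunov's inequality, obtained by integrating `2 x³ - 3 s x² + s³ = (x - s)² (2 x + s) ≥ 0`. -/
lemma sd_cube_le (h : StdSummands μ ξ) (i : ι) : sd μ ξ i ^ 3 ≤ ∫ ω, |ξ i ω| ^ 3 ∂μ := by
  have hs : 0 ≤ sd μ ξ i := Real.sqrt_nonneg _
  have hsq := sd_sq (μ := μ) (ξ := ξ) i
  set s := sd μ ξ i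
  have i2 := (h.memLp_two i).integrable_sq
  have h1 : ∫ ω, (3 * s * ξ i ω ^ 2 - s ^ 3) ∂μ ≤ ∫ ω, 2 * |ξ i ω| ^ 3 ∂μ := by
    refine integral_mono ((i2.const_mul _).sub (integrable_const _))
      ((h.integrable_cube i).const_mul 2) fun ω => ?_
    have hx := abs_nonneg (ξ i ω)
    rw [← sq_abs (ξ i ω)]
    generalize |ξ i ω| = x at hx
    nlinarith [mul_nonneg (sq_nonneg (x - s)) (by linarith : 0 ≤ 2 * x + s)]
  rw [integral_sub (i2.const_mul _) (integrable_const _), integral_const_mul, integral_const_mul,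
    ← hsq] at h1
  simp at h1
  nlinarith

lemma integral_abs_le_sd (h : StdSummands μ ξ) (i : ι) : ∫ ω, |ξ i ω| ∂μ ≤ sd μ ξ i :=
  integral_abs_le_sqrt (h.memLp_two i)

/-- Chebyshev's inequality, with the case of a vanishing standard deviation treated apart. -/
lemma prob_abs_le_two_sd (h : StdSummands μ ξ) (i : ι) :
    1 / 2 ≤ μ.real {ω | |ξ i ω| ≤ 2 * sd μ ξ i} := by
  have hs : 0 ≤ sd μ ξ i := Real.sqrt_nonneg _
  have hsq := sd_sq (μ := μ) (ξ := ξ) i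
  rcases hs.eq_or_lt with h0 | h0
  · rw [← h0] at hsq
    have h1 := (integral_eq_zero_iff_of_nonneg (fun ω => sq_nonneg (ξ i ω))
      (h.memLp_two i).integrable_sq).1 (by rw [← hsq]; norm_num)
    have h2 : ∀ᵐ ω ∂μ, ω ∈ {ω | |ξ i ω| ≤ 2 * sd μ ξ i} := h1.mono fun ω hω => by
      have : ξ i ω = 0 := by simpa using hω
      simp [this, ← h0]
    have h3 : μ {ω | |ξ i ω| ≤ 2 * sd μ ξ i} = 1 := by
      rw [← prob_compl_eq_zero_iff (measurableSet_le (h.meas i).abs measurable_const)]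
      exact h2
    rw [measureReal_def, h3]; norm_num
  · have hm : MeasurableSet {ω | |ξ i ω| ≤ 2 * sd μ ξ i} :=
      measurableSet_le (h.meas i).abs measurable_const
    have h1 : (2 * sd μ ξ i) ^ 2 * μ.real {ω | |ξ i ω| ≤ 2 * sd μ ξ i}ᶜ ≤ sd μ ξ i ^ 2 := by
      rw [hsq]
      have h2 : ∫ ω, Set.indicator {ω | |ξ i ω| ≤ 2 * sd μ ξ i}ᶜ
          (fun _ => (2 * sd μ ξ i) ^ 2) ω ∂μ ≤ ∫ ω, ξ i ω ^ 2 ∂μ := by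
        refine integral_mono ((integrable_const _).indicator hm.compl)
          (h.memLp_two i).integrable_sq fun ω => ?_
        by_cases hω : ω ∈ {ω | |ξ i ω| ≤ 2 * sd μ ξ i}ᶜ
        · rw [Set.indicator_of_mem hω]
          have : 2 * sd μ ξ i ≤ |ξ i ω| := by
            have : ¬ |ξ i ω| ≤ 2 * sd μ ξ i := hω
            linarith
          rw [← sq_abs (ξ i ω)]
          exact pow_le_pow_left₀ (by linarith) this 2
        · rw [Set.indicator_of_notMem hω]; positivity
      rwa [integral_indicator_const _ hm.compl, smul_eq_mul, mul_comm] at h2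
    rw [probReal_compl_eq_one_sub hm] at h1
    nlinarith [sq_pos_of_pos h0]

/-- The event is independent of `|ξ i| ≤ 2 * sd`, which has probability at least `1 / 2`. On the
intersection the full sum lies within `c + 2 * sd` of `z`, so twice the bound for the full sum
suffices. -/
lemma concentration_rest (h : StdSummands μ ξ) (i : ι) (z : ℝ) {c : ℝ} (hc : 0 ≤ c) :
    μ.real {ω | |(∑ j, ξ j ω) - ξ i ω - z| ≤ c} ≤
      4 * c + 8 * sd μ ξ i + 4 * ∑ i, ∫ ω, |ξ i ω| ^ 3 ∂μ := by
  have hs : 0 ≤ sd μ ξ i := Real.sqrt_nonneg _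
  have h1 := (h.indepFun_rest i).measure_inter_preimage_eq_mul
    {x | |x| ≤ 2 * sd μ ξ i} {x | |x - z| ≤ c}
    (measurableSet_le measurable_id.abs measurable_const)
    (measurableSet_le (measurable_id.sub_const z).abs measurable_const)
  have h2 := congrArg ENNReal.toReal h1
  rw [ENNReal.toReal_mul] at h2
  have h3 := h.concentration_const z (c := c + 2 * sd μ ξ i) (by positivity)
  have h4 : μ.real (ξ i ⁻¹' {x | |x| ≤ 2 * sd μ ξ i} ∩
      (fun ω => (∑ j, ξ j ω) - ξ i ω) ⁻¹' {x | |x - z| ≤ c}) ≤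
      μ.real {ω | |(∑ j, ξ j ω) - z| ≤ c + 2 * sd μ ξ i} := by
    refine measureReal_mono fun ω hω => ?_
    have a : |ξ i ω| ≤ 2 * sd μ ξ i := hω.1
    have b : |(∑ j, ξ j ω) - ξ i ω - z| ≤ c := hω.2
    show |(∑ j, ξ j ω) - z| ≤ _
    have e : (∑ j, ξ j ω) - z = ((∑ j, ξ j ω) - ξ i ω - z) + ξ i ω := by ring
    rw [e]
    exact (abs_add_le _ _).trans (add_le_add b a)
  have h5 := h.prob_abs_le_two_sd i
  have h6 : μ.real (ξ i ⁻¹' {x | |x| ≤ 2 * sd μ ξ i} ∩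
      (fun ω => (∑ j, ξ j ω) - ξ i ω) ⁻¹' {x | |x - z| ≤ c}) =
      μ.real {ω | |ξ i ω| ≤ 2 * sd μ ξ i} *
        μ.real {ω | |(∑ j, ξ j ω) - ξ i ω - z| ≤ c} := h2
  have h7 : 0 ≤ μ.real {ω | |(∑ j, ξ j ω) - ξ i ω - z| ≤ c} := measureReal_nonneg
  nlinarith

/-- The event that the jump of the Stein solution lies within `|ξ i|` of the remaining sum,
weighted by a function of `ξ i`. -/
lemma integral_near_le (h : StdSummands μ ξ) (i : ι) (z : ℝ) {q : ℝ → ℝ} (hq : Measurable q)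
    (hq0 : ∀ x, 0 ≤ q x) (hi : Integrable (fun ω => q (ξ i ω)) μ)
    (hi' : Integrable (fun ω => q (ξ i ω) * |ξ i ω|) μ) :
    ∫ ω, q (ξ i ω) * (if |(∑ j, ξ j ω) - ξ i ω - z| ≤ |ξ i ω| then 1 else 0) ∂μ ≤
      4 * ∫ ω, q (ξ i ω) * |ξ i ω| ∂μ +
        (8 * sd μ ξ i + 4 * ∑ i, ∫ ω, |ξ i ω| ^ 3 ∂μ) * ∫ ω, q (ξ i ω) ∂μ := by
  set V : Ω → ℝ := fun ω => (∑ j, ξ j ω) - ξ i ω with hV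
  have hVm : Measurable V := h.measurable_rest i
  set b := 8 * sd μ ξ i + 4 * ∑ i, ∫ ω, |ξ i ω| ^ 3 ∂μ with hb
  have hmap := (indepFun_iff_map_prod_eq_prod_map_map (h.meas i).aemeasurable
    hVm.aemeasurable).1 (h.indepFun_rest i)
  have : IsProbabilityMeasure (μ.map (ξ i)) := Measure.isProbabilityMeasure_map (h.meas i).aemeasurable
  have : IsProbabilityMeasure (μ.map V) := Measure.isProbabilityMeasure_map hVm.aemeasurable
  set F : ℝ × ℝ → ℝ := fun p => q p.1 * (if |p.2 - z| ≤ |p.1| then 1 else 0) with hF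
  have hS : MeasurableSet {p : ℝ × ℝ | |p.2 - z| ≤ |p.1|} :=
    measurableSet_le (by fun_prop) (by fun_prop)
  have hFm : Measurable F :=
    (hq.comp measurable_fst).mul (Measurable.ite hS measurable_const measurable_const)
  have hpm : Measurable fun ω => (ξ i ω, V ω) := (h.meas i).prodMk hVm
  have hFi : Integrable (fun ω => F (ξ i ω, V ω)) μ := by
    refine hi.mono (hFm.comp hpm).aestronglyMeasurable (Filter.Eventually.of_forall fun ω => ?_)
    rw [Real.norm_eq_abs, Real.norm_eq_abs, abs_of_nonneg (hq0 _)]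
    simp only [hF]
    split_ifs
    · rw [mul_one, abs_of_nonneg (hq0 _)]
    · simpa using hq0 _
  have e1 : ∫ ω, F (ξ i ω, V ω) ∂μ = ∫ x, ∫ y, F (x, y) ∂(μ.map V) ∂(μ.map (ξ i)) := by
    rw [← integral_map (f := F) hpm.aemeasurable hFm.aestronglyMeasurable, hmap, integral_prod]
    rw [← hmap]
    exact (integrable_map_measure hFm.aestronglyMeasurable hpm.aemeasurable).2 hFi
  -- With the value `x` of `ξ i` frozen, the inner integral is `q x` times the probability that the
  -- remaining sum falls within `|x|` of `z`.
  have hin : ∀ x, ∫ y, F (x, y) ∂(μ.map V) ≤ q x * (4 * |x| + b) := by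
    intro x
    simp only [hF, integral_const_mul]
    refine mul_le_mul_of_nonneg_left ?_ (hq0 x)
    have hset : MeasurableSet {y : ℝ | |y - z| ≤ |x|} :=
      measurableSet_le (by fun_prop) measurable_const
    have e : (fun y : ℝ => if |y - z| ≤ |x| then (1 : ℝ) else 0)
        = Set.indicator {y : ℝ | |y - z| ≤ |x|} 1 := by
      ext y; simp [Set.indicator_apply]
    rw [e, integral_indicator_one hset, map_measureReal_apply hVm hset, hb]
    have := h.concentration_rest i z (abs_nonneg x)
    refine this.trans (le_of_eq (by ring))
  show ∫ ω, F (ξ i ω, V ω) ∂μ ≤ _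
  have hqi : Integrable (fun x => q x * (4 * |x| + b)) (μ.map (ξ i)) := by
    rw [integrable_map_measure (by fun_prop) (h.meas i).aemeasurable]
    refine ((hi'.const_mul 4).add (hi.const_mul b)).congr (Filter.Eventually.of_forall fun ω => ?_)
    simp only [Function.comp, Pi.add_apply]; ring
  rw [e1]
  calc ∫ x, ∫ y, F (x, y) ∂(μ.map V) ∂(μ.map (ξ i))
      ≤ ∫ x, q x * (4 * |x| + b) ∂(μ.map (ξ i)) := by
        refine integral_mono ?_ hqi hin
        refine Integrable.integral_prod_left (f := F) ?_
        rw [← hmap]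
        exact (integrable_map_measure hFm.aestronglyMeasurable hpm.aemeasurable).2 hFi
    _ = ∫ ω, (4 * (q (ξ i ω) * |ξ i ω|) + b * q (ξ i ω)) ∂μ := by
        rw [integral_map (h.meas i).aemeasurable (by fun_prop)]
        exact integral_congr_ae (Filter.Eventually.of_forall fun ω => by ring)
    _ = _ := by
        rw [integral_add (hi'.const_mul 4) (hi.const_mul b), integral_const_mul,
          integral_const_mul]

/-- The contribution of one summand in Stein's method. -/
lemma stein_term (h : StdSummands μ ξ) (i : ι) (z : ℝ) :
    |∫ ω, ξ i ω * stein z (∑ j, ξ j ω) ∂μ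
        - (∫ ω, ξ i ω ^ 2 ∂μ) * ∫ ω, steinDeriv z (∑ j, ξ j ω) ∂μ| ≤
      50 * ∫ ω, |ξ i ω| ^ 3 ∂μ +
        12 * (∑ i, ∫ ω, |ξ i ω| ^ 3 ∂μ) * ∫ ω, ξ i ω ^ 2 ∂μ := by
  set V : Ω → ℝ := fun ω => (∑ j, ξ j ω) - ξ i ω with hV
  have hVm : Measurable V := h.measurable_rest i
  have hWV : ∀ ω, ∑ j, ξ j ω = V ω + ξ i ω := fun ω => by simp [hV]
  simp only [hWV]
  have hind := h.indepFun_rest i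
  set β := ∑ i, ∫ ω, |ξ i ω| ^ 3 ∂μ with hβ
  set τ := ∫ ω, |ξ i ω| ^ 3 ∂μ with hτ
  set s := sd μ ξ i with hs
  have hs0 : 0 ≤ s := Real.sqrt_nonneg _
  have hsq : ∫ ω, ξ i ω ^ 2 ∂μ = s ^ 2 := (sd_sq i).symm
  have hs3 : s ^ 3 ≤ τ := h.sd_cube_le i
  have ha : ∫ ω, |ξ i ω| ∂μ ≤ s := h.integral_abs_le_sd i
  have hβ0 : 0 < β := h.beta_pos
  have i2 := (h.memLp_two i).integrable_sq
  have i3 := h.integrable_cube i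
  have iξ := h.integrable i
  have iV : Integrable V μ := (h.memLp_rest i).integrable one_le_two
  have hEV : ∫ ω, |V ω| ∂μ ≤ 1 := h.integral_abs_rest_le i
  set N : Ω → ℝ := fun ω => if |V ω - z| ≤ |ξ i ω| then 1 else 0 with hN
  have hNm : Measurable N :=
    Measurable.ite (measurableSet_le (hVm.sub_const z).abs (h.meas i).abs)
      measurable_const measurable_const
  have hNb : ∀ ω, 0 ≤ N ω ∧ N ω ≤ 1 := fun ω => by
    simp only [hN]; split_ifs <;> norm_num
  -- bounded functions of `V` and of the sum
  have hfb : ∀ x, |stein z x| ≤ 6 := fun x => by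
    rw [abs_of_nonneg (stein_nonneg z x)]; exact stein_le z x
  have mf : Measurable (stein z) := (continuous_stein z).measurable
  have md := measurable_steinDeriv z
  have mW : Measurable fun ω => V ω + ξ i ω := hVm.add (h.meas i)
  have bdd_mul : ∀ {X Y : Ω → ℝ} {c : ℝ}, Integrable X μ → Measurable Y → (∀ ω, |Y ω| ≤ c) →
      Integrable (fun ω => X ω * Y ω) μ := fun hX hY hc =>
    hX.mul_bdd hY.aestronglyMeasurable (Filter.Eventually.of_forall hc)
  have j1 : Integrable (fun ω => ξ i ω * stein z (V ω + ξ i ω)) μ :=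
    bdd_mul iξ (mf.comp mW) fun ω => hfb _
  have j2 : Integrable (fun ω => ξ i ω * stein z (V ω)) μ :=
    bdd_mul iξ (mf.comp hVm) fun ω => hfb _
  have j3 : Integrable (fun ω => ξ i ω ^ 2 * steinDeriv z (V ω)) μ :=
    bdd_mul i2 (md.comp hVm) fun ω => abs_steinDeriv_le _ _
  have jW : Integrable (fun ω => steinDeriv z (V ω + ξ i ω)) μ := by
    simpa using bdd_mul (integrable_const (1 : ℝ)) (md.comp mW) fun ω => abs_steinDeriv_le _ _
  have jV : Integrable (fun ω => steinDeriv z (V ω)) μ := by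
    simpa using bdd_mul (integrable_const (1 : ℝ)) (md.comp hVm) fun ω => abs_steinDeriv_le _ _
  -- Leave-one-out: `V` is independent of the centered `ξ i`. The zeroth-order term of the expansion
  -- of `stein z (V + ξ i)` about `V` thus drops out, and the first-order term factorizes.
  have z1 : ∫ ω, ξ i ω * stein z (V ω) ∂μ = 0 := by
    have := (hind.comp measurable_id mf).integral_mul_eq_mul_integral
      (h.meas i).aestronglyMeasurable (mf.comp hVm).aestronglyMeasurable
    refine this.trans ?_
    simp [h.mean i]
  have z2 : ∫ ω, ξ i ω ^ 2 * steinDeriv z (V ω) ∂μ = s ^ 2 * ∫ ω, steinDeriv z (V ω) ∂μ := by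
    have := (hind.comp (measurable_id.pow_const 2) md).integral_mul_eq_mul_integral
      ((h.meas i).pow_const 2).aestronglyMeasurable (md.comp hVm).aestronglyMeasurable
    rw [← hsq]
    exact this
  have prodV : ∀ {q : ℝ → ℝ}, Measurable q → Integrable (fun ω => q (ξ i ω)) μ →
      Integrable (fun ω => q (ξ i ω) * (6 + |V ω|)) μ ∧
      ∫ ω, q (ξ i ω) * (6 + |V ω|) ∂μ
        = (∫ ω, q (ξ i ω) ∂μ) * ∫ ω, (6 + |V ω|) ∂μ := by
    intro q hq hqi
    have hc := hind.comp hq (ψ := fun x => 6 + |x|) (by fun_prop)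
    refine ⟨hc.integrable_mul hqi ((integrable_const _).add iV.abs), ?_⟩
    exact hc.integral_mul_eq_mul_integral (hq.comp (h.meas i)).aestronglyMeasurable
      (measurable_const.add hVm.abs).aestronglyMeasurable
  have hE6 : ∫ ω, (6 + |V ω|) ∂μ ≤ 7 := by
    rw [integral_add (integrable_const _) iV.abs]
    simp; linarith
  have hE60 : 0 ≤ ∫ ω, (6 + |V ω|) ∂μ := integral_nonneg fun ω => by positivity
  -- the two error terms
  obtain ⟨k1, k1e⟩ := prodV (q := fun x => |x| ^ 3) (by fun_prop) i3
  obtain ⟨k2, k2e⟩ := prodV (q := fun x => |x|) (by fun_prop) iξ.abs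
  have n1 := h.integral_near_le i z (q := fun x => x ^ 2) (by fun_prop) (fun x => sq_nonneg x) i2
    (i3.congr (Filter.Eventually.of_forall fun ω => by
      simp only []; rw [← sq_abs (ξ i ω)]; ring))
  have n2 := h.integral_near_le i z (q := fun _ => 1) (by fun_prop) (fun x => zero_le_one)
    (integrable_const _) (by simpa using iξ.abs)
  have e3 : ∫ ω, ξ i ω ^ 2 * |ξ i ω| ∂μ = τ :=
    integral_congr_ae (Filter.Eventually.of_forall fun ω => by
      simp only []; rw [← sq_abs (ξ i ω)]; ring)
  simp only [e3, hsq] at n1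
  simp only [one_mul, integral_const, probReal_univ, smul_eq_mul, mul_one] at n2
  have l1 : Integrable (fun ω => ξ i ω ^ 2 * N ω) μ := bdd_mul i2 hNm (c := 1) fun ω => by
    rw [abs_of_nonneg (hNb ω).1]; exact (hNb ω).2
  have l2 : Integrable N μ := by
    simpa using bdd_mul (integrable_const (1 : ℝ)) hNm (c := 1) fun ω => by
      rw [abs_of_nonneg (hNb ω).1]; exact (hNb ω).2
  have E1 : |∫ ω, ξ i ω * stein z (V ω + ξ i ω) ∂μ - s ^ 2 * ∫ ω, steinDeriv z (V ω) ∂μ|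
      ≤ τ * 7 + 2 * (4 * τ + (8 * s + 4 * β) * s ^ 2) := by
    have e : ∫ ω, ξ i ω * stein z (V ω + ξ i ω) ∂μ - s ^ 2 * ∫ ω, steinDeriv z (V ω) ∂μ
        = ∫ ω, (ξ i ω * stein z (V ω + ξ i ω) - ξ i ω * stein z (V ω)
            - ξ i ω ^ 2 * steinDeriv z (V ω)) ∂μ := by
      have i12 := integral_sub j1 j2
      have i123 := integral_sub (j1.sub j2) j3
      simp only [Pi.sub_apply] at i123
      rw [i123, i12, z1, z2, sub_zero]
    rw [e]
    refine abs_integral_le_integral_abs.trans ?_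
    calc ∫ ω, |ξ i ω * stein z (V ω + ξ i ω) - ξ i ω * stein z (V ω)
            - ξ i ω ^ 2 * steinDeriv z (V ω)| ∂μ
        ≤ ∫ ω, (|ξ i ω| ^ 3 * (6 + |V ω|) + 2 * (ξ i ω ^ 2 * N ω)) ∂μ := by
          refine integral_mono ((j1.sub j2).sub j3).abs (k1.add (l1.const_mul 2)) fun ω => ?_
          have ht := stein_taylor z (V ω) (ξ i ω)
          have e' : ξ i ω * stein z (V ω + ξ i ω) - ξ i ω * stein z (V ω)
            - ξ i ω ^ 2 * steinDeriv z (V ω) = ξ i ω * (stein z (V ω + ξ i ω) - stein z (V ω)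
              - ξ i ω * steinDeriv z (V ω)) := by ring
          simp only []
          rw [e', abs_mul]
          refine (mul_le_mul_of_nonneg_left ht (abs_nonneg _)).trans (le_of_eq ?_)
          have e2 : (if |V ω - z| ≤ |ξ i ω| then (2 : ℝ) else 0) = 2 * N ω := by
            simp only [hN]; split_ifs <;> norm_num
          rw [e2, ← sq_abs (ξ i ω)]; ring
      _ ≤ _ := by
          rw [integral_add k1 (l1.const_mul 2), integral_const_mul, k1e]
          have hτ0 : 0 ≤ τ := integral_nonneg fun ω => by positivity
          have : τ * ∫ ω, (6 + |V ω|) ∂μ ≤ τ * 7 := mul_le_mul_of_nonneg_left hE6 hτ0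
          linarith
  have E2 : |∫ ω, steinDeriv z (V ω) ∂μ - ∫ ω, steinDeriv z (V ω + ξ i ω) ∂μ|
      ≤ s * 7 + (4 * s + (8 * s + 4 * β)) := by
    rw [abs_sub_comm, ← integral_sub jW jV]
    refine abs_integral_le_integral_abs.trans ?_
    calc ∫ ω, |steinDeriv z (V ω + ξ i ω) - steinDeriv z (V ω)| ∂μ
        ≤ ∫ ω, (|ξ i ω| * (6 + |V ω|) + N ω) ∂μ :=
          integral_mono (jW.sub jV).abs (k2.add l2) fun ω => steinDeriv_sub_le z (V ω) (ξ i ω)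
      _ ≤ _ := by
          rw [integral_add k2 l2, k2e]
          have : (∫ ω, |ξ i ω| ∂μ) * ∫ ω, (6 + |V ω|) ∂μ ≤ s * 7 :=
            mul_le_mul ha hE6 hE60 hs0
          linarith
  rw [hsq]
  -- The first bound contributes `15 τ + 16 s³ + 8 β s²`, the second times `s²` contributes `19 s³ +
  -- 4 β s²`. With `s³ ≤ τ` the sum is `50 τ + 12 β s²`.
  have key : ∀ a b c : ℝ, |a - s ^ 2 * b| ≤ τ * 7 + 2 * (4 * τ + (8 * s + 4 * β) * s ^ 2) →
      |b - c| ≤ s * 7 + (4 * s + (8 * s + 4 * β)) →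
      |a - s ^ 2 * c| ≤ 50 * τ + 12 * β * s ^ 2 := by
    intro a b c h1 h2
    have e : a - s ^ 2 * c = (a - s ^ 2 * b) + s ^ 2 * (b - c) := by ring
    rw [e]
    refine (abs_add_le _ _).trans ?_
    rw [abs_mul, abs_of_nonneg (sq_nonneg s)]
    have h3 := mul_le_mul_of_nonneg_left h2 (sq_nonneg s)
    nlinarith
  exact key _ _ _ E1 E2

/-- The Berry–Esseen theorem. -/
theorem berry_esseen (h : StdSummands μ ξ) (z : ℝ) :
    |μ.real {ω | ∑ j, ξ j ω ≤ z} - ncdf z| ≤ 62 * ∑ i, ∫ ω, |ξ i ω| ^ 3 ∂μ := by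
  set W : Ω → ℝ := fun ω => ∑ j, ξ j ω with hW
  have hWm : Measurable W := h.measurable_sum
  have mf : Measurable (stein z) := (continuous_stein z).measurable
  have hfb : ∀ x, |stein z x| ≤ 6 := fun x => by
    rw [abs_of_nonneg (stein_nonneg z x)]; exact stein_le z x
  have jf : ∀ {X : Ω → ℝ}, Integrable X μ → Integrable (fun ω => X ω * stein z (W ω)) μ :=
    fun hX => hX.mul_bdd (c := 6) (mf.comp hWm).aestronglyMeasurable
      (Filter.Eventually.of_forall fun ω => hfb _)
  have hS : MeasurableSet {ω | W ω ≤ z} := measurableSet_le hWm measurable_const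
  have jI : Integrable (fun ω => if W ω ≤ z then (1 : ℝ) else 0) μ := by
    have := (integrable_const (μ := μ) (1 : ℝ)).indicator hS
    refine this.congr (Filter.Eventually.of_forall fun ω => ?_)
    simp [Set.indicator_apply]
  have jWf := jf (h.memLp_sum.integrable one_le_two)
  have e1 : ∫ ω, steinDeriv z (W ω) ∂μ
      = ∫ ω, W ω * stein z (W ω) ∂μ + (μ.real {ω | W ω ≤ z} - ncdf z) := by
    simp only [steinDeriv]
    have i1 := integral_sub (jWf.add jI) (integrable_const (ncdf z))
    have i2 := integral_add jWf jI
    simp only [Pi.add_apply] at i1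
    refine i1.trans ?_
    rw [i2]
    have : ∫ ω, (if W ω ≤ z then (1 : ℝ) else 0) ∂μ = μ.real {ω | W ω ≤ z} := by
      rw [← integral_indicator_one hS]
      exact integral_congr_ae (Filter.Eventually.of_forall fun ω => by
        simp [Set.indicator_apply])
    rw [this]; simp; ring
  have e2 : ∫ ω, W ω * stein z (W ω) ∂μ = ∑ i, ∫ ω, ξ i ω * stein z (W ω) ∂μ := by
    rw [← integral_finsetSum _ fun i _ => jf (h.integrable i)]
    simp only [hW, Finset.sum_mul]
  -- Because the variances add up to `1`, the integrated Stein equation splits into one contribution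
  -- per summand; the constant is `50 + 12`.
  have e3 : μ.real {ω | W ω ≤ z} - ncdf z
      = -∑ i, (∫ ω, ξ i ω * stein z (W ω) ∂μ
        - (∫ ω, ξ i ω ^ 2 ∂μ) * ∫ ω, steinDeriv z (W ω) ∂μ) := by
    rw [Finset.sum_sub_distrib, ← Finset.sum_mul, h.var, one_mul, ← e2, e1]; ring
  show |μ.real {ω | W ω ≤ z} - ncdf z| ≤ _
  rw [e3, abs_neg]
  refine (Finset.abs_sum_le_sum_abs _ _).trans ?_
  refine (Finset.sum_le_sum fun i _ => h.stein_term i z).trans (le_of_eq ?_)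
  rw [Finset.sum_add_distrib, ← Finset.mul_sum, ← Finset.mul_sum, h.var]
  ring

end StdSummands

/-! ### Resampling coordinates of a product measure -/

lemma integral_comp_measurePreserving {α β : Type*} [MeasurableSpace α] [MeasurableSpace β]
    {μ : Measure α} {ν : Measure β} {f : α → β} (hf : MeasurePreserving f μ ν) {g : β → ℝ}
    (hg : Measurable g) : ∫ x, g (f x) ∂μ = ∫ y, g y ∂ν := by
  rw [← hf.map_eq, integral_map hf.measurable.aemeasurable hg.aestronglyMeasurable]

section product

variable {ι E : Type*} [Fintype ι] [MeasurableSpace E] (P : Measure E) [IsProbabilityMeasure P]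

lemma measurePreserving_comp_injective {κ : Type*} [Fintype κ] {i : κ → ι}
    (hi : Function.Injective i) :
    MeasurePreserving (fun (D : ι → E) k => D (i k)) (Measure.pi fun _ => P)
      (Measure.pi fun _ => P) := by
  have h1 : iIndepFun (fun (k : ι) (D : ι → E) => D k) (Measure.pi fun _ => P) :=
    iIndepFun_pi (X := fun _ x => x) fun _ => aemeasurable_id
  have h2 := h1.precomp hi
  refine ⟨by fun_prop, ?_⟩
  have h3 := (iIndepFun_iff_map_fun_eq_pi_map (fun k => (measurable_pi_apply (i k)).aemeasurable)).1 h2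
  rw [h3]
  congr 1
  ext1 k
  exact (measurePreserving_eval (fun _ : ι => P) (i k)).map_eq

/-- Replacing the coordinates in `B` by those of an independent copy preserves the law. Integrating
over the copy first then plays the role of conditioning on the coordinates outside `B`. -/
lemma measurePreserving_mix (B : Finset ι) [DecidableEq ι] :
    MeasurePreserving (fun (p : (ι → E) × (ι → E)) j => if j ∈ B then p.2 j else p.1 j)
      ((Measure.pi fun _ => P).prod (Measure.pi fun _ => P)) (Measure.pi fun _ => P) := by
  have hm : Measurable (fun (p : (ι → E) × (ι → E)) j => if j ∈ B then p.2 j else p.1 j) := by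
    refine measurable_pi_lambda _ fun j => ?_
    by_cases h : j ∈ B
    · simp only [h, if_true]; fun_prop
    · simp only [h, if_false]; fun_prop
  refine ⟨hm, (Measure.pi_eq fun s hs => ?_).symm⟩
  rw [Measure.map_apply hm (MeasurableSet.univ_pi hs)]
  have e : (fun (p : (ι → E) × (ι → E)) j => if j ∈ B then p.2 j else p.1 j) ⁻¹'
      (Set.univ.pi s) = (Set.univ.pi fun j => if j ∈ B then Set.univ else s j) ×ˢ
        (Set.univ.pi fun j => if j ∈ B then s j else Set.univ) := by
    ext p
    simp only [Set.mem_preimage, Set.mem_pi, Set.mem_univ, true_implies, Set.mem_prod]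
    rw [← forall_and]
    refine forall_congr' fun j => ?_
    by_cases h : j ∈ B <;> simp [h]
  rw [e, Measure.prod_prod, Measure.pi_pi, Measure.pi_pi, ← Finset.prod_mul_distrib]
  refine Finset.prod_congr rfl fun j _ => ?_
  by_cases h : j ∈ B <;> simp [h]

/-- An observation and its fresh copy are exchangeable. The exchange turns an integrand in `D i` and
the updated data into one in the copy and the original data, which are independent. -/
lemma measurePreserving_exchange [DecidableEq ι] (i : ι) :
    MeasurePreserving (fun p : (ι → E) × E => (Function.update p.1 i p.2, p.1 i))
      ((Measure.pi fun _ => P).prod P) ((Measure.pi fun _ => P).prod P) := by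
  have hm : Measurable (fun p : (ι → E) × E => (Function.update p.1 i p.2, p.1 i)) := by
    refine Measurable.prodMk ?_ (by fun_prop)
    exact measurable_update'.comp measurable_id
  refine ⟨hm, (Measure.prod_eq_generateFrom generateFrom_pi
    MeasurableSpace.generateFrom_measurableSet isPiSystem_pi
    MeasurableSpace.isPiSystem_measurableSet ?_ ?_ ?_).symm⟩
  · exact ⟨fun _ => Set.univ, fun _ => ⟨fun _ => Set.univ, fun j _ => MeasurableSet.univ,
      by simp⟩, fun _ => measure_lt_top _ _, Set.iUnion_const _⟩
  · exact ⟨fun _ => Set.univ, fun _ => MeasurableSet.univ,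
      fun _ => measure_lt_top _ _, Set.iUnion_const _⟩
  · rintro _ ⟨s, hs, rfl⟩ t ht
    have hs' : ∀ j, MeasurableSet (s j) := fun j => hs j (Set.mem_univ j)
    have ht : MeasurableSet t := ht
    rw [Measure.map_apply hm ((MeasurableSet.univ_pi hs').prod ht)]
    have e : (fun p : (ι → E) × E => (Function.update p.1 i p.2, p.1 i)) ⁻¹'
        (Set.univ.pi s ×ˢ t) = (Set.univ.pi (Function.update s i t)) ×ˢ (s i) := by
      ext p
      simp only [Set.mem_preimage, Set.mem_prod, Set.mem_pi, Set.mem_univ, true_implies]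
      constructor
      · rintro ⟨h1, h2⟩
        refine ⟨fun j => ?_, by simpa using h1 i⟩
        by_cases h : j = i
        · subst h; simpa using h2
        · simpa [h] using h1 j
      · rintro ⟨h1, h2⟩
        refine ⟨fun j => ?_, by simpa using h1 i⟩
        by_cases h : j = i
        · subst h; simpa using h2
        · simpa [h] using h1 j
    rw [e, Measure.prod_prod, Measure.pi_pi, Measure.pi_pi]
    rw [← Finset.mul_prod_erase _ _ (Finset.mem_univ i),
      ← Finset.mul_prod_erase _ (fun j => P (s j)) (Finset.mem_univ i)]
    have e2 : ∏ j ∈ Finset.univ.erase i, P (Function.update s i t j)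
        = ∏ j ∈ Finset.univ.erase i, P (s j) :=
      Finset.prod_congr rfl fun j hj => by
        rw [Function.update_of_ne (Finset.ne_of_mem_erase hj)]
    rw [e2, Function.update_self]
    ring

lemma measurePreserving_update [DecidableEq ι] (i : ι) :
    MeasurePreserving (fun p : (ι → E) × E => Function.update p.1 i p.2)
      ((Measure.pi fun _ => P).prod P) (Measure.pi fun _ => P) :=
  measurePreserving_fst.comp (measurePreserving_exchange P i)

end product

/-! ### Second moments -/

section second_moments

variable {Ω : Type*} {mΩ : MeasurableSpace Ω} {μ : Measure Ω}

lemma eLpNorm_two_sq (X : Ω → ℝ) :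
    eLpNorm X 2 μ ^ 2 = ∫⁻ ω, ‖X ω‖ₑ ^ 2 ∂μ := by
  have h := eLpNorm_nnreal_pow_eq_lintegral (f := X) (μ := μ) (p := 2) (by norm_num)
  simpa using h

lemma memLp_two_of_lintegral {X : Ω → ℝ} (hX : AEStronglyMeasurable X μ)
    (h : ∫⁻ ω, ‖X ω‖ₑ ^ 2 ∂μ < ⊤) : MemLp X 2 μ := by
  refine ⟨hX, ?_⟩
  rw [← eLpNorm_two_sq X] at h
  by_contra h'
  rw [not_lt, top_le_iff] at h'
  simp [h'] at h

lemma ofReal_integral_sq {X : Ω → ℝ} (h : MemLp X 2 μ) :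
    ENNReal.ofReal (∫ ω, X ω ^ 2 ∂μ) = ∫⁻ ω, ‖X ω‖ₑ ^ 2 ∂μ := by
  rw [ofReal_integral_eq_lintegral_ofReal h.integrable_sq
    (Filter.Eventually.of_forall fun ω => sq_nonneg _)]
  refine lintegral_congr fun ω => ?_
  rw [← sq_abs, ENNReal.ofReal_pow (abs_nonneg _), Real.enorm_eq_ofReal_abs]

lemma integral_sq_le_of_lintegral {X : Ω → ℝ} (hX : AEStronglyMeasurable X μ) {d : ℝ}
    (hd : 0 ≤ d) (h : ∫⁻ ω, ‖X ω‖ₑ ^ 2 ∂μ ≤ ENNReal.ofReal d) :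
    MemLp X 2 μ ∧ ∫ ω, X ω ^ 2 ∂μ ≤ d := by
  have h1 := memLp_two_of_lintegral hX (h.trans_lt ENNReal.ofReal_lt_top)
  refine ⟨h1, ?_⟩
  rw [← ofReal_integral_sq h1] at h
  exact (ENNReal.ofReal_le_ofReal_iff hd).1 h

lemma enorm_add_sq_le (a b : ℝ) : ‖a + b‖ₑ ^ 2 ≤ 2 * ‖a‖ₑ ^ 2 + 2 * ‖b‖ₑ ^ 2 := by
  simp only [Real.enorm_eq_ofReal_abs, ← ENNReal.ofReal_pow (abs_nonneg _), sq_abs]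
  rw [← ENNReal.ofReal_ofNat, ← ENNReal.ofReal_mul (by norm_num), ← ENNReal.ofReal_mul (by norm_num),
    ← ENNReal.ofReal_add (by positivity) (by positivity)]
  exact ENNReal.ofReal_le_ofReal (by nlinarith [sq_nonneg (a - b)])

lemma lintegral_enorm_add_sq_le {X Y : Ω → ℝ} (hX : Measurable X) (hY : Measurable Y) :
    ∫⁻ ω, ‖X ω + Y ω‖ₑ ^ 2 ∂μ ≤ 2 * ∫⁻ ω, ‖X ω‖ₑ ^ 2 ∂μ + 2 * ∫⁻ ω, ‖Y ω‖ₑ ^ 2 ∂μ := by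
  rw [← lintegral_const_mul _ (by fun_prop), ← lintegral_const_mul _ (by fun_prop),
    ← lintegral_add_left (by fun_prop)]
  exact lintegral_mono fun ω => enorm_add_sq_le _ _

lemma lintegral_enorm_const_mul_sq (c : ℝ) (X : Ω → ℝ) :
    ∫⁻ ω, ‖c * X ω‖ₑ ^ 2 ∂μ = ENNReal.ofReal (c ^ 2) * ∫⁻ ω, ‖X ω‖ₑ ^ 2 ∂μ := by
  rw [← lintegral_const_mul' _ _ ENNReal.ofReal_ne_top]
  refine lintegral_congr fun ω => ?_
  rw [enorm_mul, mul_pow]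
  congr 1
  rw [Real.enorm_eq_ofReal_abs, ← ENNReal.ofReal_pow (abs_nonneg _), sq_abs]

lemma integral_abs_mul_le {X Y : Ω → ℝ} (hX : MemLp X 2 μ) (hY : MemLp Y 2 μ) :
    ∫ ω, |X ω * Y ω| ∂μ ≤ √(∫ ω, X ω ^ 2 ∂μ) * √(∫ ω, Y ω ^ 2 ∂μ) := by
  have h := integral_mul_norm_le_Lp_mul_Lq (μ := μ) (f := X) (g := Y)
    (Real.HolderConjugate.two_two) (by simpa using hX) (by simpa using hY)
  simpa [abs_mul, Real.sqrt_eq_rpow] using h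

end second_moments

/-! ### A Berry–Esseen bound for nonlinear statistics -/

section nonlinear

variable {ι E : Type*} [Fintype ι] [MeasurableSpace E] {P : Measure E} [IsProbabilityMeasure P]

lemma integral_eval {g : E → ℝ} (hg : Measurable g) (i : ι) :
    ∫ D, g (D i) ∂(Measure.pi fun _ : ι => P) = ∫ x, g x ∂P :=
  integral_comp_measurePreserving (measurePreserving_eval (fun _ : ι => P) i) hg

lemma stdSummands_pi {w : ι → E → ℝ} (hw : ∀ i, Measurable (w i)) (hw3 : ∀ i, MemLp (w i) 3 P)
    (hw0 : ∀ i, ∫ x, w i x ∂P = 0) (hvar : ∑ i, ∫ x, w i x ^ 2 ∂P = 1) :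
    StdSummands (Measure.pi fun _ : ι => P) (fun i D => w i (D i)) where
  meas i := (hw i).comp (measurable_pi_apply i)
  memLp i := (hw3 i).comp_measurePreserving (measurePreserving_eval (fun _ => P) i)
  mean i := by rw [integral_eval (hw i), hw0 i]
  indep := iIndepFun_pi fun i => (hw i).aemeasurable
  var := by
    rw [← hvar]
    exact Finset.sum_congr rfl fun i _ => integral_eval ((hw i).pow_const 2) i

/-- A Berry–Esseen bound for `∑ i, w i (D i) + Δ D`, where the nonlinear term `Δ` is controlled in
`L²` together with its increments when one observation is resampled. -/
theorem berry_esseen_nonlinear [DecidableEq ι] {w : ι → E → ℝ} (hw : ∀ i, Measurable (w i))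
    (hw3 : ∀ i, MemLp (w i) 3 P) (hw0 : ∀ i, ∫ x, w i x ∂P = 0)
    (hvar : ∑ i, ∫ x, w i x ^ 2 ∂P = 1) {Δ : (ι → E) → ℝ} (hΔ : Measurable Δ) {d : ℝ}
    (hd0 : 0 ≤ d) (hd : ∫⁻ D, ‖Δ D‖ₑ ^ 2 ∂(Measure.pi fun _ : ι => P) ≤ ENNReal.ofReal (d ^ 2))
    {e : ι → ℝ} (he0 : ∀ i, 0 ≤ e i)
    (he : ∀ i, ∫⁻ p, ‖Δ p.1 - Δ (Function.update p.1 i p.2)‖ₑ ^ 2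
      ∂((Measure.pi fun _ : ι => P).prod P) ≤ ENNReal.ofReal (e i ^ 2)) (t : ℝ) :
    |(Measure.pi fun _ : ι => P).real {D | ∑ i, w i (D i) + Δ D ≤ t} - ncdf t| ≤
      64 * ∑ i, ∫ x, |w i x| ^ 3 ∂P + 2 * d + 2 * ∑ i, √(∫ x, w i x ^ 2 ∂P) * e i := by
  set μ : Measure (ι → E) := Measure.pi fun _ : ι => P with hμ
  set ν := μ.prod P with hν
  have hS := stdSummands_pi hw hw3 hw0 hvar
  have hbe := hS.berry_esseen t
  obtain ⟨hΔ2, hΔd⟩ := integral_sq_le_of_lintegral hΔ.aestronglyMeasurable (sq_nonneg d) hd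
  have hβ : ∑ i, ∫ D, |w i (D i)| ^ 3 ∂μ = ∑ i, ∫ x, |w i x| ^ 3 ∂P :=
    Finset.sum_congr rfl fun i _ => integral_eval (g := fun x => |w i x| ^ 3)
      ((hw i).abs.pow_const 3) i
  set δ := (∑ i, ∫ D, |w i (D i)| ^ 3 ∂μ) / 2 with hδ
  have hδ0 : 0 < δ := by have := hS.beta_pos; rw [hδ]; positivity
  have hWm : Measurable fun D : ι → E => ∑ j, w j (D j) := hS.measurable_sum
  have hB : ∀ i, -(√(∫ x, w i x ^ 2 ∂P) * e i) ≤
      ∫ D, w i (D i) * clip (|Δ D| + δ) ((∑ j, w j (D j)) - w i (D i) - t) ∂μ := by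
    intro i
    set G : (ι → E) → ℝ := fun D =>
      clip (|Δ D| + δ) ((∑ j, w j (D j)) - w i (D i) - t) with hG
    have hGm : Measurable G := measurable_clip (hΔ.abs.add_const δ)
      ((hS.measurable_rest i).sub_const t)
    have hG2 : MemLp G 2 μ := by
      refine (hΔ2.abs.add (memLp_const δ)).mono hGm.aestronglyMeasurable
        (Filter.Eventually.of_forall fun ω => ?_)
      have hp : 0 ≤ |Δ ω| + δ := by positivity
      rw [Real.norm_eq_abs, Real.norm_eq_abs]
      refine (abs_clip_le hp _).trans (le_of_eq ?_)
      exact (abs_of_nonneg hp).symm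
    have hup := measurePreserving_update P i
    have hex := measurePreserving_exchange P i
    have hmu : Measurable fun p : (ι → E) × E => Function.update p.1 i p.2 := hup.measurable
    have hwi2 : MemLp (fun p : (ι → E) × E => w i (p.1 i)) 2 ν :=
      (hS.memLp_two i).comp_measurePreserving measurePreserving_fst
    have hGf : MemLp (fun p : (ι → E) × E => G p.1) 2 ν :=
      hG2.comp_measurePreserving measurePreserving_fst
    have hGu : MemLp (fun p : (ι → E) × E => G (Function.update p.1 i p.2)) 2 ν :=
      hG2.comp_measurePreserving hup
    -- After the exchange, `w i` is evaluated at the copy, which is independent of the data, and it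
    -- has mean zero. Hence `w i` only feels the change of `G` under resampling.
    have hzero : ∫ p, w i (p.1 i) * G (Function.update p.1 i p.2) ∂ν = 0 := by
      have h1 : ∫ q, w i q.2 * G q.1 ∂ν = 0 := by
        have := integral_prod_mul (μ := μ) (ν := P) G (w i)
        rw [hw0 i, mul_zero] at this
        rw [← this]
        exact integral_congr_ae (Filter.Eventually.of_forall fun q => mul_comm _ _)
      rw [← h1]
      exact integral_comp_measurePreserving hex (g := fun q => w i q.2 * G q.1)
        (((hw i).comp measurable_snd).mul (hGm.comp measurable_fst))
    have hone : ∫ D, w i (D i) * G D ∂μ = ∫ p, w i (p.1 i) * G p.1 ∂ν :=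
      (integral_comp_measurePreserving (measurePreserving_fst (μ := μ) (ν := P))
        (((hw i).comp (measurable_pi_apply i)).mul hGm)).symm
    have hdm : Measurable fun p : (ι → E) × E => Δ p.1 - Δ (Function.update p.1 i p.2) :=
      (hΔ.comp measurable_fst).sub (hΔ.comp hmu)
    obtain ⟨hD2, hDe⟩ := integral_sq_le_of_lintegral hdm.aestronglyMeasurable
      (sq_nonneg (e i)) (he i)
    have i1 := integrable_mul_of_memLp_two hwi2 hGf
    have i2 := integrable_mul_of_memLp_two hwi2 hGu
    have hdiff : |∫ D, w i (D i) * G D ∂μ| ≤ √(∫ x, w i x ^ 2 ∂P) * e i := by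
      have e1 : ∫ D, w i (D i) * G D ∂μ
          = ∫ p, (w i (p.1 i) * G p.1 - w i (p.1 i) * G (Function.update p.1 i p.2)) ∂ν := by
        rw [integral_sub i1 i2, hzero, sub_zero, hone]
      rw [e1]
      refine abs_integral_le_integral_abs.trans ?_
      calc ∫ p, |w i (p.1 i) * G p.1 - w i (p.1 i) * G (Function.update p.1 i p.2)| ∂ν
          ≤ ∫ p, |w i (p.1 i) * (Δ p.1 - Δ (Function.update p.1 i p.2))| ∂ν := by
            refine integral_mono (i1.sub i2).abs
              (integrable_mul_of_memLp_two hwi2 hD2).abs fun p => ?_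
            simp only []
            rw [← mul_sub, abs_mul, abs_mul]
            refine mul_le_mul_of_nonneg_left ?_ (abs_nonneg _)
            -- The sum without its `i`-th term is unaffected by resampling observation `i`. So `G`
            -- changes only through the clipping level `|Δ| + δ`, hence by at most the increment of
            -- `Δ`.
            have e2 : (∑ j, w j (Function.update p.1 i p.2 j))
                - w i (Function.update p.1 i p.2 i) = (∑ j, w j (p.1 j)) - w i (p.1 i) := by
              rw [← Finset.add_sum_erase _ _ (Finset.mem_univ i),
                ← Finset.add_sum_erase _ (fun j => w j (p.1 j)) (Finset.mem_univ i),
                add_sub_cancel_left, add_sub_cancel_left]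
              exact Finset.sum_congr rfl fun j hj => by
                rw [Function.update_of_ne (Finset.ne_of_mem_erase hj)]
            simp only [hG]
            rw [e2]
            refine (abs_clip_sub_le _ _ _).trans ?_
            rw [add_sub_add_right_eq_sub]
            exact abs_abs_sub_abs_le_abs_sub _ _
        _ ≤ √(∫ p, w i (p.1 i) ^ 2 ∂ν)
            * √(∫ p, (Δ p.1 - Δ (Function.update p.1 i p.2)) ^ 2 ∂ν) :=
            integral_abs_mul_le hwi2 hD2
        _ ≤ √(∫ x, w i x ^ 2 ∂P) * e i := by
            refine mul_le_mul (le_of_eq ?_) (Real.sqrt_le_iff.2 ⟨he0 i, hDe⟩)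
              (Real.sqrt_nonneg _) (Real.sqrt_nonneg _)
            congr 1
            rw [← integral_eval (P := P) ((hw i).pow_const 2) i]
            exact integral_comp_measurePreserving (measurePreserving_fst (μ := μ) (ν := P))
              (((hw i).comp (measurable_pi_apply i)).pow_const 2)
    exact (abs_le.1 hdiff).1
  have hconc := hS.concentration hΔ hΔ2 t hδ hB
  have hWΔ : ∫ D, |(∑ j, w j (D j)) * Δ D| ∂μ ≤ d := by
    refine (integral_abs_mul_le hS.memLp_sum hΔ2).trans ?_
    rw [hS.integral_sum_sq Finset.univ, hS.var, Real.sqrt_one, one_mul]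
    exact Real.sqrt_le_iff.2 ⟨hd0, hΔd⟩
  have hTW : |μ.real {D | ∑ i, w i (D i) + Δ D ≤ t} - μ.real {D | ∑ i, w i (D i) ≤ t}| ≤
      μ.real {D | |(∑ j, w j (D j)) - t| ≤ |Δ D|} := by
    rw [abs_sub_le_iff]
    constructor
    · rw [sub_le_iff_le_add]
      refine (measureReal_mono (fun D hD => ?_)).trans (measureReal_union_le _ _)
      have hD : ∑ i, w i (D i) + Δ D ≤ t := hD
      by_cases h : ∑ i, w i (D i) ≤ t
      · exact Or.inr h
      · left
        show |(∑ j, w j (D j)) - t| ≤ |Δ D|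
        rw [abs_of_pos (by linarith)]
        linarith [neg_abs_le (Δ D)]
    · rw [sub_le_iff_le_add]
      refine (measureReal_mono (fun D hD => ?_)).trans (measureReal_union_le _ _)
      have hD : ∑ i, w i (D i) ≤ t := hD
      by_cases h : ∑ i, w i (D i) + Δ D ≤ t
      · exact Or.inr h
      · left
        show |(∑ j, w j (D j)) - t| ≤ |Δ D|
        rw [abs_of_nonpos (by linarith)]
        linarith [le_abs_self (Δ D)]
  -- The term `4 * δ` is twice the sum of the third moments, whence the constant `62 + 2`.
  rw [← hβ]
  have h3 := abs_sub_le (μ.real {D | ∑ i, w i (D i) + Δ D ≤ t})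
    (μ.real {D | ∑ i, w i (D i) ≤ t}) (ncdf t)
  linarith

end nonlinear

/-! ### Counting increasing maps -/

section counting

open Classical in
/-- The increasing maps `Fin r → Fin n`. -/
def incMaps (r n : ℕ) : Finset (Fin r → Fin n) := {i : Fin r → Fin n | StrictMono i}

lemma mem_incMaps {r n : ℕ} {i : Fin r → Fin n} : i ∈ incMaps r n ↔ StrictMono i := by
  simp [incMaps]

open Classical in
-- An increasing map is determined by its image, so these maps correspond to the `r`-subsets that
-- contain `A`.
lemma card_incMaps_filter (r n : ℕ) (A : Finset (Fin n)) (hA : A.card ≤ r) :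
    ((incMaps r n).filter fun i => ∀ a ∈ A, ∃ k, i k = a).card
      = (n - A.card).choose (r - A.card) := by
  have h := Finset.card_filter_powersetCard_subset A Finset.univ r (Finset.subset_univ _) hA
  rw [Finset.card_univ, Fintype.card_fin] at h
  rw [← h]
  refine Finset.card_bij (fun i _ => Finset.univ.image i) ?_ ?_ ?_
  · intro i hi
    rw [Finset.mem_filter, mem_incMaps] at hi
    rw [Finset.mem_filter, Finset.mem_powersetCard]
    refine ⟨⟨Finset.subset_univ _, ?_⟩, fun a ha => ?_⟩
    · rw [Finset.card_image_of_injective _ hi.1.injective]; simp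
    · obtain ⟨k, hk⟩ := hi.2 a ha
      exact Finset.mem_image.2 ⟨k, Finset.mem_univ _, hk⟩
  · intro i hi j hj hij
    rw [Finset.mem_filter, mem_incMaps] at hi hj
    refine (StrictMono.range_inj hi.1 hj.1).1 ?_
    have := congrArg (fun s : Finset (Fin n) => (s : Set (Fin n))) hij
    simpa using this
  · intro S hS
    rw [Finset.mem_filter, Finset.mem_powersetCard] at hS
    refine ⟨S.orderEmbOfFin hS.1.2, ?_, ?_⟩
    · rw [Finset.mem_filter, mem_incMaps]
      refine ⟨(S.orderEmbOfFin hS.1.2).strictMono, fun a ha => ?_⟩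
      have : a ∈ Set.range (S.orderEmbOfFin hS.1.2) := by
        rw [Finset.range_orderEmbOfFin]; exact hS.2 ha
      exact this
    · ext a
      have : a ∈ Set.range (S.orderEmbOfFin hS.1.2) ↔ a ∈ S := by
        rw [Finset.range_orderEmbOfFin]; rfl
      rw [← this]; simp

lemma card_incMaps (r n : ℕ) : (incMaps r n).card = n.choose r := by
  have h := card_incMaps_filter r n ∅ (by simp)
  simpa using h

open Classical in
lemma card_incMaps_mem {r n : ℕ} (hr : 0 < r) (hrn : r < n) (a : Fin n) :
    (((incMaps r n).filter fun i => ∃ k, i k = a).card : ℝ) = n.choose r * (r / n) := by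
  have h := card_incMaps_filter r n {a} (by rw [Finset.card_singleton]; exact hr)
  simp only [Finset.mem_singleton, forall_eq, Finset.card_singleton] at h
  rw [h]
  obtain ⟨n, rfl⟩ : ∃ k, n = k + 1 := ⟨n - 1, by omega⟩
  obtain ⟨r, rfl⟩ : ∃ k, r = k + 1 := ⟨r - 1, by omega⟩
  have := Nat.add_one_mul_choose_eq n r
  have h2 : ((n : ℝ) + 1) * n.choose r = (n + 1).choose (r + 1) * (r + 1) := by exact_mod_cast this
  simp only [Nat.add_sub_cancel]
  push_cast
  field_simp
  linarith

open Classical in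
-- For `r ≥ 2` the exact fraction is `r (r - 1) / (n (n - 1))`, and `n ≤ 2 (n - 1)`. For smaller `r`
-- no map takes two values.
lemma card_incMaps_mem_two {r n : ℕ} (hrn : r < n) {a b : Fin n} (hab : a ≠ b) :
    (((incMaps r n).filter fun i => (∃ k, i k = a) ∧ ∃ k, i k = b).card : ℝ)
      ≤ n.choose r * (2 * r ^ 2 / n ^ 2) := by
  rcases lt_or_ge r 2 with hr | hr
  · have : (incMaps r n).filter (fun i => (∃ k, i k = a) ∧ ∃ k, i k = b) = ∅ := by
      refine Finset.filter_eq_empty_iff.2 fun i _ h => ?_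
      obtain ⟨⟨k, hk⟩, l, hl⟩ := h
      have : k = l := by ext; omega
      exact hab (by rw [← hk, ← hl, this])
    rw [this]
    simp only [Finset.card_empty, Nat.cast_zero]
    positivity
  have h := card_incMaps_filter r n {a, b} (by rw [Finset.card_pair hab]; exact hr)
  simp only [Finset.mem_insert, Finset.mem_singleton, forall_eq_or_imp, forall_eq,
    Finset.card_pair hab] at h
  rw [h]
  obtain ⟨n, rfl⟩ : ∃ k, n = k + 2 := ⟨n - 2, by omega⟩
  obtain ⟨r, rfl⟩ : ∃ k, r = k + 2 := ⟨r - 2, by omega⟩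
  have h1 := Nat.add_one_mul_choose_eq n r
  have h2 := Nat.add_one_mul_choose_eq (n + 1) (r + 1)
  have h1' : ((n : ℝ) + 1) * n.choose r = (n + 1).choose (r + 1) * (r + 1) := by exact_mod_cast h1
  have h2' : ((n : ℝ) + 2) * (n + 1).choose (r + 1) = (n + 2).choose (r + 2) * (r + 2) := by
    have := congrArg (Nat.cast (R := ℝ)) h2
    push_cast at this
    have e : (n : ℝ) + 1 + 1 = n + 2 := by ring
    have e2 : (r : ℝ) + 1 + 1 = r + 2 := by ring
    rw [e, e2] at this
    exact this
  simp only [Nat.add_sub_cancel]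
  push_cast
  set c : ℝ := (n.choose r : ℝ)
  set d : ℝ := ((n + 1).choose (r + 1) : ℝ)
  set e : ℝ := ((n + 2).choose (r + 2) : ℝ)
  have he : 0 ≤ e := Nat.cast_nonneg _
  have hn : (0 : ℝ) ≤ n := Nat.cast_nonneg _
  have hr0 : (0 : ℝ) ≤ r := Nat.cast_nonneg _
  have key : c * (((n : ℝ) + 1) * (n + 2)) = e * ((r + 1) * (r + 2)) := by
    linear_combination (n + 2 : ℝ) * h1' + (r + 1 : ℝ) * h2'
  rw [mul_div_assoc', le_div_iff₀ (by positivity)]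
  have hc : 0 ≤ c := Nat.cast_nonneg _
  have s1 : c * ((n : ℝ) + 2) ^ 2 ≤ 2 * (c * (((n : ℝ) + 1) * (n + 2))) := by
    nlinarith [mul_nonneg hc hn, mul_nonneg hc (mul_nonneg hn hn)]
  have s2 : e * (((r : ℝ) + 1) * (r + 2)) ≤ e * (r + 2) ^ 2 := by
    refine mul_le_mul_of_nonneg_left ?_ he
    nlinarith
  linarith

open Classical in
-- The second filter says that `j` and `i` have at least two indices in common, in a form whose
-- negation is the hypothesis of `integral_degTerm_mul_eq_zero`. As `a` is already one common index,
-- only the position of another is free: a factor `r`, not `r ^ 2`.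
lemma card_correlated_mem_le {r n : ℕ} (hrn : r < n) {i : Fin r → Fin n} (hi : StrictMono i) {a : Fin n}
    (ha : ∃ k, i k = a) :
    ((((incMaps r n).filter fun j => ∃ k, j k = a).filter
      fun j => ∀ k, ∃ k', k' ≠ k ∧ ∃ l, j l = i k').card : ℝ) ≤
      r * (n.choose r * (2 * r ^ 2 / n ^ 2)) := by
  obtain ⟨k, rfl⟩ := ha
  have hsub : ((incMaps r n).filter fun j => ∃ k', j k' = i k).filter
      (fun j => ∀ k, ∃ k', k' ≠ k ∧ ∃ l, j l = i k') ⊆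
      (Finset.univ.filter fun p : Fin r => k ≠ p).biUnion fun p =>
        (incMaps r n).filter fun j => (∃ l, j l = i k) ∧ ∃ l, j l = i p := by
    intro j hj
    rw [Finset.mem_filter, Finset.mem_filter] at hj
    obtain ⟨k', hk', hk2⟩ := hj.2 k
    exact Finset.mem_biUnion.2 ⟨k', by simpa using hk'.symm,
      Finset.mem_filter.2 ⟨hj.1.1, hj.1.2, hk2⟩⟩
  have h1 := (Finset.card_le_card hsub).trans Finset.card_biUnion_le
  have h2 : ((((incMaps r n).filter fun j => ∃ k', j k' = i k).filter
      fun j => ∀ k, ∃ k', k' ≠ k ∧ ∃ l, j l = i k').card : ℝ) ≤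
      ∑ p : Fin r with k ≠ p, (((incMaps r n).filter fun j =>
        (∃ l, j l = i k) ∧ ∃ l, j l = i p).card : ℝ) := by exact_mod_cast h1
  refine h2.trans ?_
  refine (Finset.sum_le_card_nsmul _ _ ((n.choose r : ℝ) * (2 * r ^ 2 / n ^ 2)) fun p hp => ?_).trans ?_
  · exact card_incMaps_mem_two hrn (hi.injective.ne (Finset.mem_filter.1 hp).2)
  · rw [nsmul_eq_mul]
    refine mul_le_mul_of_nonneg_right ?_ (by positivity)
    have := Finset.card_filter_le (Finset.univ (α := Fin r)) (fun p => k ≠ p)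
    simp only [Finset.card_univ, Fintype.card_fin] at this
    exact_mod_cast this

end counting

/-! ### The degenerate part of the kernel -/

section kernel

variable {𝒴 : Type*} [MeasurableSpace 𝒴] {Q : Measure 𝒴} [IsProbabilityMeasure Q]
  {r : ℕ} {ℓ : (Fin r → 𝒴) → ℝ}

lemma enorm_integral_sq_le {α : Type*} [MeasurableSpace α] {μ : Measure α}
    [IsProbabilityMeasure μ] {g : α → ℝ} (hg : AEStronglyMeasurable g μ) :
    ‖∫ x, g x ∂μ‖ₑ ^ 2 ≤ ∫⁻ x, ‖g x‖ₑ ^ 2 ∂μ := by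
  rw [← eLpNorm_two_sq]
  gcongr
  refine (enorm_integral_le_lintegral_enorm _).trans ?_
  rw [← eLpNorm_one_eq_lintegral_enorm]
  exact eLpNorm_le_eLpNorm_of_exponent_le one_le_two hg

/-- The mean of the kernel. -/
def kmean (Q : Measure 𝒴) (ℓ : (Fin r → 𝒴) → ℝ) : ℝ := ∫ y, ℓ y ∂(Measure.pi fun _ : Fin r => Q)

lemma integrable_update (hℓ2 : MemLp ℓ 2 (Measure.pi fun _ : Fin r => Q)) (k : Fin r) :
    ∀ᵐ y ∂Q, Integrable (fun v => ℓ (Function.update v k y)) (Measure.pi fun _ : Fin r => Q) := by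
  have h := (measurePreserving_update Q k).integrable_comp_of_integrable
    (hℓ2.integrable one_le_two)
  exact h.prod_left_ae

lemma eLpNorm_kernel_sub_le (hℓ2 : MemLp ℓ 2 (Measure.pi fun _ : Fin r => Q)) :
    eLpNorm (fun y => ℓ y - kmean Q ℓ) 2 (Measure.pi fun _ : Fin r => Q)
      ≤ ENNReal.ofReal (√(Var[ℓ; Measure.pi fun _ : Fin r => Q])) := by
  have h : MemLp (fun y => ℓ y - kmean Q ℓ) 2 (Measure.pi fun _ : Fin r => Q) :=
    hℓ2.sub (memLp_const _)
  rw [← ENNReal.pow_le_pow_left_iff two_ne_zero, eLpNorm_two_sq, ← ofReal_integral_sq h,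
    ← ENNReal.ofReal_pow (Real.sqrt_nonneg _), Real.sq_sqrt (variance_nonneg _ _),
    variance_eq_integral hℓ2.1.aemeasurable, kmean]

variable [NeZero r]

/-- The expectation of the kernel given that its first argument is `y`. -/
def proj1 (Q : Measure 𝒴) (ℓ : (Fin r → 𝒴) → ℝ) (y : 𝒴) : ℝ :=
  ∫ v, ℓ (Function.update v 0 y) ∂(Measure.pi fun _ : Fin r => Q)

/-- The kernel without its constant and linear parts. -/
def degKernel (Q : Measure 𝒴) (ℓ : (Fin r → 𝒴) → ℝ) (y : Fin r → 𝒴) : ℝ :=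
  ℓ y - kmean Q ℓ - ∑ k, (proj1 Q ℓ (y k) - kmean Q ℓ)

lemma measurable_proj1 (hℓ : Measurable ℓ) : Measurable (proj1 Q ℓ) := by
  have h : Measurable fun p : 𝒴 × (Fin r → 𝒴) => ℓ (Function.update p.2 0 p.1) :=
    hℓ.comp (measurable_update'.comp measurable_swap)
  exact (h.stronglyMeasurable.integral_prod_right' (ν := Measure.pi fun _ : Fin r => Q)).measurable

lemma measurable_degKernel (hℓ : Measurable ℓ) : Measurable (degKernel Q ℓ) :=
  (hℓ.sub_const _).sub (Finset.measurable_fun_sum _ fun k _ =>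
    ((measurable_proj1 hℓ).comp (measurable_pi_apply k)).sub_const _)

/-- For a symmetric kernel it does not matter which argument is frozen. -/
lemma integral_update_eq_proj1 (hℓ : Measurable ℓ)
    (hsymm : ∀ (τ : Equiv.Perm (Fin r)) (y : Fin r → 𝒴), ℓ (y ∘ τ) = ℓ y) (k : Fin r) (y : 𝒴) :
    ∫ v, ℓ (Function.update v k y) ∂(Measure.pi fun _ : Fin r => Q) = proj1 Q ℓ y := by
  have h := integral_comp_measurePreserving
    (measurePreserving_comp_injective Q (Equiv.swap 0 k).injective)
    (g := fun v => ℓ (Function.update v 0 y)) (hℓ.comp measurable_update_left)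
  rw [proj1, ← h]
  refine integral_congr_ae (Filter.Eventually.of_forall fun v => ?_)
  simp only []
  rw [← hsymm (Equiv.swap 0 k)]
  congr 1
  ext j
  simp only [Function.comp, Function.update_apply]
  by_cases h : j = 0
  · subst h; simp
  · rw [if_neg h, if_neg]
    intro h'
    exact h ((Equiv.swap 0 k).injective (h'.trans (Equiv.swap_apply_left 0 k).symm))

lemma integral_proj1 (hℓ : Measurable ℓ) (hℓ2 : MemLp ℓ 2 (Measure.pi fun _ : Fin r => Q)) :
    ∫ y, proj1 Q ℓ y ∂Q = kmean Q ℓ := by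
  have hi := (measurePreserving_update Q (0 : Fin r)).integrable_comp_of_integrable
    (hℓ2.integrable one_le_two)
  have h := integral_prod_symm _ hi
  rw [kmean, ← integral_comp_measurePreserving (measurePreserving_update Q (0 : Fin r)) hℓ]
  exact h.symm

/-- Conditional expectation contracts `L²`: Jensen's inequality for the inner integral, for almost
every frozen value. -/
lemma eLpNorm_proj1_sub_le (hℓ : Measurable ℓ)
    (hℓ2 : MemLp ℓ 2 (Measure.pi fun _ : Fin r => Q)) :
    eLpNorm (fun y => proj1 Q ℓ y - kmean Q ℓ) 2 Q ≤
      eLpNorm (fun y => ℓ y - kmean Q ℓ) 2 (Measure.pi fun _ : Fin r => Q) := by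
  rw [← ENNReal.pow_le_pow_left_iff two_ne_zero, eLpNorm_two_sq, eLpNorm_two_sq]
  have hm : Measurable fun p : (Fin r → 𝒴) × 𝒴 =>
      ‖ℓ (Function.update p.1 0 p.2) - kmean Q ℓ‖ₑ ^ 2 := by
    have := hℓ.comp (measurePreserving_update Q (0 : Fin r)).measurable
    exact ((this.sub_const _).enorm).pow_const 2
  rw [← (measurePreserving_update Q (0 : Fin r)).lintegral_comp
    ((hℓ.sub_const _).enorm.pow_const 2), lintegral_prod_symm' _ hm]
  refine lintegral_mono_ae ?_
  filter_upwards [integrable_update hℓ2 0] with y hy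
  have e : proj1 Q ℓ y - kmean Q ℓ = ∫ v, (ℓ (Function.update v 0 y) - kmean Q ℓ)
      ∂(Measure.pi fun _ : Fin r => Q) := by
    rw [integral_sub hy (integrable_const _), proj1]; simp
  rw [e]
  exact enorm_integral_sq_le ((hℓ.comp measurable_update_left).sub_const _).aestronglyMeasurable

lemma memLp_proj1 (hℓ : Measurable ℓ) (hℓ2 : MemLp ℓ 2 (Measure.pi fun _ : Fin r => Q)) :
    MemLp (proj1 Q ℓ) 2 Q := by
  have h : MemLp (fun y => proj1 Q ℓ y - kmean Q ℓ) 2 Q :=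
    ⟨((measurable_proj1 hℓ).sub_const _).aestronglyMeasurable,
      (eLpNorm_proj1_sub_le hℓ hℓ2).trans_lt (hℓ2.sub (memLp_const _)).2⟩
  have h2 := h.add (memLp_const (kmean Q ℓ))
  refine h2.congr_norm (measurable_proj1 hℓ).aestronglyMeasurable
    (Filter.Eventually.of_forall fun y => ?_)
  simp

/-- Minkowski's inequality: the centered kernel and each of the `r` centered projections have `L²`
norm at most `σ_ℓ`. -/
lemma degKernel_second_moment (hℓ : Measurable ℓ)
    (hℓ2 : MemLp ℓ 2 (Measure.pi fun _ : Fin r => Q)) :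
    MemLp (degKernel Q ℓ) 2 (Measure.pi fun _ : Fin r => Q) ∧
    ∫ y, degKernel Q ℓ y ^ 2 ∂(Measure.pi fun _ : Fin r => Q) ≤
      ((1 + r) * √(Var[ℓ; Measure.pi fun _ : Fin r => Q])) ^ 2 := by
  set μ := Measure.pi fun _ : Fin r => Q
  set s := √(Var[ℓ; μ])
  have hs : 0 ≤ s := Real.sqrt_nonneg _
  refine integral_sq_le_of_lintegral (measurable_degKernel hℓ).aestronglyMeasurable
    (sq_nonneg _) ?_
  rw [← eLpNorm_two_sq, ENNReal.ofReal_pow (by positivity)]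
  gcongr
  have hm : Measurable fun y => proj1 Q ℓ y - kmean Q ℓ := (measurable_proj1 hℓ).sub_const _
  have hsm : ∀ k : Fin r, Measurable fun y : Fin r → 𝒴 => proj1 Q ℓ (y k) - kmean Q ℓ :=
    fun k => hm.comp (measurable_pi_apply k)
  calc eLpNorm (degKernel Q ℓ) 2 μ
      ≤ eLpNorm (fun y => ℓ y - kmean Q ℓ) 2 μ +
          eLpNorm (∑ k, fun y : Fin r → 𝒴 => proj1 Q ℓ (y k) - kmean Q ℓ) 2 μ := by
        have := eLpNorm_sub_le (p := 2) (μ := μ) (hℓ.sub_const (kmean Q ℓ)).aestronglyMeasurable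
          (Finset.aestronglyMeasurable_sum (Finset.univ (α := Fin r)) fun k _ =>
            (hsm k).aestronglyMeasurable) (by norm_num)
        convert this using 2
        ext y; simp [degKernel]
    _ ≤ ENNReal.ofReal s + ∑ k : Fin r, ENNReal.ofReal s := by
        refine add_le_add (eLpNorm_kernel_sub_le hℓ2) ?_
        refine (eLpNorm_sum_le (fun k _ => (hsm k).aestronglyMeasurable) (by norm_num)).trans ?_
        refine Finset.sum_le_sum fun k _ => ?_
        have := eLpNorm_comp_measurePreserving (p := 2) hm.aestronglyMeasurable
          (measurePreserving_eval (fun _ : Fin r => Q) k)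
        refine (le_of_eq this).trans ?_
        exact (eLpNorm_proj1_sub_le hℓ hℓ2).trans (eLpNorm_kernel_sub_le hℓ2)
    _ = ENNReal.ofReal ((1 + r) * s) := by
        rw [Finset.sum_const, Finset.card_univ, Fintype.card_fin, nsmul_eq_mul, add_mul, one_mul,
          ENNReal.ofReal_add hs (by positivity), ENNReal.ofReal_mul (by positivity),
          ENNReal.ofReal_natCast]

/-- Degeneracy: averaging over all arguments but the `k`-th turns the kernel into its projection,
which the `k`-th linear term cancels; the other linear terms have mean zero. -/
lemma integral_degKernel_update (hℓ : Measurable ℓ)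
    (hsymm : ∀ (τ : Equiv.Perm (Fin r)) (y : Fin r → 𝒴), ℓ (y ∘ τ) = ℓ y)
    (hℓ2 : MemLp ℓ 2 (Measure.pi fun _ : Fin r => Q)) (k : Fin r) :
    ∀ᵐ y ∂Q, ∫ v, degKernel Q ℓ (Function.update v k y) ∂(Measure.pi fun _ : Fin r => Q) = 0 := by
  filter_upwards [integrable_update hℓ2 k] with y hy
  have hp : Integrable (fun y => proj1 Q ℓ y - kmean Q ℓ) Q :=
    ((memLp_proj1 hℓ hℓ2).integrable one_le_two).sub (integrable_const _)
  have hpm : Measurable fun y => proj1 Q ℓ y - kmean Q ℓ := (measurable_proj1 hℓ).sub_const _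
  have hterm : ∀ j, Integrable (fun v : Fin r → 𝒴 =>
      proj1 Q ℓ (Function.update v k y j) - kmean Q ℓ) (Measure.pi fun _ : Fin r => Q) ∧
      ∫ v, (proj1 Q ℓ (Function.update v k y j) - kmean Q ℓ) ∂(Measure.pi fun _ : Fin r => Q)
        = if j = k then proj1 Q ℓ y - kmean Q ℓ else 0 := by
    intro j
    by_cases h : j = k
    · subst h; simp
    · simp only [Function.update_of_ne h, if_neg h]
      refine ⟨(measurePreserving_eval (fun _ : Fin r => Q) j).integrable_comp_of_integrable hp, ?_⟩
      rw [integral_eval (g := fun y => proj1 Q ℓ y - kmean Q ℓ) hpm j,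
        integral_sub ((memLp_proj1 hℓ hℓ2).integrable one_le_two) (integrable_const _),
        integral_proj1 hℓ hℓ2]
      simp
  simp only [degKernel]
  have h1 := integral_sub (hy.sub (integrable_const (kmean Q ℓ)))
    (integrable_finsetSum Finset.univ fun j _ => (hterm j).1)
  simp only [Pi.sub_apply] at h1
  rw [h1, integral_sub hy (integrable_const _), integral_update_eq_proj1 hℓ hsymm,
    integral_finsetSum _ fun j _ => (hterm j).1, Finset.sum_congr rfl fun j _ => (hterm j).2]
  simp

end kernel

/-! ### The remainder of the Hoeffding projection -/

section remainder

variable {𝒴 : Type*} [MeasurableSpace 𝒴] {Q : Measure 𝒴}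
  {r n : ℕ} [NeZero r] {ℓ : (Fin r → 𝒴) → ℝ}

/-- The degenerate kernel evaluated at the arguments selected by `i`. -/
def degTerm (Q : Measure 𝒴) (ℓ : (Fin r → 𝒴) → ℝ) (i : Fin r → Fin n) (D : Fin n → 𝒴) : ℝ :=
  degKernel Q ℓ fun k => D (i k)

/-- The remainder of the Hoeffding projection of the U-statistic. -/
def uRem (Q : Measure 𝒴) (ℓ : (Fin r → 𝒴) → ℝ) (D : Fin n → 𝒴) : ℝ :=
  ((n.choose r : ℕ) : ℝ)⁻¹ * ∑ i ∈ incMaps r n, degTerm Q ℓ i D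

/-- The Hoeffding decomposition. -/
lemma UStat_eq (hrn : r < n) (D : Fin n → 𝒴) :
    UStat ℓ D - kmean Q ℓ = r / n * ∑ a, (proj1 Q ℓ (D a) - kmean Q ℓ) + uRem Q ℓ D := by
  classical
  have hc : (n.choose r : ℝ) ≠ 0 := by
    exact_mod_cast (Nat.choose_pos hrn.le).ne'
  -- Double counting: every index lies in the image of a fraction `r / n` of the increasing maps.
  have hlin : ∑ i ∈ incMaps r n, ∑ k, (proj1 Q ℓ (D (i k)) - kmean Q ℓ)
      = n.choose r * (r / n) * ∑ a, (proj1 Q ℓ (D a) - kmean Q ℓ) := by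
    set u : Fin n → ℝ := fun a => proj1 Q ℓ (D a) - kmean Q ℓ
    have h1 : ∀ i ∈ incMaps r n, ∑ k, u (i k) = ∑ a, if ∃ k, i k = a then u a else 0 := by
      intro i hi
      rw [← Finset.sum_filter]
      have : Finset.univ.filter (fun a => ∃ k, i k = a) = Finset.univ.image i := by
        ext a; simp
      rw [this, Finset.sum_image fun x _ y _ h => (mem_incMaps.1 hi).injective h]
    calc ∑ i ∈ incMaps r n, ∑ k, u (i k)
        = ∑ a, ∑ i ∈ incMaps r n, if ∃ k, i k = a then u a else 0 := by
          rw [Finset.sum_congr rfl h1, Finset.sum_comm]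
      _ = ∑ a, n.choose r * (r / n) * u a := by
          refine Finset.sum_congr rfl fun a _ => ?_
          rw [← Finset.sum_filter, Finset.sum_const, nsmul_eq_mul,
            card_incMaps_mem (Nat.pos_of_ne_zero (NeZero.ne r)) hrn]
      _ = _ := by rw [Finset.mul_sum]
  have hdeg : ∑ i ∈ incMaps r n, degTerm Q ℓ i D
      = ∑ i ∈ incMaps r n, ℓ (fun k => D (i k)) - n.choose r * kmean Q ℓ
        - n.choose r * (r / n) * ∑ a, (proj1 Q ℓ (D a) - kmean Q ℓ) := by
    rw [← hlin]
    simp only [degTerm, degKernel]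
    rw [Finset.sum_sub_distrib, Finset.sum_sub_distrib, Finset.sum_const, card_incMaps,
      nsmul_eq_mul]
  have hU : UStat ℓ D = ((n.choose r : ℕ) : ℝ)⁻¹ * ∑ i ∈ incMaps r n, ℓ (fun k => D (i k)) := rfl
  rw [hU, uRem, hdeg]
  field_simp
  ring

variable [IsProbabilityMeasure Q]

lemma measurable_degTerm (hℓ : Measurable ℓ) (i : Fin r → Fin n) : Measurable (degTerm Q ℓ i) :=
  (measurable_degKernel hℓ).comp (measurable_pi_lambda _ fun k => measurable_pi_apply (i k))

lemma memLp_degTerm (hℓ : Measurable ℓ) (hℓ2 : MemLp ℓ 2 (Measure.pi fun _ : Fin r => Q))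
    {i : Fin r → Fin n} (hi : Function.Injective i) :
    MemLp (degTerm Q ℓ i) 2 (Measure.pi fun _ : Fin n => Q) :=
  (degKernel_second_moment hℓ hℓ2).1.comp_measurePreserving
    (measurePreserving_comp_injective Q hi)

/-- Two degenerate terms with at most one common argument are uncorrelated. -/
lemma integral_degTerm_mul_eq_zero (hℓ : Measurable ℓ)
    (hsymm : ∀ (τ : Equiv.Perm (Fin r)) (y : Fin r → 𝒴), ℓ (y ∘ τ) = ℓ y)
    (hℓ2 : MemLp ℓ 2 (Measure.pi fun _ : Fin r => Q)) {i j : Fin r → Fin n}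
    (hi : Function.Injective i) (hj : Function.Injective j) (k : Fin r)
    (hij : ∀ k', k' ≠ k → ∀ l, j l ≠ i k') :
    ∫ D, degTerm Q ℓ i D * degTerm Q ℓ j D ∂(Measure.pi fun _ : Fin n => Q) = 0 := by
  classical
  set μ := Measure.pi fun _ : Fin n => Q with hμ
  -- `B` holds the observations used by `i` apart from `i k`; none of them is used by `j`. Averaging
  -- over `B` alone leaves the second factor fixed and annihilates the first by degeneracy.
  set B : Finset (Fin n) := (Finset.univ.erase k).image i with hB
  have hmix := measurePreserving_mix Q B
  have hmm : Measurable fun D => degTerm Q ℓ i D * degTerm Q ℓ j D :=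
    (measurable_degTerm hℓ i).mul (measurable_degTerm hℓ j)
  have hint := integrable_mul_of_memLp_two (memLp_degTerm (n := n) hℓ hℓ2 hi)
    (memLp_degTerm hℓ hℓ2 hj)
  have hint2 := hmix.integrable_comp_of_integrable hint
  rw [← integral_comp_measurePreserving hmix hmm]
  refine (integral_prod _ hint2).trans ?_
  simp only [Function.comp]
  have hk := (measurePreserving_eval (fun _ : Fin n => Q) (i k)).quasiMeasurePreserving.ae
    (integral_degKernel_update hℓ hsymm hℓ2 k)
  rw [← integral_zero (Fin n → 𝒴) ℝ (μ := μ)]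
  refine integral_congr_ae ?_
  filter_upwards [hk] with D hD
  have hBi : ∀ k', i k' ∈ B ↔ k' ≠ k := fun k' => by
    simp only [hB, Finset.mem_image, Finset.mem_erase, Finset.mem_univ, and_true]
    constructor
    · rintro ⟨a, ha, hak⟩; rwa [← hi hak]
    · exact fun h => ⟨k', h, rfl⟩
  have hBj : ∀ l, j l ∉ B := fun l h => by
    simp only [hB, Finset.mem_image, Finset.mem_erase, Finset.mem_univ, and_true] at h
    obtain ⟨a, ha, hal⟩ := h
    exact hij a ha l hal.symm
  have e1 : ∀ D' : Fin n → 𝒴, degTerm Q ℓ j (fun a => if a ∈ B then D' a else D a)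
      = degTerm Q ℓ j D := fun D' => by
    simp [degTerm, hBj]
  have e2 : ∀ D' : Fin n → 𝒴, degTerm Q ℓ i (fun a => if a ∈ B then D' a else D a)
      = degKernel Q ℓ (Function.update (fun k' => D' (i k')) k (D (i k))) := fun D' => by
    rw [degTerm]
    congr 1
    ext k'
    simp only [hBi, Function.update_apply]
    by_cases h : k' = k
    · simp [h]
    · simp [h]
  simp only [e1, e2]
  rw [integral_mul_const, integral_comp_measurePreserving (measurePreserving_comp_injective Q hi)
    (g := fun v => degKernel Q ℓ (Function.update v k (D (i k))))
    ((measurable_degKernel hℓ).comp measurable_update_left)]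
  rw [show ∫ v, degKernel Q ℓ (Function.update v k (D (i k))) ∂(Measure.pi fun _ : Fin r => Q) = 0
    from hD, zero_mul]

/-- The bound on the second moment of a degenerate term. -/
def degBound (Q : Measure 𝒴) (ℓ : (Fin r → 𝒴) → ℝ) : ℝ :=
  ((1 + r) * √(Var[ℓ; Measure.pi fun _ : Fin r => Q])) ^ 2

lemma integral_degTerm_mul_le (hℓ : Measurable ℓ)
    (hℓ2 : MemLp ℓ 2 (Measure.pi fun _ : Fin r => Q)) {i j : Fin r → Fin n}
    (hi : Function.Injective i) (hj : Function.Injective j) :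
    ∫ D, degTerm Q ℓ i D * degTerm Q ℓ j D ∂(Measure.pi fun _ : Fin n => Q) ≤ degBound Q ℓ := by
  have hsq : ∀ {i : Fin r → Fin n}, Function.Injective i →
      ∫ D, degTerm Q ℓ i D ^ 2 ∂(Measure.pi fun _ : Fin n => Q) ≤ degBound Q ℓ := fun hi => by
    refine le_trans (le_of_eq ?_) (degKernel_second_moment hℓ hℓ2).2
    exact integral_comp_measurePreserving (measurePreserving_comp_injective Q hi)
      ((measurable_degKernel hℓ).pow_const 2)
  have h0 : 0 ≤ degBound Q ℓ := sq_nonneg _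
  have h := integral_abs_mul_le (memLp_degTerm (n := n) hℓ hℓ2 hi) (memLp_degTerm hℓ hℓ2 hj)
  calc _ ≤ ∫ D, |degTerm Q ℓ i D * degTerm Q ℓ j D| ∂(Measure.pi fun _ : Fin n => Q) :=
        (le_abs_self _).trans abs_integral_le_integral_abs
    _ ≤ _ := h
    _ ≤ √(degBound Q ℓ) * √(degBound Q ℓ) :=
        mul_le_mul (Real.sqrt_le_sqrt (hsq hi)) (Real.sqrt_le_sqrt (hsq hj))
          (Real.sqrt_nonneg _) (Real.sqrt_nonneg _)
    _ = _ := Real.mul_self_sqrt h0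

open Classical in
/-- If every term of a family is correlated with at most `c` terms of the family, the second
moment of the sum is at most the number of terms times `c`. -/
lemma integral_sum_degTerm_sq_le (hℓ : Measurable ℓ)
    (hsymm : ∀ (τ : Equiv.Perm (Fin r)) (y : Fin r → 𝒴), ℓ (y ∘ τ) = ℓ y)
    (hℓ2 : MemLp ℓ 2 (Measure.pi fun _ : Fin r => Q)) {F : Finset (Fin r → Fin n)}
    (hF : ∀ i ∈ F, Function.Injective i) {c : ℝ}
    (hc : ∀ i ∈ F, ((F.filter fun j => ∀ k, ∃ k', k' ≠ k ∧ ∃ l, j l = i k').card : ℝ) ≤ c) :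
    ∫ D, (∑ i ∈ F, degTerm Q ℓ i D) ^ 2 ∂(Measure.pi fun _ : Fin n => Q) ≤
      F.card * (c * degBound Q ℓ) := by
  have h0 : 0 ≤ degBound Q ℓ := sq_nonneg _
  have e : ∫ D, (∑ i ∈ F, degTerm Q ℓ i D) ^ 2 ∂(Measure.pi fun _ : Fin n => Q)
      = ∑ i ∈ F, ∑ j ∈ F, ∫ D, degTerm Q ℓ i D * degTerm Q ℓ j D
        ∂(Measure.pi fun _ : Fin n => Q) := by
    have hI : ∀ i ∈ F, ∀ j ∈ F, Integrable (fun D => degTerm Q ℓ i D * degTerm Q ℓ j D)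
        (Measure.pi fun _ : Fin n => Q) := fun i hi j hj =>
      integrable_mul_of_memLp_two (memLp_degTerm hℓ hℓ2 (hF i hi)) (memLp_degTerm hℓ hℓ2 (hF j hj))
    simp only [sq, Finset.sum_mul_sum]
    rw [integral_finsetSum _ fun i hi => integrable_finsetSum _ fun j hj => hI i hi j hj]
    exact Finset.sum_congr rfl fun i hi => integral_finsetSum _ fun j hj => hI i hi j hj
  rw [e, ← nsmul_eq_mul]
  refine Finset.sum_le_card_nsmul _ _ _ fun i hi => ?_
  rw [← Finset.sum_filter_add_sum_filter_not F
    (fun j => ∀ k, ∃ k', k' ≠ k ∧ ∃ l, j l = i k')]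
  have z : ∑ j ∈ F with ¬ ∀ k, ∃ k', k' ≠ k ∧ ∃ l, j l = i k',
      ∫ D, degTerm Q ℓ i D * degTerm Q ℓ j D ∂(Measure.pi fun _ : Fin n => Q) = 0 := by
    refine Finset.sum_eq_zero fun j hj => ?_
    rw [Finset.mem_filter] at hj
    obtain ⟨hj, hk⟩ := hj
    push Not at hk
    obtain ⟨k, hk⟩ := hk
    exact integral_degTerm_mul_eq_zero hℓ hsymm hℓ2 (hF i hi) (hF j hj) k hk
  rw [z, add_zero]
  refine (Finset.sum_le_card_nsmul _ _ (degBound Q ℓ) fun j hj =>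
    integral_degTerm_mul_le hℓ hℓ2 (hF i hi) (hF j (Finset.mem_filter.1 hj).1)).trans ?_
  rw [nsmul_eq_mul]
  exact mul_le_mul_of_nonneg_right (hc i hi) h0

open Classical in
-- Applying the condition at position `0` gives one common index, and applying it again at the
-- position found gives a different one. There are at most `r ^ 2` pairs of positions.
lemma card_correlated_le (hrn : r < n) {i : Fin r → Fin n} (hi : StrictMono i) :
    (((incMaps r n).filter fun j => ∀ k, ∃ k', k' ≠ k ∧ ∃ l, j l = i k').card : ℝ) ≤
      r ^ 2 * (n.choose r * (2 * r ^ 2 / n ^ 2)) := by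
  have hsub : (incMaps r n).filter (fun j => ∀ k, ∃ k', k' ≠ k ∧ ∃ l, j l = i k') ⊆
      (Finset.univ.filter fun p : Fin r × Fin r => p.1 ≠ p.2).biUnion fun p =>
        (incMaps r n).filter fun j => (∃ l, j l = i p.1) ∧ ∃ l, j l = i p.2 := by
    intro j hj
    rw [Finset.mem_filter] at hj
    obtain ⟨k, -, hk⟩ := hj.2 0
    obtain ⟨k', hk', hk2⟩ := hj.2 k
    exact Finset.mem_biUnion.2 ⟨(k, k'), by simpa using hk'.symm,
      Finset.mem_filter.2 ⟨hj.1, hk, hk2⟩⟩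
  have h1 := (Finset.card_le_card hsub).trans Finset.card_biUnion_le
  have h2 : (((incMaps r n).filter fun j => ∀ k, ∃ k', k' ≠ k ∧ ∃ l, j l = i k').card : ℝ) ≤
      ∑ p : Fin r × Fin r with p.1 ≠ p.2, (((incMaps r n).filter fun j =>
        (∃ l, j l = i p.1) ∧ ∃ l, j l = i p.2).card : ℝ) := by exact_mod_cast h1
  refine h2.trans ?_
  refine (Finset.sum_le_card_nsmul _ _ ((n.choose r : ℝ) * (2 * r ^ 2 / n ^ 2)) fun p hp => ?_).trans ?_
  · exact card_incMaps_mem_two hrn (hi.injective.ne (Finset.mem_filter.1 hp).2)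
  · rw [nsmul_eq_mul]
    refine mul_le_mul_of_nonneg_right ?_ (by positivity)
    have := Finset.card_filter_le (Finset.univ (α := Fin r × Fin r)) (fun p => p.1 ≠ p.2)
    simp only [Finset.card_univ, Fintype.card_prod, Fintype.card_fin] at this
    rw [sq]; exact_mod_cast this

lemma measurable_uRem (hℓ : Measurable ℓ) : Measurable (uRem (n := n) Q ℓ) :=
  (Finset.measurable_fun_sum _ fun i _ => measurable_degTerm hℓ i).const_mul _

/-- Of the squared number of pairs of terms, only a fraction `2 r⁴ / n²` can be correlated. -/
lemma uRem_second_moment (hrn : r < n) (hℓ : Measurable ℓ)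
    (hsymm : ∀ (τ : Equiv.Perm (Fin r)) (y : Fin r → 𝒴), ℓ (y ∘ τ) = ℓ y)
    (hℓ2 : MemLp ℓ 2 (Measure.pi fun _ : Fin r => Q)) :
    ∫⁻ D, ‖uRem Q ℓ D‖ₑ ^ 2 ∂(Measure.pi fun _ : Fin n => Q) ≤
      ENNReal.ofReal (2 * r ^ 4 * degBound Q ℓ / n ^ 2) := by
  classical
  have hc : (0 : ℝ) < n.choose r := by exact_mod_cast Nat.choose_pos hrn.le
  have hn : (0 : ℝ) < n := by exact_mod_cast (Nat.zero_le r).trans_lt hrn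
  have hinj : ∀ i ∈ incMaps r n, Function.Injective i := fun i hi => (mem_incMaps.1 hi).injective
  have h := integral_sum_degTerm_sq_le hℓ hsymm hℓ2 hinj
    (fun i hi => card_correlated_le hrn (mem_incMaps.1 hi))
  have hL : MemLp (fun D => ∑ i ∈ incMaps r n, degTerm Q ℓ i D) 2
      (Measure.pi fun _ : Fin n => Q) :=
    memLp_finsetSum _ fun i hi => memLp_degTerm hℓ hℓ2 (hinj i hi)
  simp only [uRem]
  rw [lintegral_enorm_const_mul_sq, ← ofReal_integral_sq hL, ← ENNReal.ofReal_mul (sq_nonneg _)]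
  refine ENNReal.ofReal_le_ofReal ?_
  refine (mul_le_mul_of_nonneg_left h (sq_nonneg _)).trans (le_of_eq ?_)
  rw [card_incMaps]
  field_simp

/-- Only terms that use observation `a` change, a fraction `r / n` of all, and each is correlated
with at most a fraction `2 r³ / n²`. The factor `8` is `2` times the `4` from bounding the squared
difference of two identically distributed sums. -/
lemma uRem_increment (hrn : r < n) (hℓ : Measurable ℓ)
    (hsymm : ∀ (τ : Equiv.Perm (Fin r)) (y : Fin r → 𝒴), ℓ (y ∘ τ) = ℓ y)
    (hℓ2 : MemLp ℓ 2 (Measure.pi fun _ : Fin r => Q)) (a : Fin n) :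
    ∫⁻ p, ‖uRem Q ℓ p.1 - uRem Q ℓ (Function.update p.1 a p.2)‖ₑ ^ 2
      ∂((Measure.pi fun _ : Fin n => Q).prod Q) ≤
      ENNReal.ofReal (8 * r ^ 4 * degBound Q ℓ / n ^ 3) := by
  classical
  have hc : (0 : ℝ) < n.choose r := by exact_mod_cast Nat.choose_pos hrn.le
  have hn : (0 : ℝ) < n := by exact_mod_cast (Nat.zero_le r).trans_lt hrn
  set μ := Measure.pi fun _ : Fin n => Q with hμ
  set F := (incMaps r n).filter fun i => ∃ k, i k = a with hF
  have hmem : ∀ i ∈ F, StrictMono i ∧ ∃ k, i k = a := fun i hi => by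
    rw [hF, Finset.mem_filter, mem_incMaps] at hi; exact hi
  have hinj : ∀ i ∈ F, Function.Injective i := fun i hi => (hmem i hi).1.injective
  have h := integral_sum_degTerm_sq_le hℓ hsymm hℓ2 hinj
    (fun i hi => card_correlated_mem_le hrn (hmem i hi).1 (hmem i hi).2)
  set S : (Fin n → 𝒴) → ℝ := fun D => ∑ i ∈ F, degTerm Q ℓ i D with hS
  have hSm : Measurable S := Finset.measurable_fun_sum _ fun i _ => measurable_degTerm hℓ i
  have hL : MemLp S 2 μ := memLp_finsetSum _ fun i hi => memLp_degTerm hℓ hℓ2 (hinj i hi)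
  have hup := measurePreserving_update Q a
  have e : ∀ p : (Fin n → 𝒴) × 𝒴, uRem Q ℓ p.1 - uRem Q ℓ (Function.update p.1 a p.2)
      = ((n.choose r : ℕ) : ℝ)⁻¹ * (S p.1 + -S (Function.update p.1 a p.2)) := by
    intro p
    rw [uRem, uRem, ← mul_sub, ← Finset.sum_sub_distrib, hS, ← sub_eq_add_neg,
      ← Finset.sum_sub_distrib, hF, Finset.sum_filter]
    congr 1
    refine Finset.sum_congr rfl fun i _ => ?_
    split_ifs with hi
    · rfl
    · push Not at hi
      rw [sub_eq_zero, degTerm, degTerm]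
      congr 1
      ext k
      rw [Function.update_of_ne (hi k)]
  simp only [e]
  rw [lintegral_enorm_const_mul_sq]
  have h1 := lintegral_enorm_add_sq_le (μ := μ.prod Q) (X := fun p => S p.1)
    (Y := fun p => -S (Function.update p.1 a p.2)) (hSm.comp measurable_fst)
    (hSm.comp hup.measurable).neg
  have h2 : ∫⁻ p, ‖S p.1‖ₑ ^ 2 ∂(μ.prod Q) = ∫⁻ D, ‖S D‖ₑ ^ 2 ∂μ :=
    (measurePreserving_fst (μ := μ) (ν := Q)).lintegral_comp (hSm.enorm.pow_const 2)
  have h3 : ∫⁻ p, ‖-S (Function.update p.1 a p.2)‖ₑ ^ 2 ∂(μ.prod Q) = ∫⁻ D, ‖S D‖ₑ ^ 2 ∂μ := by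
    simp only [enorm_neg]
    exact hup.lintegral_comp (hSm.enorm.pow_const 2)
  rw [h2, h3, ← ofReal_integral_sq hL, ← two_mul, ← mul_assoc] at h1
  refine (mul_le_mul_right h1 _).trans ?_
  rw [← ENNReal.ofReal_ofNat, ← ENNReal.ofReal_mul (by norm_num),
    ← ENNReal.ofReal_mul (by norm_num), ← ENNReal.ofReal_mul (sq_nonneg _)]
  refine ENNReal.ofReal_le_ofReal ?_
  have h4 : (F.card : ℝ) = n.choose r * (r / n) :=
    card_incMaps_mem (Nat.pos_of_ne_zero (NeZero.ne r)) hrn a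
  rw [h4] at h
  calc _ ≤ (((n.choose r : ℕ) : ℝ)⁻¹) ^ 2 * (2 * 2 * (n.choose r * (r / n) *
        (r * (n.choose r * (2 * r ^ 2 / n ^ 2)) * degBound Q ℓ))) := by gcongr
    _ = _ := by field_simp; ring

end remainder

/-! ### Weighted sums of a function trained on the other fold -/

section crossfit

variable {ι E : Type*}

/-- The constant in the second moment bound for weighted sums over `B`. -/
def wtBound (c : ι → ℝ) (B : Finset ι) : ℝ := ∑ j ∈ B, c j ^ 2 + (∑ j ∈ B, c j) ^ 2

lemma wtBound_nonneg (c : ι → ℝ) (B : Finset ι) : 0 ≤ wtBound c B :=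
  add_nonneg (Finset.sum_nonneg fun _ _ => sq_nonneg _) (sq_nonneg _)

/-- `h D` does not depend on the coordinates of `D` in `B`. -/
def DependsOff (B : Finset ι) (h : (ι → E) → E → ℝ) : Prop :=
  ∀ D D' : ι → E, (∀ j, j ∉ B → D j = D' j) → h D = h D'

/-- The weighted sum over `B` of the values of a trained function. -/
def wtSum (c : ι → ℝ) (B : Finset ι) (h : (ι → E) → E → ℝ) (D : ι → E) : ℝ :=
  ∑ j ∈ B, c j * h D (D j)

variable [MeasurableSpace E]

lemma measurable_eval_uncurry {h : (ι → E) → E → ℝ} (hm : Measurable (Function.uncurry h))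
    (j : ι) : Measurable fun D : ι → E => h D (D j) :=
  hm.comp (measurable_id.prodMk (measurable_pi_apply j))

lemma measurable_wtSum (c : ι → ℝ) (B : Finset ι) {h : (ι → E) → E → ℝ}
    (hm : Measurable (Function.uncurry h)) : Measurable (wtSum c B h) :=
  Finset.measurable_fun_sum _ fun j _ => (measurable_eval_uncurry hm j).const_mul _

variable [Fintype ι] {P : Measure E} [IsProbabilityMeasure P]

/-- The variance of the sum is `∑ c² Var g`, its squared mean is `(∑ c)² (E g)²`, and both `Var g`
and `(E g)²` are at most `E g²`. -/
lemma lintegral_weighted_sum_sq_le (c : ι → ℝ) (B : Finset ι) {g : E → ℝ} (hg : Measurable g) :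
    ∫⁻ D, ‖∑ j ∈ B, c j * g (D j)‖ₑ ^ 2 ∂(Measure.pi fun _ : ι => P) ≤
      ENNReal.ofReal (wtBound c B) * ∫⁻ x, ‖g x‖ₑ ^ 2 ∂P := by
  by_cases hfin : ∫⁻ x, ‖g x‖ₑ ^ 2 ∂P < ⊤
  · have hg2 : MemLp g 2 P := memLp_two_of_lintegral hg.aestronglyMeasurable hfin
    set μ := Measure.pi fun _ : ι => P
    set X : ι → (ι → E) → ℝ := fun j D => c j * g (D j) with hX
    have hev : ∀ j, MeasurePreserving (fun D : ι → E => D j) μ P :=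
      fun j => measurePreserving_eval (fun _ => P) j
    have hgj : ∀ j, MemLp (fun D : ι → E => g (D j)) 2 μ :=
      fun j => hg2.comp_measurePreserving (hev j)
    have hX2 : ∀ j, MemLp (X j) 2 μ := fun j => (hgj j).const_mul (c j)
    have hind : iIndepFun X μ := iIndepFun_pi (X := fun j x => c j * g x)
      fun j => (hg.const_mul _).aemeasurable
    have hvar := IndepFun.variance_sum (s := B) (fun j _ => hX2 j)
      (fun i _ j _ hij => hind.indepFun hij)
    have hS2 : MemLp (∑ j ∈ B, X j) 2 μ := memLp_finsetSum' B fun j _ => hX2 j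
    have hvX : ∀ j, Var[X j; μ] = c j ^ 2 * Var[g; P] := fun j => by
      rw [hX, variance_const_mul]
      congr 1
      exact (hev j).variance_fun_comp hg.aemeasurable
    have hmean : ∫ D, (∑ j ∈ B, X j) D ∂μ = (∑ j ∈ B, c j) * ∫ x, g x ∂P := by
      simp only [Finset.sum_apply]
      rw [integral_finsetSum _ fun j _ => (hX2 j).integrable one_le_two, Finset.sum_mul]
      refine Finset.sum_congr rfl fun j _ => ?_
      rw [hX]
      simp only []
      rw [integral_const_mul, integral_eval hg]
    have hsq : ∫ D, (∑ j ∈ B, X j) D ^ 2 ∂μ ≤ wtBound c B * ∫ x, g x ^ 2 ∂P := by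
      have h1 := variance_eq_sub hS2
      rw [hvar, hmean, Finset.sum_congr rfl fun j _ => hvX j, ← Finset.sum_mul] at h1
      have h2 := variance_le_expectation_sq (X := g) (μ := P) hg.aestronglyMeasurable
      have h3 := variance_nonneg g P
      rw [variance_eq_sub hg2] at h3
      simp only [Pi.pow_apply] at h1 h2 h3
      have h4 : 0 ≤ ∑ j ∈ B, c j ^ 2 := Finset.sum_nonneg fun _ _ => sq_nonneg _
      rw [wtBound]
      nlinarith [mul_le_mul_of_nonneg_left h2 h4, sq_nonneg (∑ j ∈ B, c j)]
    have e : ∀ D : ι → E, ∑ j ∈ B, c j * g (D j) = (∑ j ∈ B, X j) D := fun D => by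
      simp [hX]
    simp only [e]
    rw [← ofReal_integral_sq hS2, ← ofReal_integral_sq hg2,
      ← ENNReal.ofReal_mul (wtBound_nonneg c B)]
    exact ENNReal.ofReal_le_ofReal hsq
  -- If `E g² = ∞`, the right side is `∞` unless the constant vanishes. In that case all weights in
  -- `B` are zero and so is the left side.
  · rw [not_lt, top_le_iff] at hfin
    rw [hfin]
    rcases (wtBound_nonneg c B).eq_or_lt with h | h
    · have h1 : ∑ j ∈ B, c j ^ 2 = 0 := by
        have := Finset.sum_nonneg fun j (_ : j ∈ B) => sq_nonneg (c j)
        rw [wtBound] at h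
        nlinarith [sq_nonneg (∑ j ∈ B, c j)]
      have h2 := (Finset.sum_eq_zero_iff_of_nonneg fun j _ => sq_nonneg (c j)).1 h1
      have h3 : ∀ D : ι → E, ∑ j ∈ B, c j * g (D j) = 0 := fun D =>
        Finset.sum_eq_zero fun j hj => by rw [pow_eq_zero_iff two_ne_zero |>.1 (h2 j hj), zero_mul]
      simp [h3]
    · rw [ENNReal.mul_top (by simpa using h)]
      exact le_top

variable [DecidableEq ι]

/-- Given the coordinates outside `B` the trained function is fixed and the evaluation points are
i.i.d., so the bound for a fixed function applies. -/
lemma lintegral_wtSum_sq_le (c : ι → ℝ) {B : Finset ι} {h : (ι → E) → E → ℝ}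
    (hm : Measurable (Function.uncurry h)) (hB : DependsOff B h) :
    ∫⁻ D, ‖wtSum c B h D‖ₑ ^ 2 ∂(Measure.pi fun _ : ι => P) ≤
      ENNReal.ofReal (wtBound c B) *
        ∫⁻ D, ∫⁻ x, ‖h D x‖ₑ ^ 2 ∂P ∂(Measure.pi fun _ : ι => P) := by
  have hmix := measurePreserving_mix P B
  have hmS : Measurable fun D => ‖wtSum c B h D‖ₑ ^ 2 := (measurable_wtSum c B hm).enorm.pow_const 2
  have hmm : Measurable fun p : (ι → E) × (ι → E) =>
      ‖wtSum c B h (fun j => if j ∈ B then p.2 j else p.1 j)‖ₑ ^ 2 := hmS.comp hmix.measurable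
  rw [← hmix.lintegral_comp hmS, lintegral_prod _ hmm.aemeasurable,
    ← lintegral_const_mul' _ _ ENNReal.ofReal_ne_top]
  refine lintegral_mono fun D => ?_
  refine le_trans (le_of_eq ?_) (lintegral_weighted_sum_sq_le c B (g := h D)
    (hm.comp (measurable_const.prodMk measurable_id)))
  refine lintegral_congr fun D' => ?_
  have e : h (fun j => if j ∈ B then D' j else D j) = h D := hB _ _ fun j hj => by simp [hj]
  simp only [wtSum, e]
  congr 2
  exact Finset.sum_congr rfl fun j hj => by simp [hj]

/-- If `i ∈ B`, the trained function is unchanged and one evaluation point moves. If `i ∉ B`, the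
evaluation points stay and the function is retrained; the difference of the two functions still
ignores the coordinates in `B`, so it obeys the second moment bound. The right side adds both cases.
-/
lemma lintegral_wtSum_increment_le (c : ι → ℝ) {B : Finset ι} {h : (ι → E) → E → ℝ}
    (hm : Measurable (Function.uncurry h)) (hB : DependsOff B h) (i : ι) :
    ∫⁻ p, ‖wtSum c B h p.1 - wtSum c B h (Function.update p.1 i p.2)‖ₑ ^ 2
        ∂((Measure.pi fun _ : ι => P).prod P) ≤
      ENNReal.ofReal (4 * c i ^ 2) * ∫⁻ D, ∫⁻ x, ‖h D x‖ₑ ^ 2 ∂P ∂(Measure.pi fun _ : ι => P) +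
      ENNReal.ofReal (wtBound c B) * ∫⁻ D, ∫⁻ z, ∫⁻ x, ‖h D x - h (Function.update D i z) x‖ₑ ^ 2
        ∂P ∂P ∂(Measure.pi fun _ : ι => P) := by
  set μ := Measure.pi fun _ : ι => P
  have hup := measurePreserving_update P i
  have hex := measurePreserving_exchange P i
  by_cases hi : i ∈ B
  · refine le_trans ?_ le_self_add
    have e : ∀ p : (ι → E) × E, wtSum c B h p.1 - wtSum c B h (Function.update p.1 i p.2)
        = c i * (h p.1 (p.1 i) + -h p.1 p.2) := by
      intro p
      have e1 : h (Function.update p.1 i p.2) = h p.1 := hB _ _ fun j hj => by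
        rw [Function.update_of_ne]; rintro rfl; exact hj hi
      rw [wtSum, wtSum, e1, ← Finset.add_sum_erase _ _ hi,
        ← Finset.add_sum_erase _ (fun j => c j * h p.1 (Function.update p.1 i p.2 j)) hi]
      have e2 : ∑ j ∈ B.erase i, c j * h p.1 (Function.update p.1 i p.2 j)
          = ∑ j ∈ B.erase i, c j * h p.1 (p.1 j) := Finset.sum_congr rfl fun j hj => by
        rw [Function.update_of_ne (Finset.ne_of_mem_erase hj)]
      rw [e2, Function.update_self]
      ring
    simp only [e]
    rw [lintegral_enorm_const_mul_sq]
    have hmp : Measurable fun q : (ι → E) × E => ‖h q.1 q.2‖ₑ ^ 2 := hm.enorm.pow_const 2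
    have h1 : ∫⁻ p, ‖h p.1 p.2‖ₑ ^ 2 ∂(μ.prod P) = ∫⁻ D, ∫⁻ x, ‖h D x‖ₑ ^ 2 ∂P ∂μ :=
      lintegral_prod _ hmp.aemeasurable
    -- `h` ignores coordinate `i`, so evaluating at `D i` has the same law as evaluating at a fresh
    -- copy.
    have h2 : ∫⁻ p, ‖h p.1 (p.1 i)‖ₑ ^ 2 ∂(μ.prod P) = ∫⁻ p, ‖h p.1 p.2‖ₑ ^ 2 ∂(μ.prod P) := by
      rw [← hex.lintegral_comp hmp]
      refine lintegral_congr fun p => ?_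
      have e1 : h (Function.update p.1 i p.2) = h p.1 := hB _ _ fun j hj => by
        rw [Function.update_of_ne]; rintro rfl; exact hj hi
      rw [e1]
    have h3 := lintegral_enorm_add_sq_le (μ := μ.prod P) (X := fun p => h p.1 (p.1 i))
      (Y := fun p => -h p.1 p.2) ((measurable_eval_uncurry hm i).comp measurable_fst)
      hm.neg
    simp only [enorm_neg] at h3
    rw [h2, h1, ← two_mul, ← mul_assoc] at h3
    refine (mul_le_mul_right h3 _).trans (le_of_eq ?_)
    rw [← mul_assoc, mul_comm 4 (c i ^ 2), ENNReal.ofReal_mul (sq_nonneg _)]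
    congr 2
    rw [← ENNReal.ofReal_ofNat, ← ENNReal.ofReal_mul (by norm_num)]
    norm_num
  · refine le_trans ?_ le_add_self
    have e : ∀ p : (ι → E) × E, wtSum c B h p.1 - wtSum c B h (Function.update p.1 i p.2)
        = wtSum c B (fun D x => h D x - h (Function.update D i p.2) x) p.1 := by
      intro p
      rw [wtSum, wtSum, wtSum, ← Finset.sum_sub_distrib]
      refine Finset.sum_congr rfl fun j hj => ?_
      rw [Function.update_of_ne (by rintro rfl; exact hi hj)]
      ring
    have hmD : Measurable fun p : (ι → E) × E =>
        ‖wtSum c B h p.1 - wtSum c B h (Function.update p.1 i p.2)‖ₑ ^ 2 :=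
      (((measurable_wtSum c B hm).comp measurable_fst).sub
        ((measurable_wtSum c B hm).comp hup.measurable)).enorm.pow_const 2
    rw [lintegral_prod_symm' _ hmD]
    have hm3 : Measurable fun q : ((ι → E) × E) × E =>
        ‖h q.1.1 q.2 - h (Function.update q.1.1 i q.1.2) q.2‖ₑ ^ 2 := by
      refine (Measurable.sub ?_ ?_).enorm.pow_const 2
      · exact hm.comp ((measurable_fst.comp measurable_fst).prodMk measurable_snd)
      · exact hm.comp ((hup.measurable.comp measurable_fst).prodMk measurable_snd)
    have hswap : ∫⁻ D, ∫⁻ z, ∫⁻ x, ‖h D x - h (Function.update D i z) x‖ₑ ^ 2 ∂P ∂P ∂μ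
        = ∫⁻ z, ∫⁻ D, ∫⁻ x, ‖h D x - h (Function.update D i z) x‖ₑ ^ 2 ∂P ∂μ ∂P :=
      lintegral_lintegral_swap (f := fun D z => ∫⁻ x,
        ‖h D x - h (Function.update D i z) x‖ₑ ^ 2 ∂P) hm3.lintegral_prod_right'.aemeasurable
    rw [hswap, ← lintegral_const_mul' _ _ ENNReal.ofReal_ne_top]
    refine lintegral_mono fun z => ?_
    refine le_trans (le_of_eq (lintegral_congr fun D => by rw [← e (D, z)]))
      (lintegral_wtSum_sq_le (P := P) c
        (h := fun D x => h D x - h (Function.update D i z) x) (B := B) ?_ ?_)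
    · refine Measurable.sub hm (hm.comp (Measurable.prodMk ?_ measurable_snd))
      exact measurable_update_left.comp measurable_fst
    · intro D D' hDD
      have e1 := hB D D' hDD
      have e2 := hB (Function.update D i z) (Function.update D' i z) fun j hj => by
        by_cases hji : j = i
        · subst hji; simp
        · rw [Function.update_of_ne hji, Function.update_of_ne hji, hDD j hj]
      simp only [e1, e2]

end crossfit

/-! ### The weights of the cross-fit statistic -/

section weights

variable (n m : ℕ)

/-- The weight with which the fitted value of each observation enters the statistic. -/
def cw : Fin n ⊕ Fin m → ℝ :=
  Sum.elim (fun _ => (m : ℝ) / (n * (n + m))) (fun _ => -(1 / ((n : ℝ) + m)))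

/-- The weight with which the projection of the kernel enters the statistic. -/
def bw : Fin n ⊕ Fin m → ℝ := Sum.elim (fun _ => 1 / (n : ℝ)) (fun _ => 0)

/-- The observations whose fitted value is computed from the second fold. -/
def firstFold : Finset (Fin n ⊕ Fin m) :=
  Finset.univ.filter fun i => Sum.elim (fun i : Fin n => decide ((i : ℕ) < n / 2))
    (fun j : Fin m => decide ((j : ℕ) < m / 2)) i

/-- The sum of the squared weights. -/
def kap : ℝ := (m : ℝ) / (n * (n + m))

variable {n m}

lemma kap_nonneg : 0 ≤ kap n m := by unfold kap; positivity

lemma mem_firstFold_inl {i : Fin n} : (Sum.inl i : Fin n ⊕ Fin m) ∈ firstFold n m ↔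
    (i : ℕ) < n / 2 := by simp [firstFold]

lemma mem_firstFold_inr {j : Fin m} : (Sum.inr j : Fin n ⊕ Fin m) ∈ firstFold n m ↔
    (j : ℕ) < m / 2 := by simp [firstFold]

/-- The statistic is thus insensitive to constants in the fitted functions, so `f` can be centered
for free. -/
lemma sum_cw (hn : 0 < n) : ∑ i, cw n m i = 0 := by
  have hn : (0 : ℝ) < n := by exact_mod_cast hn
  have hm : (0 : ℝ) ≤ m := Nat.cast_nonneg m
  simp [cw]
  field_simp
  ring

lemma sum_cw_sq (hn : 0 < n) : ∑ i, cw n m i ^ 2 = kap n m := by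
  have hn : (0 : ℝ) < n := by exact_mod_cast hn
  have hm : (0 : ℝ) ≤ m := Nat.cast_nonneg m
  simp [cw, kap]
  field_simp
  ring

lemma card_filter_val_lt (k : ℕ) : (Finset.univ.filter fun i : Fin k => (i : ℕ) < k / 2).card
    = k / 2 := by
  rw [Fin.card_filter_val_lt]; omega

lemma sum_firstFold_cw (hn : 0 < n) : ∑ i ∈ firstFold n m, cw n m i
    = (((n / 2 : ℕ) : ℝ) * m - n * ((m / 2 : ℕ) : ℝ)) / (n * (n + m)) := by
  have hn : (0 : ℝ) < n := by exact_mod_cast hn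
  have hm : (0 : ℝ) ≤ m := Nat.cast_nonneg m
  rw [firstFold, Finset.sum_filter, Fintype.sum_sum_type]
  simp only [Sum.elim_inl, Sum.elim_inr, cw, decide_eq_true_eq]
  rw [← Finset.sum_filter, ← Finset.sum_filter, Finset.sum_const, Finset.sum_const,
    card_filter_val_lt, card_filter_val_lt]
  simp only [nsmul_eq_mul]
  field_simp
  ring

/-- Both samples are halved, so the weights of a fold would cancel but for rounding. The floors
leave a numerator between `-m / 2` and `n / 2`, whose square is at most `(n + m)² / 4 ≤ n m (n + m)`
because `n + m ≤ 4 n m` for positive integers. -/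
lemma sum_firstFold_cw_sq_le (hn : 0 < n) : (∑ i ∈ firstFold n m, cw n m i) ^ 2 ≤ kap n m := by
  rw [sum_firstFold_cw hn, kap]
  have hn' : (1 : ℝ) ≤ n := by exact_mod_cast hn
  have a1 : (((n / 2 : ℕ) : ℝ)) * 2 ≤ n := by exact_mod_cast Nat.div_mul_le_self n 2
  have a2 : (n : ℝ) ≤ ((n / 2 : ℕ) : ℝ) * 2 + 1 := by exact_mod_cast (by omega : n ≤ n / 2 * 2 + 1)
  have b1 : (((m / 2 : ℕ) : ℝ)) * 2 ≤ m := by exact_mod_cast Nat.div_mul_le_self m 2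
  have b2 : (m : ℝ) ≤ ((m / 2 : ℕ) : ℝ) * 2 + 1 := by exact_mod_cast (by omega : m ≤ m / 2 * 2 + 1)
  rcases Nat.eq_zero_or_pos m with h | h
  · subst h; simp
  have hm' : (1 : ℝ) ≤ m := by exact_mod_cast h
  generalize ((n / 2 : ℕ) : ℝ) = p at *
  generalize ((m / 2 : ℕ) : ℝ) = q at *
  generalize (n : ℝ) = x at *
  generalize (m : ℝ) = y at *
  rw [div_pow, div_le_div_iff₀ (by positivity) (by positivity)]
  have h1 : p * y - x * q ≤ x / 2 := by nlinarith
  have h2 : -(y / 2) ≤ p * y - x * q := by nlinarith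
  have h3 : (p * y - x * q) ^ 2 ≤ y * (x * (x + y)) := by
    have h4 : (p * y - x * q) ^ 2 ≤ (x + y) ^ 2 / 4 := by
      have : |p * y - x * q| ≤ (x + y) / 2 := abs_le.2 ⟨by linarith, by linarith⟩
      have := pow_le_pow_left₀ (abs_nonneg _) this 2
      rw [sq_abs] at this
      linarith [this, (by ring : ((x + y) / 2) ^ 2 = (x + y) ^ 2 / 4)]
    have h5 : x + y ≤ 4 * (x * y) := by nlinarith
    nlinarith
  have h6 : 0 ≤ x * (x + y) := by positivity
  calc _ ≤ y * (x * (x + y)) * (x * (x + y)) := mul_le_mul_of_nonneg_right h3 h6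
    _ = _ := by ring

lemma wtBound_firstFold_le (hn : 0 < n) : wtBound (cw n m) (firstFold n m) ≤ 2 * kap n m := by
  have h1 := sum_firstFold_cw_sq_le (m := m) hn
  have h2 : ∑ j ∈ firstFold n m, cw n m j ^ 2 ≤ ∑ j, cw n m j ^ 2 :=
    Finset.sum_le_univ_sum_of_nonneg fun _ => sq_nonneg _
  rw [sum_cw_sq hn] at h2
  rw [wtBound]; linarith

lemma wtBound_firstFold_compl_le (hn : 0 < n) :
    wtBound (cw n m) (firstFold n m)ᶜ ≤ 2 * kap n m := by
  have h1 := sum_firstFold_cw_sq_le (m := m) hn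
  have h2 : ∑ j ∈ (firstFold n m)ᶜ, cw n m j ^ 2 ≤ ∑ j, cw n m j ^ 2 :=
    Finset.sum_le_univ_sum_of_nonneg fun _ => sq_nonneg _
  rw [sum_cw_sq hn] at h2
  have h3 := Finset.sum_add_sum_compl (firstFold n m) (cw n m)
  rw [sum_cw hn] at h3
  have h4 : ∑ j ∈ (firstFold n m)ᶜ, cw n m j = -∑ j ∈ firstFold n m, cw n m j := by linarith
  rw [wtBound, h4, neg_sq]; linarith

lemma n_mul_kap_le_one (hn : 0 < n) : n * kap n m ≤ 1 := by
  have hn : (0 : ℝ) < n := by exact_mod_cast hn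
  have hm : (0 : ℝ) ≤ m := Nat.cast_nonneg m
  rw [kap, mul_div_assoc', div_le_one (by positivity)]
  nlinarith

/-- The left side is `m / (n + m)`. This is the source of the factor `min {m, n}` in `Δ_Stability`.
-/
lemma n_mul_kap_le (hn : 0 < n) : n * kap n m ≤ ((min m n : ℕ) : ℝ) / n := by
  have hn' : (0 : ℝ) < n := by exact_mod_cast hn
  have hm : (0 : ℝ) ≤ m := Nat.cast_nonneg m
  rcases le_total m n with h | h
  · rw [min_eq_left h, kap, mul_div_assoc', div_le_div_iff₀ (by positivity) hn']
    nlinarith [mul_nonneg hm (mul_nonneg hn'.le hm)]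
  · rw [min_eq_right h, div_self hn'.ne']
    exact n_mul_kap_le_one hn

end weights

/-! ### The decomposition of the statistic -/

section decomposition

variable {𝒳 : Type u} {𝒴 : Type v} [MeasurableSpace 𝒳] [MeasurableSpace 𝒴] {r n m : ℕ}

/-- The responses of the labeled observations. -/
def labelsY (D : Fin n ⊕ Fin m → 𝒳 × 𝒴) : Fin n → 𝒴 := fun i => (D (Sum.inl i)).2

/-- The labeled observations. -/
def labeled (D : Fin n ⊕ Fin m → 𝒳 × 𝒴) : Fin n → 𝒳 × 𝒴 := fun i => D (Sum.inl i)

/-- The estimation error of a trained function. -/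
def fitErr (f : 𝒳 → ℝ) (fhat : (Fin n → 𝒳 × 𝒴) → 𝒳 → ℝ) (D : Fin n ⊕ Fin m → 𝒳 × 𝒴)
    (z : 𝒳 × 𝒴) : ℝ := fhat (labeled D) z.1 - f z.1

/-- The linear part of the statistic, up to a factor. -/
def linPart [NeZero r] (P : Measure (𝒳 × 𝒴)) (ℓ : (Fin r → 𝒴) → ℝ) (f : 𝒳 → ℝ) (n m : ℕ)
    (i : Fin n ⊕ Fin m) (z : 𝒳 × 𝒴) : ℝ :=
  bw n m i * (ell1 P ℓ z.2 - psi P ℓ) - cw n m i * (f z.1 - ∫ x, f x ∂P.fst)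

lemma UCross_sub_eq [NeZero r] (P : Measure (𝒳 × 𝒴)) (ℓ : (Fin r → 𝒴) → ℝ) (f : 𝒳 → ℝ)
    (fhat1 : (Fold1 n → 𝒳 × 𝒴) → 𝒳 → ℝ) (fhat2 : (Fold2 n → 𝒳 × 𝒴) → 𝒳 → ℝ) (hrn : r < n)
    (D : Fin n ⊕ Fin m → 𝒳 × 𝒴) :
    UCross ℓ fhat1 fhat2 (labeled D) (fun j => (D (Sum.inr j)).1) - psi P ℓ =
      r * ∑ i, linPart P ℓ f n m i (D i) + uRem P.snd ℓ (labelsY D)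
        - r * (wtSum (cw n m) (firstFold n m) (fitErr f fun D => fhat2 (half2 D)) D
          + wtSum (cw n m) (firstFold n m)ᶜ (fitErr f fun D => fhat1 (half1 D)) D) := by
  have hn0 : 0 < n := (Nat.zero_le r).trans_lt hrn
  have hn : (0 : ℝ) < n := by exact_mod_cast hn0
  have hm : (0 : ℝ) ≤ m := Nat.cast_nonneg m
  have hU := UStat_eq (Q := P.snd) (ℓ := ℓ) hrn (labelsY D)
  have hk : kmean P.snd ℓ = psi P ℓ := rfl
  have hp : proj1 P.snd ℓ = ell1 P ℓ := rfl
  rw [hk, hp] at hU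
  set g₁ := fhat1 (half1 (labeled D))
  set g₂ := fhat2 (half2 (labeled D))
  have hsum : wtSum (cw n m) (firstFold n m) (fitErr f fun D => fhat2 (half2 D)) D
          + wtSum (cw n m) (firstFold n m)ᶜ (fitErr f fun D => fhat1 (half1 D)) D
      = (m : ℝ) / (n * (n + m)) * ∑ i, (crossFit g₁ g₂ (fun i => (labeled D i).1) i - f (D (Sum.inl i)).1)
        - 1 / ((n : ℝ) + m) * ∑ j, (crossFit g₁ g₂ (fun j => (D (Sum.inr j)).1) j
          - f (D (Sum.inr j)).1) := by
    have e : ∀ i, (if i ∈ firstFold n m then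
          cw n m i * fitErr f (fun D => fhat2 (half2 D)) D (D i) else 0) +
        (if i ∈ (firstFold n m)ᶜ then
          cw n m i * fitErr f (fun D => fhat1 (half1 D)) D (D i) else 0)
        = cw n m i * ((if i ∈ firstFold n m then g₂ (D i).1 else g₁ (D i).1) - f (D i).1) := by
      intro i
      by_cases h : i ∈ firstFold n m
      · simp [h, fitErr, g₂]
      · simp [h, fitErr, g₁]
    have h1 : ∀ (S : Finset (Fin n ⊕ Fin m)) (F : Fin n ⊕ Fin m → ℝ),
        ∑ i ∈ S, F i = ∑ i, if i ∈ S then F i else 0 := fun S F => by simp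
    rw [wtSum, wtSum, h1, h1 (firstFold n m)ᶜ, ← Finset.sum_add_distrib,
      Finset.sum_congr rfl fun i _ => e i, Fintype.sum_sum_type]
    simp only [mem_firstFold_inl, mem_firstFold_inr, cw, Sum.elim_inl, Sum.elim_inr,
      ← Finset.mul_sum, crossFit, labeled]
    ring
  have hlin : ∑ i, linPart P ℓ f n m i (D i)
      = 1 / n * ∑ i, (ell1 P ℓ (labelsY D i) - psi P ℓ)
        - (m : ℝ) / (n * (n + m)) * ∑ i, f (D (Sum.inl i)).1
        + 1 / ((n : ℝ) + m) * ∑ j, f (D (Sum.inr j)).1 := by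
    have h0 : ∑ i, cw n m i * (∫ x, f x ∂P.fst) = 0 := by rw [← Finset.sum_mul, sum_cw hn0, zero_mul]
    have e : ∀ i, linPart P ℓ f n m i (D i) = bw n m i * (ell1 P ℓ (D i).2 - psi P ℓ)
        - cw n m i * f (D i).1 + cw n m i * ∫ x, f x ∂P.fst := fun i => by
      rw [linPart]; ring
    rw [Finset.sum_congr rfl fun i _ => e i, Finset.sum_add_distrib, h0, add_zero,
      Finset.sum_sub_distrib, Fintype.sum_sum_type, Fintype.sum_sum_type]
    simp only [bw, cw, Sum.elim_inl, Sum.elim_inr, ← Finset.mul_sum, labelsY]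
    simp
    ring
  rw [hsum, hlin, UCross]
  simp only [Finset.sum_sub_distrib] at hU ⊢
  have hU' : UStat ℓ (fun i => (labeled D i).2) = UStat ℓ (labelsY D) := rfl
  simp only [hU']
  have h2 : UStat ℓ (labelsY D) = psi P ℓ + (r / n * (∑ a, ell1 P ℓ (labelsY D a)
      - ∑ a : Fin n, psi P ℓ) + uRem P.snd ℓ (labelsY D)) := by linarith
  rw [h2]
  simp only [labeled]
  field_simp
  ring

/-- The sample can be realized on the product space over all observations. -/
lemma IsSample.measure_eq {Ω : Type w} [MeasurableSpace Ω] {μ : Measure Ω} [IsProbabilityMeasure μ]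
    {P : Measure (𝒳 × 𝒴)} [IsProbabilityMeasure P] {Z : Fin n → Ω → 𝒳 × 𝒴} {X' : Fin m → Ω → 𝒳}
    (h : IsSample μ P Z X') {S : Set ((Fin n → 𝒳 × 𝒴) × (Fin m → 𝒳))} (hS : MeasurableSet S) :
    μ.real {ω | ((fun i => Z i ω), fun j => X' j ω) ∈ S} =
      (Measure.pi fun _ : Fin n ⊕ Fin m => P).real
        {D | (labeled D, fun j => (D (Sum.inr j)).1) ∈ S} := by
  have hZ : AEMeasurable (fun ω i => Z i ω) μ :=
    aemeasurable_pi_lambda _ fun i => (h.law_labeled i).aemeasurable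
  have hX : AEMeasurable (fun ω j => X' j ω) μ :=
    aemeasurable_pi_lambda _ fun i => (h.law_unlabeled i).aemeasurable
  have e1 : μ.map (fun ω i => Z i ω) = Measure.pi fun _ : Fin n => P := by
    rw [(iIndepFun_iff_map_fun_eq_pi_map fun i => (h.law_labeled i).aemeasurable).1
      h.indep_labeled]
    congr 1; ext1 i; exact (h.law_labeled i).map_eq
  have e2 : μ.map (fun ω j => X' j ω) = Measure.pi fun _ : Fin m => P.fst := by
    rw [(iIndepFun_iff_map_fun_eq_pi_map fun i => (h.law_unlabeled i).aemeasurable).1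
      h.indep_unlabeled]
    congr 1; ext1 i; exact (h.law_unlabeled i).map_eq
  have e3 := (indepFun_iff_map_prod_eq_prod_map_map hZ hX).1 h.indep
  rw [e1, e2] at e3
  have hfst : MeasurePreserving (Prod.fst : 𝒳 × 𝒴 → 𝒳) P P.fst := ⟨measurable_fst, rfl⟩
  have m1 := measurePreserving_sumPiEquivProdPi (fun _ : Fin n ⊕ Fin m => P)
  -- Unlabeled covariates are realized as first components of full observations, so that all
  -- coordinates have the same law `P`.
  have m2 : MeasurePreserving (fun (a : Fin m → 𝒳 × 𝒴) i => (a i).1) (Measure.pi fun _ => P)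
    (Measure.pi fun _ => P.fst) := measurePreserving_pi _ _ fun _ => hfst
  have m3 := ((MeasurePreserving.id (Measure.pi fun _ : Fin n => P)).prod m2).comp m1
  have hS1 : μ.real {ω | ((fun i => Z i ω), fun j => X' j ω) ∈ S}
      = (μ.map fun ω => ((fun i => Z i ω), fun j => X' j ω)).real S := by
    rw [measureReal_def, measureReal_def, Measure.map_apply_of_aemeasurable (hZ.prodMk hX) hS]
    rfl
  rw [hS1, e3, ← m3.map_eq, map_measureReal_apply m3.measurable hS]
  rfl

end decomposition

/-! ### The variance of the linear part -/

section variance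

variable {𝒳 : Type u} {𝒴 : Type v} [MeasurableSpace 𝒳] [MeasurableSpace 𝒴]
  {P : Measure (𝒳 × 𝒴)} [IsProbabilityMeasure P]

lemma integral_condExp_mul {g φ : 𝒳 × 𝒴 → ℝ} (hg : MemLp g 2 P) (hφ : MemLp φ 2 P)
    (hφm : StronglyMeasurable[sigmaX 𝒳 𝒴] φ) :
    ∫ z, (P[g | sigmaX 𝒳 𝒴]) z * φ z ∂P = ∫ z, g z * φ z ∂P := by
  have hle : sigmaX 𝒳 𝒴 ≤ (inferInstance : MeasurableSpace (𝒳 × 𝒴)) := measurable_fst.comap_le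
  have h := condExp_mul_of_stronglyMeasurable_right (μ := P) hφm (hg.integrable_mul hφ)
    (hg.integrable one_le_two)
  have h2 := integral_condExp (μ := P) (f := g * φ) hle
  rw [integral_congr_ae h] at h2
  exact h2

/-- The conditional expectation `c` is the best predictor: the two sides differ by `E (c - φ)²`. -/
lemma integral_condVar_le {g φ : 𝒳 × 𝒴 → ℝ} (hg : MemLp g 2 P) (hφ : MemLp φ 2 P)
    (hφm : StronglyMeasurable[sigmaX 𝒳 𝒴] φ) :
    ∫ z, (Var[g; P | sigmaX 𝒳 𝒴]) z ∂P ≤ ∫ z, (g z - φ z) ^ 2 ∂P := by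
  have hle : sigmaX 𝒳 𝒴 ≤ (inferInstance : MeasurableSpace (𝒳 × 𝒴)) := measurable_fst.comap_le
  set c := P[g | sigmaX 𝒳 𝒴] with hc
  have hc2 : MemLp c 2 P := hg.condExp one_le_two
  have h1 := condVar_ae_eq_condExp_sq_sub_sq_condExp hle hg
  have h2 : ∫ z, (Var[g; P | sigmaX 𝒳 𝒴]) z ∂P = ∫ z, g z ^ 2 ∂P - ∫ z, c z ^ 2 ∂P := by
    rw [integral_congr_ae h1]
    have := integral_sub (μ := P) (integrable_condExp (m := sigmaX 𝒳 𝒴) (f := g ^ 2))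
      hc2.integrable_sq
    refine this.trans ?_
    rw [integral_condExp hle]; rfl
  have hx := integral_condExp_mul hg hφ hφm
  have i1 := integrable_mul_of_memLp_two hg hφ
  have i2 := integrable_mul_of_memLp_two hc2 hφ
  have expand : ∀ {a : 𝒳 × 𝒴 → ℝ}, MemLp a 2 P → ∫ z, (a z - φ z) ^ 2 ∂P
      = ∫ z, a z ^ 2 ∂P - 2 * ∫ z, a z * φ z ∂P + ∫ z, φ z ^ 2 ∂P := by
    intro a ha
    have ia := integrable_mul_of_memLp_two ha hφ
    have e : ∀ z, (a z - φ z) ^ 2 = (a z ^ 2 - 2 * (a z * φ z)) + φ z ^ 2 := fun z => by ring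
    simp only [e]
    have e1 := integral_add (ha.integrable_sq.sub (ia.const_mul 2)) hφ.integrable_sq
    have e2 := integral_sub ha.integrable_sq (ia.const_mul 2)
    simp only [Pi.sub_apply] at e1
    rw [e1, e2, integral_const_mul]
  have h3 : 0 ≤ ∫ z, (c z - φ z) ^ 2 ∂P := integral_nonneg fun z => sq_nonneg _
  rw [expand hc2] at h3
  rw [expand hg, h2]
  rw [← hc] at hx
  linarith

end variance

/-! ### Moments of the linear part -/

section linear

variable {𝒳 : Type u} {𝒴 : Type v} [MeasurableSpace 𝒳] [MeasurableSpace 𝒴]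
  {P : Measure (𝒳 × 𝒴)} {r : ℕ} [NeZero r] {ℓ : (Fin r → 𝒴) → ℝ} {f : 𝒳 → ℝ}

/-- The centered projection of the kernel, as a function of an observation. -/
def cEll (P : Measure (𝒳 × 𝒴)) (ℓ : (Fin r → 𝒴) → ℝ) (z : 𝒳 × 𝒴) : ℝ := ell1 P ℓ z.2 - psi P ℓ

/-- The centered regression function, as a function of an observation. -/
def cF (P : Measure (𝒳 × 𝒴)) (f : 𝒳 → ℝ) (z : 𝒳 × 𝒴) : ℝ := f z.1 - ∫ x, f x ∂P.fst

/-- The variance of the projection. -/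
def vEll (P : Measure (𝒳 × 𝒴)) (ℓ : (Fin r → 𝒴) → ℝ) : ℝ := ∫ z, cEll P ℓ z ^ 2 ∂P

/-- The variance of the regression function. -/
def vF (P : Measure (𝒳 × 𝒴)) (f : 𝒳 → ℝ) : ℝ := ∫ z, cF P f z ^ 2 ∂P

/-- The covariance of the projection and the regression function. -/
def vEF (P : Measure (𝒳 × 𝒴)) (ℓ : (Fin r → 𝒴) → ℝ) (f : 𝒳 → ℝ) : ℝ :=
  ∫ z, cEll P ℓ z * cF P f z ∂P

lemma vEll_nonneg : 0 ≤ vEll P ℓ := integral_nonneg fun _ => sq_nonneg _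

lemma vF_nonneg : 0 ≤ vF P f := integral_nonneg fun _ => sq_nonneg _

lemma measurePreserving_fst' : MeasurePreserving (Prod.fst : 𝒳 × 𝒴 → 𝒳) P P.fst :=
  ⟨measurable_fst, rfl⟩

lemma measurePreserving_snd' : MeasurePreserving (Prod.snd : 𝒳 × 𝒴 → 𝒴) P P.snd :=
  ⟨measurable_snd, rfl⟩

/-- The third absolute central moment of the projection. -/
def tEll (P : Measure (𝒳 × 𝒴)) (ℓ : (Fin r → 𝒴) → ℝ) : ℝ := ∫ z, |cEll P ℓ z| ^ 3 ∂P

/-- The third absolute central moment of the regression function. -/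
def tF (P : Measure (𝒳 × 𝒴)) (f : 𝒳 → ℝ) : ℝ := ∫ z, |cF P f z| ^ 3 ∂P

lemma tEll_nonneg : 0 ≤ tEll P ℓ := integral_nonneg fun _ => by positivity

lemma tF_nonneg : 0 ≤ tF P f := integral_nonneg fun _ => by positivity

lemma measurable_cF (hf : Measurable f) : Measurable (cF P f) :=
  (hf.comp measurable_fst).sub_const _

lemma variance_f (hf : Measurable f) : Var[f; P.fst] = vF P f := by
  rw [variance_eq_integral hf.aemeasurable]
  exact (integral_comp_measurePreserving measurePreserving_fst'
    ((hf.sub_const _).pow_const 2)).symm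

lemma stronglyMeasurable_cF (hf : Measurable f) (κ c : ℝ) :
    StronglyMeasurable[sigmaX 𝒳 𝒴] (fun z => c + κ * cF P f z) := by
  have h1 : Measurable (fun x : 𝒳 => c + κ * (f x - ∫ x, f x ∂P.fst)) :=
    ((hf.sub_const _).const_mul κ).const_add _
  have h2 : Measurable[sigmaX 𝒳 𝒴] (fun z : 𝒳 × 𝒴 => c + κ * (f z.1 - ∫ x, f x ∂P.fst)) :=
    h1.comp (comap_measurable (Prod.fst : 𝒳 × 𝒴 → 𝒳))
  exact h2.stronglyMeasurable

variable {n m : ℕ}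

lemma linPart_eq (i : Fin n ⊕ Fin m) (z : 𝒳 × 𝒴) :
    linPart P ℓ f n m i z = bw n m i * cEll P ℓ z - cw n m i * cF P f z := rfl

/-- The order of magnitude of the contribution of an observation to the linear part. -/
def kw (n m : ℕ) : Fin n ⊕ Fin m → ℝ :=
  Sum.elim (fun _ => 1 / (n : ℝ)) (fun _ => 1 / ((n : ℝ) + m))

lemma kw_nonneg (i : Fin n ⊕ Fin m) : 0 ≤ kw n m i := by
  rcases i with i | i <;> simp only [kw, Sum.elim_inl, Sum.elim_inr] <;> positivity

lemma kap_le_inv (hn : 0 < n) : kap n m ≤ 1 / n := by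
  have hn' : (0 : ℝ) < n := by exact_mod_cast hn
  rw [le_div_iff₀ hn', mul_comm]
  exact n_mul_kap_le_one hn

lemma abs_cw_le (hn : 0 < n) (i : Fin n ⊕ Fin m) : |cw n m i| ≤ kw n m i := by
  rcases i with i | i
  · have : cw n m (Sum.inl i) = kap n m := rfl
    rw [this, abs_of_nonneg kap_nonneg]
    exact kap_le_inv hn
  · simp only [cw, kw, Sum.elim_inr, abs_neg]
    rw [abs_of_nonneg (by positivity)]

lemma bw_nonneg (i : Fin n ⊕ Fin m) : 0 ≤ bw n m i := by
  rcases i with i | i <;> simp only [bw, Sum.elim_inl, Sum.elim_inr]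
  · positivity
  · exact le_rfl

lemma bw_le (i : Fin n ⊕ Fin m) : bw n m i ≤ kw n m i := by
  rcases i with i | i <;> simp only [bw, kw, Sum.elim_inl, Sum.elim_inr]
  · exact le_rfl
  · positivity

lemma n_mul_sum_kw_cw_le (hn : 0 < n) : n * ∑ i, kw n m i * |cw n m i| ≤ 2 := by
  have hn' : (0 : ℝ) < n := by exact_mod_cast hn
  have hm : (0 : ℝ) ≤ m := Nat.cast_nonneg m
  rw [Fintype.sum_sum_type, mul_add]
  have h1 : (n : ℝ) * ∑ i : Fin n, kw n m (Sum.inl i) * |cw n m (Sum.inl i)| = n * kap n m := by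
    have : ∀ i : Fin n, |cw n m (Sum.inl i)| = kap n m := fun i => abs_of_nonneg kap_nonneg
    simp only [this, kw, Sum.elim_inl]
    simp only [Finset.sum_const, Finset.card_univ, Fintype.card_fin, nsmul_eq_mul]
    field_simp
  have h2 : (n : ℝ) * ∑ i : Fin m, kw n m (Sum.inr i) * |cw n m (Sum.inr i)| ≤ 1 := by
    simp only [kw, cw, Sum.elim_inr, abs_neg]
    rw [abs_of_nonneg (by positivity)]
    simp
    field_simp
    nlinarith
  rw [h1]
  linarith [n_mul_kap_le_one (m := m) hn]

/-- The weights `bw` and `cw` have sums of absolute cubes at most `1 / n²` and `2 / n²`, the latter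
uniformly in `m`. -/
lemma sum_integral_linPart_cube_le (hℓ3 : MemLp (cEll P ℓ) 3 P) (hf3 : MemLp (cF P f) 3 P) (hn : 0 < n) :
    ∑ i, ∫ z, |linPart P ℓ f n m i z| ^ 3 ∂P ≤ 8 * (tEll P ℓ + tF P f) / n ^ 2 := by
  have hn' : (0 : ℝ) < n := by exact_mod_cast hn
  have hm : (0 : ℝ) ≤ m := Nat.cast_nonneg m
  have i1 : Integrable (fun z => |cEll P ℓ z| ^ 3) P := by
    simpa using hℓ3.integrable_norm_pow (by norm_num)
  have i2 : Integrable (fun z => |cF P f z| ^ 3) P := by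
    simpa using hf3.integrable_norm_pow (by norm_num)
  have hterm : ∀ i, ∫ z, |linPart P ℓ f n m i z| ^ 3 ∂P ≤
      4 * bw n m i ^ 3 * tEll P ℓ + 4 * |cw n m i| ^ 3 * tF P f := by
    intro i
    have hb0 := bw_nonneg i
    have hL : MemLp (linPart P ℓ f n m i) 3 P := (hℓ3.const_mul _).sub (hf3.const_mul _)
    have i0 : Integrable (fun z => |linPart P ℓ f n m i z| ^ 3) P := by
      simpa using hL.integrable_norm_pow (by norm_num)
    rw [tEll, tF, ← integral_const_mul, ← integral_const_mul,
      ← integral_add (i1.const_mul _) (i2.const_mul _)]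
    refine integral_mono i0 ((i1.const_mul _).add (i2.const_mul _)) fun z => ?_
    simp only [linPart_eq]
    have h1 : |bw n m i * cEll P ℓ z - cw n m i * cF P f z| ≤
        bw n m i * |cEll P ℓ z| + |cw n m i| * |cF P f z| := by
      refine (abs_sub _ _).trans (le_of_eq ?_)
      rw [abs_mul, abs_mul, abs_of_nonneg hb0]
    refine (pow_le_pow_left₀ (abs_nonneg _) h1 3).trans ?_
    have ha : 0 ≤ bw n m i * |cEll P ℓ z| := by positivity
    have hb : 0 ≤ |cw n m i| * |cF P f z| := by positivity
    have e : 4 * bw n m i ^ 3 * |cEll P ℓ z| ^ 3 + 4 * |cw n m i| ^ 3 * |cF P f z| ^ 3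
        = 4 * (bw n m i * |cEll P ℓ z|) ^ 3 + 4 * (|cw n m i| * |cF P f z|) ^ 3 := by ring
    show _ ≤ 4 * bw n m i ^ 3 * |cEll P ℓ z| ^ 3 + 4 * |cw n m i| ^ 3 * |cF P f z| ^ 3
    rw [e]
    generalize bw n m i * |cEll P ℓ z| = A at *
    generalize |cw n m i| * |cF P f z| = B at *
    -- `4 A³ + 4 B³ - (A + B)³ = 3 (A + B) (A - B)²`.
    nlinarith [mul_nonneg (add_nonneg ha hb) (sq_nonneg (A - B))]
  refine (Finset.sum_le_sum fun i _ => hterm i).trans ?_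
  rw [Finset.sum_add_distrib, ← Finset.sum_mul, ← Finset.sum_mul, ← Finset.mul_sum,
    ← Finset.mul_sum]
  have e1 : ∑ i, bw n m i ^ 3 = 1 / n ^ 2 := by
    simp [bw]; field_simp
  have e2 : ∑ i, |cw n m i| ^ 3 ≤ 2 / n ^ 2 := by
    refine (Finset.sum_le_sum fun i _ => pow_le_pow_left₀ (abs_nonneg _) (abs_cw_le hn i) 3).trans ?_
    have h3 : (m : ℝ) * (((n : ℝ) + m)⁻¹) ^ 3 ≤ 1 / n ^ 2 := by
      rw [inv_pow, ← div_eq_mul_inv, div_le_div_iff₀ (by positivity) (by positivity)]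
      nlinarith [mul_nonneg hm (mul_nonneg hn'.le hn'.le), mul_nonneg hm (mul_nonneg hm hn'.le),
        pow_pos hn' 3, pow_nonneg hm 3]
    simp [kw] at h3 ⊢
    have h4 : (n : ℝ) * ((n : ℝ) ^ 3)⁻¹ = ((n : ℝ) ^ 2)⁻¹ := by field_simp
    rw [h4, div_eq_mul_inv]
    linarith
  rw [e1]
  have h1 := tEll_nonneg (P := P) (ℓ := ℓ)
  have h2 := mul_le_mul_of_nonneg_right e2 (tF_nonneg (P := P) (f := f))
  have h3 : (0 : ℝ) ≤ 1 / n ^ 2 := by positivity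
  have e3 : 8 * (tEll P ℓ + tF P f) / n ^ 2 = 8 * (1 / n ^ 2) * tEll P ℓ + 4 * (2 / n ^ 2 * tF P f) := by
    field_simp; ring
  rw [e3]
  nlinarith [mul_nonneg h3 h1]

variable [IsProbabilityMeasure P]

lemma measurable_ell1 (hℓ : Measurable ℓ) : Measurable (ell1 P ℓ) :=
  measurable_proj1 (Q := P.snd) hℓ

lemma measurable_cEll (hℓ : Measurable ℓ) : Measurable (cEll P ℓ) :=
  ((measurable_ell1 hℓ).comp measurable_snd).sub_const _

lemma memLp_ell1 (hℓ : Measurable ℓ) (hℓ2 : MemLp ℓ 2 (Measure.pi fun _ : Fin r => P.snd)) :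
    MemLp (fun z : 𝒳 × 𝒴 => ell1 P ℓ z.2) 2 P :=
  (memLp_proj1 (Q := P.snd) hℓ hℓ2).comp_measurePreserving measurePreserving_snd'

lemma memLp_cEll (hℓ : Measurable ℓ) (hℓ2 : MemLp ℓ 2 (Measure.pi fun _ : Fin r => P.snd)) :
    MemLp (cEll P ℓ) 2 P := (memLp_ell1 hℓ hℓ2).sub (memLp_const _)

lemma memLp_cF (hf2 : MemLp f 2 P.fst) : MemLp (cF P f) 2 P :=
  (hf2.comp_measurePreserving measurePreserving_fst').sub (memLp_const _)

lemma integral_ell1 (hℓ : Measurable ℓ) (hℓ2 : MemLp ℓ 2 (Measure.pi fun _ : Fin r => P.snd)) :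
    ∫ y, ell1 P ℓ y ∂P.snd = psi P ℓ := integral_proj1 (Q := P.snd) hℓ hℓ2

lemma integral_cEll (hℓ : Measurable ℓ) (hℓ2 : MemLp ℓ 2 (Measure.pi fun _ : Fin r => P.snd)) :
    ∫ z, cEll P ℓ z ∂P = 0 := by
  simp only [cEll]
  rw [integral_sub ((memLp_ell1 hℓ hℓ2).integrable one_le_two) (integrable_const _),
    integral_comp_measurePreserving measurePreserving_snd' (measurable_ell1 hℓ),
    integral_ell1 hℓ hℓ2]
  simp

lemma integral_cF (hf : Measurable f) (hf2 : MemLp f 2 P.fst) : ∫ z, cF P f z ∂P = 0 := by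
  have hF2 : MemLp (fun z : 𝒳 × 𝒴 => f z.1) 2 P :=
    hf2.comp_measurePreserving measurePreserving_fst'
  simp only [cF]
  rw [integral_sub (hF2.integrable one_le_two)
    (integrable_const _), integral_comp_measurePreserving measurePreserving_fst' hf]
  simp

lemma abs_vEF_le (hℓ : Measurable ℓ) (hℓ2 : MemLp ℓ 2 (Measure.pi fun _ : Fin r => P.snd))
    (hf2 : MemLp f 2 P.fst) : |vEF P ℓ f| ≤ √(vEll P ℓ) * √(vF P f) :=
  abs_integral_le_integral_abs.trans (integral_abs_mul_le (memLp_cEll hℓ hℓ2) (memLp_cF hf2))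

lemma variance_ell1 (hℓ : Measurable ℓ) (hℓ2 : MemLp ℓ 2 (Measure.pi fun _ : Fin r => P.snd)) :
    Var[ell1 P ℓ; P.snd] = vEll P ℓ := by
  rw [variance_eq_integral (measurable_ell1 hℓ).aemeasurable, integral_ell1 hℓ hℓ2]
  exact (integral_comp_measurePreserving measurePreserving_snd'
    (((measurable_ell1 hℓ).sub_const _).pow_const 2)).symm

/-- As `f(X)` is a function of `X`, the conditional expectation `ψ₁(X)` can be replaced by `ℓ₁(Y)`
in the covariance. -/
lemma covariance_psi1 (hℓ : Measurable ℓ)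
    (hℓ2 : MemLp ℓ 2 (Measure.pi fun _ : Fin r => P.snd)) (hf : Measurable f)
    (hf2 : MemLp f 2 P.fst) : cov[fun z => f z.1, psi1 P ℓ; P] = vEF P ℓ f := by
  have hle : sigmaX 𝒳 𝒴 ≤ (inferInstance : MeasurableSpace (𝒳 × 𝒴)) := measurable_fst.comap_le
  have hF2 : MemLp (fun z : 𝒳 × 𝒴 => f z.1) 2 P :=
    hf2.comp_measurePreserving measurePreserving_fst'
  have hE2 := memLp_ell1 (P := P) hℓ hℓ2
  have hp2 : MemLp (psi1 P ℓ) 2 P := hE2.condExp one_le_two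
  have hFm : StronglyMeasurable[sigmaX 𝒳 𝒴] (fun z : 𝒳 × 𝒴 => f z.1) :=
    (hf.comp (comap_measurable (Prod.fst : 𝒳 × 𝒴 → 𝒳))).stronglyMeasurable
  have h1 := integral_condExp_mul hE2 hF2 hFm
  have h2 : ∫ z, psi1 P ℓ z ∂P = ∫ z, ell1 P ℓ z.2 ∂P := integral_condExp hle
  have h3 : ∫ z : 𝒳 × 𝒴, ell1 P ℓ z.2 ∂P = psi P ℓ := by
    rw [integral_comp_measurePreserving measurePreserving_snd' (measurable_ell1 hℓ),
      integral_ell1 hℓ hℓ2]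
  have h4 : ∫ z : 𝒳 × 𝒴, f z.1 ∂P = ∫ x, f x ∂P.fst :=
    integral_comp_measurePreserving measurePreserving_fst' hf
  have h5 : vEF P ℓ f = ∫ z, ell1 P ℓ z.2 * f z.1 ∂P - psi P ℓ * ∫ x, f x ∂P.fst := by
    have := covariance_eq_sub hE2 hF2
    rw [covariance, h3, h4] at this
    exact this
  rw [covariance_eq_sub hF2 hp2, h2, h3, h4, h5, ← h1, psi1]
  simp only [Pi.mul_apply, mul_comm]

lemma Lam_eq (hℓ : Measurable ℓ) (hℓ2 : MemLp ℓ 2 (Measure.pi fun _ : Fin r => P.snd))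
    (hf : Measurable f) (hf2 : MemLp f 2 P.fst) (hn : 0 < n) :
    Lam P ℓ f n m = r ^ 2 * (vEll P ℓ + n * kap n m * (vF P f - 2 * vEF P ℓ f)) := by
  have hn : (0 : ℝ) < n := by exact_mod_cast hn
  rw [Lam, variance_ell1 hℓ hℓ2, variance_f hf, covariance_psi1 hℓ hℓ2 hf hf2, kap]
  field_simp

lemma sigma1Sq_le {φ : 𝒳 × 𝒴 → ℝ} (hφ2 : MemLp φ 2 P)
    (hφm : StronglyMeasurable[sigmaX 𝒳 𝒴] φ) (hℓ : Measurable ℓ)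
    (hℓ2 : MemLp ℓ 2 (Measure.pi fun _ : Fin r => P.snd)) :
    sigma1Sq P ℓ ≤ ∫ z, (ell1 P ℓ z.2 - φ z) ^ 2 ∂P :=
  integral_condVar_le (memLp_ell1 (P := P) hℓ hℓ2) hφ2 hφm

/-- With `κ = m / (n + m)` in `[0, 1]`, the bracket `Var ℓ₁ + κ Var f - 2 κ Cov` is at least the
same expression with `κ² Var f`. The latter is the mean squared error of predicting `ℓ₁(Y)` by `ψ +
κ (f(X) - E f(X))`, which `sigma1Sq_le` bounds below. -/
lemma sigma1Sq_mul_le_Lam (hℓ : Measurable ℓ)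
    (hℓ2 : MemLp ℓ 2 (Measure.pi fun _ : Fin r => P.snd))
    (hf : Measurable f) (hf2 : MemLp f 2 P.fst) (hn : 0 < n) :
    r ^ 2 * sigma1Sq P ℓ ≤ Lam P ℓ f n m := by
  rw [Lam_eq hℓ hℓ2 hf hf2 hn]
  refine mul_le_mul_of_nonneg_left ?_ (sq_nonneg _)
  set κ := n * kap n m with hκ
  have hκ0 : 0 ≤ κ := mul_nonneg (Nat.cast_nonneg _) kap_nonneg
  have hκ1 : κ ≤ 1 := n_mul_kap_le_one hn
  have hcE := memLp_cEll (P := P) hℓ hℓ2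
  have hcF := memLp_cF (P := P) hf2
  have hφ2 : MemLp (fun z => psi P ℓ + κ * cF P f z) 2 P :=
    (memLp_const (psi P ℓ)).add (hcF.const_mul κ)
  have h := sigma1Sq_le hφ2 (stronglyMeasurable_cF hf κ (psi P ℓ)) hℓ hℓ2
  refine h.trans ?_
  have e : ∀ z, (ell1 P ℓ z.2 - (psi P ℓ + κ * cF P f z)) ^ 2
      = cEll P ℓ z ^ 2 + (-(2 * κ) * (cEll P ℓ z * cF P f z) + κ ^ 2 * cF P f z ^ 2) := fun z => by
    rw [cEll]; ring
  simp only [e]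
  have i1 := hcE.integrable_sq
  have i2 := (integrable_mul_of_memLp_two hcE hcF).const_mul (-(2 * κ))
  have i3 := hcF.integrable_sq.const_mul (κ ^ 2)
  have e1 := integral_add i1 (i2.add i3)
  simp only [Pi.add_apply] at e1
  rw [e1, integral_add i2 i3, integral_const_mul, integral_const_mul]
  have hv : 0 ≤ vF P f := vF_nonneg
  show vEll P ℓ + (-(2 * κ) * vEF P ℓ f + κ ^ 2 * vF P f) ≤ _
  linarith [mul_nonneg (mul_nonneg hκ0 (sub_nonneg.2 hκ1)) hv]

lemma measurable_linPart (hℓ : Measurable ℓ) (hf : Measurable f) (i : Fin n ⊕ Fin m) :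
    Measurable (linPart P ℓ f n m i) :=
  ((measurable_cEll hℓ).const_mul _).sub ((measurable_cF hf).const_mul _)

lemma integral_linPart (hℓ : Measurable ℓ)
    (hℓ2 : MemLp ℓ 2 (Measure.pi fun _ : Fin r => P.snd))
    (hf : Measurable f) (hf2 : MemLp f 2 P.fst) (i : Fin n ⊕ Fin m) :
    ∫ z, linPart P ℓ f n m i z ∂P = 0 := by
  simp only [linPart_eq]
  rw [integral_sub (((memLp_cEll hℓ hℓ2).integrable one_le_two).const_mul _)
    (((memLp_cF hf2).integrable one_le_two).const_mul _), integral_const_mul, integral_const_mul,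
    integral_cEll hℓ hℓ2, integral_cF hf hf2]
  simp

lemma integral_linPart_sq (hℓ : Measurable ℓ)
    (hℓ2 : MemLp ℓ 2 (Measure.pi fun _ : Fin r => P.snd)) (hf2 : MemLp f 2 P.fst)
    (i : Fin n ⊕ Fin m) :
    ∫ z, linPart P ℓ f n m i z ^ 2 ∂P = bw n m i ^ 2 * vEll P ℓ
      - 2 * (bw n m i * cw n m i) * vEF P ℓ f + cw n m i ^ 2 * vF P f := by
  have hcE := memLp_cEll (P := P) hℓ hℓ2
  have hcF := memLp_cF (P := P) hf2
  have e : ∀ z, linPart P ℓ f n m i z ^ 2 = bw n m i ^ 2 * cEll P ℓ z ^ 2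
      + (-(2 * (bw n m i * cw n m i)) * (cEll P ℓ z * cF P f z)
        + cw n m i ^ 2 * cF P f z ^ 2) := fun z => by
    rw [linPart_eq]; ring
  simp only [e]
  have i1 := hcE.integrable_sq.const_mul (bw n m i ^ 2)
  have i2 := (integrable_mul_of_memLp_two hcE hcF).const_mul (-(2 * (bw n m i * cw n m i)))
  have i3 := hcF.integrable_sq.const_mul (cw n m i ^ 2)
  have e1 := integral_add i1 (i2.add i3)
  simp only [Pi.add_apply] at e1
  rw [e1, integral_add i2 i3, integral_const_mul, integral_const_mul,
    integral_const_mul]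
  rw [vEll, vEF, vF]; ring

/-- The sums of `bw²`, `bw * cw` and `cw²` are `1 / n`, `kap` and `kap`. The standardized linear
part therefore has variance exactly `1`, as Stein's method requires. -/
lemma sum_integral_linPart_sq (hℓ : Measurable ℓ)
    (hℓ2 : MemLp ℓ 2 (Measure.pi fun _ : Fin r => P.snd))
    (hf : Measurable f) (hf2 : MemLp f 2 P.fst) (hn : 0 < n) :
    r ^ 2 * n * ∑ i, ∫ z, linPart P ℓ f n m i z ^ 2 ∂P = Lam P ℓ f n m := by
  have hn' : (0 : ℝ) < n := by exact_mod_cast hn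
  simp only [integral_linPart_sq hℓ hℓ2 hf2]
  rw [Finset.sum_add_distrib, Finset.sum_sub_distrib, ← Finset.sum_mul, ← Finset.sum_mul,
    ← Finset.sum_mul, ← Finset.mul_sum, sum_cw_sq hn, Lam_eq hℓ hℓ2 hf hf2 hn]
  have e1 : ∑ i, bw n m i ^ 2 = 1 / n := by
    simp [bw]; field_simp
  have e2 : ∑ i, bw n m i * cw n m i = kap n m := by
    simp [bw, cw, kap]; field_simp
  rw [e1, e2]
  field_simp
  ring

lemma sqrt_integral_linPart_sq_le (hℓ : Measurable ℓ)
    (hℓ2 : MemLp ℓ 2 (Measure.pi fun _ : Fin r => P.snd)) (hf2 : MemLp f 2 P.fst) (hn : 0 < n)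
    (i : Fin n ⊕ Fin m) :
    √(∫ z, linPart P ℓ f n m i z ^ 2 ∂P) ≤ kw n m i * (√(vEll P ℓ) + √(vF P f)) := by
  have hk := kw_nonneg i
  refine Real.sqrt_le_iff.2 ⟨by positivity, ?_⟩
  rw [integral_linPart_sq hℓ hℓ2 hf2]
  have hq := abs_vEF_le (P := P) hℓ hℓ2 hf2
  have hx := Real.sq_sqrt (vEll_nonneg (P := P) (ℓ := ℓ))
  have hy := Real.sq_sqrt (vF_nonneg (P := P) (f := f))
  have hx0 := Real.sqrt_nonneg (vEll P ℓ)
  have hy0 := Real.sqrt_nonneg (vF P f)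
  have hb := bw_le i
  have hb0 := bw_nonneg i
  have hc := abs_cw_le hn i
  set x := √(vEll P ℓ)
  set y := √(vF P f)
  have h1 : -(2 * (bw n m i * cw n m i) * vEF P ℓ f) ≤ 2 * (bw n m i * |cw n m i|) * (x * y) := by
    refine (neg_le_abs _).trans ?_
    rw [abs_mul, abs_mul, abs_mul, abs_of_nonneg hb0]
    norm_num
    gcongr
  have h2 : bw n m i * x + |cw n m i| * y ≤ kw n m i * (x + y) := by
    rw [mul_add]; gcongr
  have h3 := pow_le_pow_left₀ (by positivity) h2 2
  rw [← sq_abs (cw n m i)]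
  refine le_trans (le_of_le_of_eq ?_ rfl) h3
  nlinarith

end linear

/-! ### The remainder due to the trained functions -/

section fit

variable {𝒳 : Type u} {𝒴 : Type v} {f : 𝒳 → ℝ} {n m : ℕ} {fhat : (Fin n → 𝒳 × 𝒴) → 𝒳 → ℝ}
  {fhat1 : (Fold1 n → 𝒳 × 𝒴) → 𝒳 → ℝ} {fhat2 : (Fold2 n → 𝒳 × 𝒴) → 𝒳 → ℝ}

/-- The point of cross-fitting: a function is never evaluated at an observation it was trained on.
-/
lemma dependsOff_fitErr_half2 : DependsOff (firstFold n m) (fitErr f fun D => fhat2 (half2 D)) := by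
  intro D D' h
  have : (half2 (labeled D) : Fold2 n → 𝒳 × 𝒴) = half2 (labeled D') :=
    funext fun i => h _ fun hi => i.2 (mem_firstFold_inl.1 hi)
  funext z
  simp only [fitErr, this]

lemma dependsOff_fitErr_half1 :
    DependsOff (firstFold n m)ᶜ (fitErr f fun D => fhat1 (half1 D)) := by
  intro D D' h
  have : (half1 (labeled D) : Fold1 n → 𝒳 × 𝒴) = half1 (labeled D') :=
    funext fun i => h _ fun hi => Finset.mem_compl.1 hi (mem_firstFold_inl.2 i.2)
  funext z
  simp only [fitErr, this]

lemma labeled_update_inl (D : Fin n ⊕ Fin m → 𝒳 × 𝒴) (i : Fin n) (z : 𝒳 × 𝒴) :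
    labeled (Function.update D (Sum.inl i) z) = Function.update (labeled D) i z := by
  funext j
  by_cases h : j = i
  · subst h; simp [labeled]
  · simp [labeled, h]

lemma labeled_update_inr (D : Fin n ⊕ Fin m → 𝒳 × 𝒴) (i : Fin m) (z : 𝒳 × 𝒴) :
    labeled (Function.update D (Sum.inr i) z) = labeled D := by
  funext j
  simp [labeled]

lemma labelsY_update_inl (D : Fin n ⊕ Fin m → 𝒳 × 𝒴) (i : Fin n) (z : 𝒳 × 𝒴) :
    labelsY (Function.update D (Sum.inl i) z) = Function.update (labelsY D) i z.2 := by
  funext j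
  by_cases h : j = i
  · subst h; simp [labelsY]
  · simp [labelsY, h]

lemma labelsY_update_inr (D : Fin n ⊕ Fin m → 𝒳 × 𝒴) (i : Fin m) (z : 𝒳 × 𝒴) :
    labelsY (Function.update D (Sum.inr i) z) = labelsY D := by
  funext j
  simp [labelsY]

/-- The part of the statistic that is due to the trained functions. -/
def fitRem (f : 𝒳 → ℝ) (fhat1 : (Fold1 n → 𝒳 × 𝒴) → 𝒳 → ℝ) (fhat2 : (Fold2 n → 𝒳 × 𝒴) → 𝒳 → ℝ)
    (D : Fin n ⊕ Fin m → 𝒳 × 𝒴) : ℝ :=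
  wtSum (cw n m) (firstFold n m) (fitErr f fun D => fhat2 (half2 D)) D
    + wtSum (cw n m) (firstFold n m)ᶜ (fitErr f fun D => fhat1 (half1 D)) D

variable [MeasurableSpace 𝒳] [MeasurableSpace 𝒴] {P : Measure (𝒳 × 𝒴)}

/-- The mean squared prediction error of a trained function. -/
def fitMse (P : Measure (𝒳 × 𝒴)) (f : 𝒳 → ℝ) (fhat : (Fin n → 𝒳 × 𝒴) → 𝒳 → ℝ) : ℝ≥0∞ :=
  ∫⁻ D, ∫⁻ x, ‖fhat D x - f x‖ₑ ^ 2 ∂P.fst ∂(Measure.pi fun _ : Fin n => P)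

lemma mspe_eq : mspe P f fhat1 fhat2 =
    fitMse P f (fun D => fhat1 (half1 D)) + fitMse P f (fun D => fhat2 (half2 D)) := rfl

lemma measurable_half1 (h : Measurable (Function.uncurry fhat1)) :
    Measurable (Function.uncurry fun D : Fin n → 𝒳 × 𝒴 => fhat1 (half1 D)) := by
  have : Measurable fun q : (Fin n → 𝒳 × 𝒴) × 𝒳 => ((half1 q.1 : Fold1 n → 𝒳 × 𝒴), q.2) :=
    (measurable_pi_lambda _ fun i => (measurable_pi_apply _).comp measurable_fst).prodMk
      measurable_snd
  exact h.comp this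

lemma measurable_half2 (h : Measurable (Function.uncurry fhat2)) :
    Measurable (Function.uncurry fun D : Fin n → 𝒳 × 𝒴 => fhat2 (half2 D)) := by
  have : Measurable fun q : (Fin n → 𝒳 × 𝒴) × 𝒳 => ((half2 q.1 : Fold2 n → 𝒳 × 𝒴), q.2) :=
    (measurable_pi_lambda _ fun i => (measurable_pi_apply _).comp measurable_fst).prodMk
      measurable_snd
  exact h.comp this

lemma measurable_labeled : Measurable (labeled : (Fin n ⊕ Fin m → 𝒳 × 𝒴) → Fin n → 𝒳 × 𝒴) :=
  measurable_pi_lambda _ fun i => measurable_pi_apply (Sum.inl i)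

lemma measurable_labelsY : Measurable (labelsY : (Fin n ⊕ Fin m → 𝒳 × 𝒴) → Fin n → 𝒴) :=
  measurable_pi_lambda _ fun i => measurable_snd.comp (measurable_pi_apply (Sum.inl i))

lemma measurable_fitErr (hf : Measurable f) (hm : Measurable (Function.uncurry fhat)) :
    Measurable (Function.uncurry (fitErr f fhat : (Fin n ⊕ Fin m → 𝒳 × 𝒴) → 𝒳 × 𝒴 → ℝ)) := by
  have h1 : Measurable fun q : (Fin n ⊕ Fin m → 𝒳 × 𝒴) × 𝒳 × 𝒴 => (labeled q.1, q.2.1) :=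
    (measurable_labeled.comp measurable_fst).prodMk (measurable_fst.comp measurable_snd)
  exact (hm.comp h1).sub (hf.comp (measurable_fst.comp measurable_snd))

lemma lintegral_fst {g : 𝒳 → ℝ≥0∞} (hg : Measurable g) :
    ∫⁻ z, g z.1 ∂P = ∫⁻ x, g x ∂P.fst :=
  measurePreserving_fst'.lintegral_comp hg

lemma measurable_fitRem (hf : Measurable f) (h1 : Measurable (Function.uncurry fhat1))
    (h2 : Measurable (Function.uncurry fhat2)) :
    Measurable (fitRem f fhat1 fhat2 : (Fin n ⊕ Fin m → 𝒳 × 𝒴) → ℝ) :=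
  (measurable_wtSum _ _ (measurable_fitErr hf (measurable_half2 h2))).add
    (measurable_wtSum _ _ (measurable_fitErr hf (measurable_half1 h1)))

variable [IsProbabilityMeasure P]

lemma measurePreserving_labeled :
    MeasurePreserving (labeled : (Fin n ⊕ Fin m → 𝒳 × 𝒴) → Fin n → 𝒳 × 𝒴)
      (Measure.pi fun _ => P) (Measure.pi fun _ => P) :=
  measurePreserving_comp_injective P Sum.inl_injective

lemma measurePreserving_labelsY :
    MeasurePreserving (labelsY : (Fin n ⊕ Fin m → 𝒳 × 𝒴) → Fin n → 𝒴)
      (Measure.pi fun _ => P) (Measure.pi fun _ => P.snd) :=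
  (measurePreserving_pi (fun _ : Fin n => P) (fun _ => P.snd)
    fun _ => measurePreserving_snd').comp measurePreserving_labeled

lemma lintegral_fitErr (hf : Measurable f) (hm : Measurable (Function.uncurry fhat)) :
    ∫⁻ D, ∫⁻ z, ‖fitErr f fhat D z‖ₑ ^ 2 ∂P ∂(Measure.pi fun _ : Fin n ⊕ Fin m => P) =
      fitMse P f fhat := by
  have h1 : Measurable fun q : (Fin n → 𝒳 × 𝒴) × 𝒳 => ‖fhat q.1 q.2 - f q.2‖ₑ ^ 2 :=
    ((hm.sub (hf.comp measurable_snd)).enorm.pow_const 2)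
  have h2 : ∀ D : Fin n ⊕ Fin m → 𝒳 × 𝒴, ∫⁻ z, ‖fitErr f fhat D z‖ₑ ^ 2 ∂P =
      ∫⁻ x, ‖fhat (labeled D) x - f x‖ₑ ^ 2 ∂P.fst := fun D =>
    lintegral_fst (P := P) (h1.comp measurable_prodMk_left)
  simp only [h2]
  exact measurePreserving_labeled.lintegral_comp h1.lintegral_prod_right'

lemma lintegral_fitErr_update_inl (hm : Measurable (Function.uncurry fhat)) (i : Fin n) :
    ∫⁻ D, ∫⁻ z, ∫⁻ x, ‖fitErr f fhat D x - fitErr f fhat (Function.update D (Sum.inl i) z) x‖ₑ ^ 2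
      ∂P ∂P ∂(Measure.pi fun _ : Fin n ⊕ Fin m => P) = looError P fhat i := by
  have hu : Measurable fun q : ((Fin n → 𝒳 × 𝒴) × 𝒳 × 𝒴) × 𝒳 =>
      (Function.update q.1.1 i q.1.2, q.2) := by
    have : Measurable fun q : (Fin n → 𝒳 × 𝒴) × 𝒳 × 𝒴 => Function.update q.1 i q.2 :=
      (measurePreserving_update P i).measurable
    exact (this.comp measurable_fst).prodMk measurable_snd
  have h1 : Measurable fun q : ((Fin n → 𝒳 × 𝒴) × 𝒳 × 𝒴) × 𝒳 =>
      ‖fhat q.1.1 q.2 - fhat (Function.update q.1.1 i q.1.2) q.2‖ₑ ^ 2 :=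
    ((hm.comp ((measurable_fst.comp measurable_fst).prodMk measurable_snd)).sub
      (hm.comp hu)).enorm.pow_const 2
  have h2 : ∀ (D : Fin n ⊕ Fin m → 𝒳 × 𝒴) (z : 𝒳 × 𝒴),
      ∫⁻ x, ‖fitErr f fhat D x - fitErr f fhat (Function.update D (Sum.inl i) z) x‖ₑ ^ 2 ∂P =
      ∫⁻ x, ‖fhat (labeled D) x - fhat (Function.update (labeled D) i z) x‖ₑ ^ 2 ∂P.fst := by
    intro D z
    simp only [fitErr, labeled_update_inl, sub_sub_sub_cancel_right]
    exact lintegral_fst (P := P) (h1.comp (measurable_prodMk_left (x := (labeled D, z))))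
  simp only [h2]
  exact measurePreserving_labeled.lintegral_comp h1.lintegral_prod_right'.lintegral_prod_right'

lemma lintegral_fitErr_update_inr (i : Fin m) :
    ∫⁻ D, ∫⁻ z, ∫⁻ x, ‖fitErr f fhat D x - fitErr f fhat (Function.update D (Sum.inr i) z) x‖ₑ ^ 2
      ∂P ∂P ∂(Measure.pi fun _ : Fin n ⊕ Fin m => P) = 0 := by
  simp [fitErr, labeled_update_inr]

/-- Triangle inequality through `f`, the retrained function having the same law. It serves to make
the stability terms finite when `Δ_MSPE` is, so that they can be treated as real numbers. -/
lemma looError_le (hf : Measurable f) (hm : Measurable (Function.uncurry fhat)) (i : Fin n) :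
    looError P fhat i ≤ 4 * fitMse P f fhat := by
  have hv : Measurable fun q : (Fin n → 𝒳 × 𝒴) × 𝒳 × 𝒴 => Function.update q.1 i q.2 :=
    (measurePreserving_update P i).measurable
  have h1 : Measurable fun q : (Fin n → 𝒳 × 𝒴) × 𝒳 => ‖fhat q.1 q.2 - f q.2‖ₑ ^ 2 :=
    ((hm.sub (hf.comp measurable_snd)).enorm.pow_const 2)
  have hg : Measurable fun D : Fin n → 𝒳 × 𝒴 => ∫⁻ x, ‖fhat D x - f x‖ₑ ^ 2 ∂P.fst :=
    h1.lintegral_prod_right'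
  have hsec : ∀ D, Measurable fun x => fhat D x - f x := fun D =>
    (hm.comp measurable_prodMk_left).sub hf
  have key : ∀ D z, ∫⁻ x, ‖fhat D x - fhat (Function.update D i z) x‖ₑ ^ 2 ∂P.fst ≤
      2 * ∫⁻ x, ‖fhat D x - f x‖ₑ ^ 2 ∂P.fst +
        2 * ∫⁻ x, ‖fhat (Function.update D i z) x - f x‖ₑ ^ 2 ∂P.fst := by
    intro D z
    have := lintegral_enorm_add_sq_le (μ := P.fst) (hsec D) (hsec (Function.update D i z)).neg
    simp only [Pi.neg_apply, enorm_neg] at this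
    refine le_trans (le_of_eq ?_) this
    refine lintegral_congr fun x => ?_
    congr 2
    ring
  calc looError P fhat i ≤ ∫⁻ D, ∫⁻ z, (2 * ∫⁻ x, ‖fhat D x - f x‖ₑ ^ 2 ∂P.fst +
        2 * ∫⁻ x, ‖fhat (Function.update D i z) x - f x‖ₑ ^ 2 ∂P.fst) ∂P
          ∂(Measure.pi fun _ : Fin n => P) := lintegral_mono fun D => lintegral_mono fun z => key D z
    _ = 2 * fitMse P f fhat + 2 * ∫⁻ D, ∫⁻ z,
        (∫⁻ x, ‖fhat (Function.update D i z) x - f x‖ₑ ^ 2 ∂P.fst) ∂P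
          ∂(Measure.pi fun _ : Fin n => P) := by
      have e : ∀ D, ∫⁻ z, (2 * ∫⁻ x, ‖fhat D x - f x‖ₑ ^ 2 ∂P.fst +
          2 * ∫⁻ x, ‖fhat (Function.update D i z) x - f x‖ₑ ^ 2 ∂P.fst) ∂P =
          2 * ∫⁻ x, ‖fhat D x - f x‖ₑ ^ 2 ∂P.fst +
          2 * ∫⁻ z, ∫⁻ x, ‖fhat (Function.update D i z) x - f x‖ₑ ^ 2 ∂P.fst ∂P := by
        intro D
        rw [lintegral_add_left measurable_const, lintegral_const, measure_univ, mul_one,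
          lintegral_const_mul]
        exact hg.comp (hv.comp measurable_prodMk_left)
      simp only [e]
      rw [lintegral_add_left (hg.const_mul 2), lintegral_const_mul _ hg, lintegral_const_mul]
      · rfl
      · exact (hg.comp hv).lintegral_prod_right'
    _ = 4 * fitMse P f fhat := by
      have : ∫⁻ D, ∫⁻ z, (∫⁻ x, ‖fhat (Function.update D i z) x - f x‖ₑ ^ 2 ∂P.fst) ∂P
          ∂(Measure.pi fun _ : Fin n => P) = fitMse P f fhat := by
        rw [← lintegral_prod (fun q : (Fin n → 𝒳 × 𝒴) × 𝒳 × 𝒴 =>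
          ∫⁻ x, ‖fhat (Function.update q.1 i q.2) x - f x‖ₑ ^ 2 ∂P.fst)
          (hg.comp hv).aemeasurable]
        exact (measurePreserving_update P i).lintegral_comp hg
      rw [this]
      ring

lemma fitRem_second_moment (hn : 0 < n) (hf : Measurable f)
    (h1 : Measurable (Function.uncurry fhat1)) (h2 : Measurable (Function.uncurry fhat2)) :
    ∫⁻ D, ‖fitRem f fhat1 fhat2 D‖ₑ ^ 2 ∂(Measure.pi fun _ : Fin n ⊕ Fin m => P) ≤
      ENNReal.ofReal (4 * kap n m) * mspe P f fhat1 fhat2 := by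
  have m1 := measurable_fitErr (m := m) hf (measurable_half1 h1)
  have m2 := measurable_fitErr (m := m) hf (measurable_half2 h2)
  have b1 := lintegral_wtSum_sq_le (P := P) (cw n m) m1 dependsOff_fitErr_half1
  have b2 := lintegral_wtSum_sq_le (P := P) (cw n m) m2 dependsOff_fitErr_half2
  rw [lintegral_fitErr hf (measurable_half1 h1)] at b1
  rw [lintegral_fitErr hf (measurable_half2 h2)] at b2
  refine (lintegral_enorm_add_sq_le (measurable_wtSum _ _ m2) (measurable_wtSum _ _ m1)).trans ?_
  have e : ENNReal.ofReal (4 * kap n m) = 2 * ENNReal.ofReal (2 * kap n m) := by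
    rw [← ENNReal.ofReal_ofNat, ← ENNReal.ofReal_mul (by norm_num)]; congr 1; ring
  rw [e, mspe_eq, mul_add, add_comm, mul_assoc, mul_assoc]
  gcongr
  · exact b1.trans (by gcongr; exact wtBound_firstFold_compl_le hn)
  · exact b2.trans (by gcongr; exact wtBound_firstFold_le hn)

/-- The contribution of an observation to the stability of the two trained functions. -/
def looSum (P : Measure (𝒳 × 𝒴)) (fhat1 : (Fold1 n → 𝒳 × 𝒴) → 𝒳 → ℝ)
    (fhat2 : (Fold2 n → 𝒳 × 𝒴) → 𝒳 → ℝ) : Fin n ⊕ Fin m → ℝ≥0∞ :=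
  Sum.elim (fun i => looError P (fun D => fhat1 (half1 D)) i +
    looError P (fun D => fhat2 (half2 D)) i) (fun _ => 0)

/-- The first term pays for moving an evaluation point, the second for retraining. Unlabeled
observations are not used for training, so `looSum` vanishes there. -/
lemma fitRem_increment (hn : 0 < n) (hf : Measurable f)
    (h1 : Measurable (Function.uncurry fhat1)) (h2 : Measurable (Function.uncurry fhat2))
    (i : Fin n ⊕ Fin m) :
    ∫⁻ p, ‖fitRem f fhat1 fhat2 p.1 - fitRem f fhat1 fhat2 (Function.update p.1 i p.2)‖ₑ ^ 2
        ∂((Measure.pi fun _ : Fin n ⊕ Fin m => P).prod P) ≤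
      ENNReal.ofReal (8 * cw n m i ^ 2) * mspe P f fhat1 fhat2 +
        ENNReal.ofReal (4 * kap n m) * looSum P fhat1 fhat2 i := by
  have m1 := measurable_fitErr (m := m) hf (measurable_half1 h1)
  have m2 := measurable_fitErr (m := m) hf (measurable_half2 h2)
  have b1 := lintegral_wtSum_increment_le (P := P) (cw n m) m1 dependsOff_fitErr_half1 i
  have b2 := lintegral_wtSum_increment_le (P := P) (cw n m) m2 dependsOff_fitErr_half2 i
  rw [lintegral_fitErr hf (measurable_half1 h1)] at b1
  rw [lintegral_fitErr hf (measurable_half2 h2)] at b2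
  have hv : Measurable fun q : (Fin n ⊕ Fin m → 𝒳 × 𝒴) × 𝒳 × 𝒴 => Function.update q.1 i q.2 :=
    (measurePreserving_update P i).measurable
  have hinc : ∀ {B : Finset (Fin n ⊕ Fin m)} {h : (Fin n ⊕ Fin m → 𝒳 × 𝒴) → 𝒳 × 𝒴 → ℝ},
      Measurable (Function.uncurry h) → Measurable fun p : (Fin n ⊕ Fin m → 𝒳 × 𝒴) × 𝒳 × 𝒴 =>
        wtSum (cw n m) B h p.1 - wtSum (cw n m) B h (Function.update p.1 i p.2) := fun hm =>
    ((measurable_wtSum _ _ hm).comp measurable_fst).sub ((measurable_wtSum _ _ hm).comp hv)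
  have e : ENNReal.ofReal (4 * kap n m) = 2 * ENNReal.ofReal (2 * kap n m) := by
    rw [← ENNReal.ofReal_ofNat, ← ENNReal.ofReal_mul (by norm_num)]; congr 1; ring
  have e' : ENNReal.ofReal (8 * cw n m i ^ 2) = 2 * ENNReal.ofReal (4 * cw n m i ^ 2) := by
    rw [← ENNReal.ofReal_ofNat 2, ← ENNReal.ofReal_mul (by norm_num)]; congr 1; ring
  have hsum := lintegral_enorm_add_sq_le (μ := (Measure.pi fun _ : Fin n ⊕ Fin m => P).prod P)
    (hinc (B := firstFold n m) m2) (hinc (B := (firstFold n m)ᶜ) m1)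
  have hw1 := ENNReal.ofReal_le_ofReal (wtBound_firstFold_compl_le (m := m) hn)
  have hw2 := ENNReal.ofReal_le_ofReal (wtBound_firstFold_le (m := m) hn)
  refine le_trans (le_of_eq (lintegral_congr fun p => ?_)) (hsum.trans ?_)
  · simp only [fitRem]; congr 2; ring
  rw [e, e', mspe_eq]
  rcases i with i | i
  · rw [lintegral_fitErr_update_inl (measurable_half1 h1)] at b1
    rw [lintegral_fitErr_update_inl (measurable_half2 h2)] at b2
    simp only [looSum, Sum.elim_inl]
    calc _ ≤ _ := add_le_add (mul_le_mul_right b2 2) (mul_le_mul_right b1 2)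
      _ ≤ 2 * (_ + ENNReal.ofReal (2 * kap n m) * _) + 2 * (_ + ENNReal.ofReal (2 * kap n m) * _) :=
        by gcongr
      _ = _ := by ring
  · rw [lintegral_fitErr_update_inr, mul_zero, add_zero] at b1 b2
    simp only [looSum, Sum.elim_inr, mul_zero, add_zero]
    calc _ ≤ _ := add_le_add (mul_le_mul_right b2 2) (mul_le_mul_right b1 2)
      _ = _ := by ring

lemma looSum_le (hf : Measurable f)
    (h1 : Measurable (Function.uncurry fhat1)) (h2 : Measurable (Function.uncurry fhat2))
    (i : Fin n ⊕ Fin m) : looSum P fhat1 fhat2 i ≤ 4 * mspe P f fhat1 fhat2 := by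
  rcases i with i | i
  · rw [mspe_eq, mul_add]
    exact add_le_add (looError_le hf (measurable_half1 h1) i)
      (looError_le hf (measurable_half2 h2) i)
  · exact zero_le

end fit

/-! ### Perturbation of a normal approximation -/

lemma ncdf_le_add {t ε : ℝ} (hε : 0 ≤ ε) : ncdf (t + ε) ≤ ncdf t + ε := by
  have h := Convex.norm_image_sub_le_of_norm_hasDerivWithin_le (f := ncdf) (f' := npdf) (C := 1)
    (s := Set.univ) (x := t) (y := t + ε) (fun x _ => (hasDerivAt_ncdf x).hasDerivWithinAt)
    (fun x _ => by
      rw [Real.norm_eq_abs, abs_of_nonneg (npdf_pos x).le]; exact npdf_le_one x) convex_univ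
    (Set.mem_univ _) (Set.mem_univ _)
  rw [one_mul, add_sub_cancel_left, Real.norm_eq_abs, Real.norm_eq_abs, abs_of_nonneg hε] at h
  linarith [le_abs_self (ncdf (t + ε) - ncdf t)]

lemma measureReal_le_of_lintegral_sq {Ω : Type*} [MeasurableSpace Ω] {μ : Measure Ω}
    {B : Ω → ℝ} (hB : Measurable B) {v ε : ℝ} (hv0 : 0 ≤ v) (hε : 0 < ε)
    (hv : ∫⁻ ω, ‖B ω‖ₑ ^ 2 ∂μ ≤ ENNReal.ofReal v) :
    μ.real {ω | ε ≤ |B ω|} ≤ v / ε ^ 2 := by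
  have h := mul_meas_ge_le_lintegral (μ := μ) (hB.enorm.pow_const 2) (ENNReal.ofReal (ε ^ 2))
  have hsub : {ω | ε ≤ |B ω|} ⊆ {ω | ENNReal.ofReal (ε ^ 2) ≤ ‖B ω‖ₑ ^ 2} := fun ω hω => by
    rw [Set.mem_ofPred_eq, Real.enorm_eq_ofReal_abs, ← ENNReal.ofReal_pow (abs_nonneg _)]
    exact ENNReal.ofReal_le_ofReal (pow_le_pow_left₀ hε.le hω 2)
  refine ENNReal.toReal_le_of_le_ofReal (by positivity) ((measure_mono hsub).trans ?_)
  rw [ENNReal.ofReal_div_of_pos (by positivity),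
    ENNReal.le_div_iff_mul_le (Or.inl (by simp [hε.ne'])) (Or.inl ENNReal.ofReal_ne_top), mul_comm]
  exact h.trans hv

/-- Shifting `t` by `ε` costs at most `ε` in the normal distribution function, and `|B| ≥ ε` has
probability at most `4 q³ / ε²`. At `ε = q` these add up to `5 q`; the extra `δ` keeps `ε` positive
when `q = 0`. -/
lemma abs_measureReal_sub_ncdf_le {Ω : Type*} [MeasurableSpace Ω] {μ : Measure Ω}
    [IsProbabilityMeasure μ] {A B : Ω → ℝ} (hB : Measurable B) {β v q : ℝ}
    (hA : ∀ t, |μ.real {ω | A ω ≤ t} - ncdf t| ≤ β) (hq : 0 ≤ q)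
    (hv : ∫⁻ ω, ‖B ω‖ₑ ^ 2 ∂μ ≤ ENNReal.ofReal v) (hvq : v = 4 * q ^ 3) (t : ℝ) :
    |μ.real {ω | A ω + B ω ≤ t} - ncdf t| ≤ β + 5 * q := by
  have hv0 : 0 ≤ v := by rw [hvq]; positivity
  refine le_of_forall_pos_le_add fun δ hδ => ?_
  set ε := q + δ with hε
  have hε0 : 0 < ε := by positivity
  have hB' := measureReal_le_of_lintegral_sq hB hv0 hε0 hv
  have hle : v / ε ^ 2 ≤ 4 * q := by
    rw [div_le_iff₀ (by positivity), hvq]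
    have : q ^ 2 ≤ ε ^ 2 := pow_le_pow_left₀ hq (by linarith) 2
    nlinarith
  have h1 : μ.real {ω | A ω + B ω ≤ t} ≤ μ.real {ω | A ω ≤ t + ε} + μ.real {ω | ε ≤ |B ω|} := by
    refine (measureReal_mono fun ω hω => ?_).trans (measureReal_union_le _ _)
    by_cases h : ε ≤ |B ω|
    · exact Or.inr h
    · refine Or.inl ?_
      have := (abs_lt.1 (not_le.1 h)).1
      simp only [Set.mem_ofPred_eq] at hω ⊢
      linarith
  have h2 : μ.real {ω | A ω ≤ t - ε} ≤ μ.real {ω | A ω + B ω ≤ t} + μ.real {ω | ε ≤ |B ω|} := by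
    refine (measureReal_mono fun ω hω => ?_).trans (measureReal_union_le _ _)
    by_cases h : ε ≤ |B ω|
    · exact Or.inr h
    · refine Or.inl ?_
      have := (abs_lt.1 (not_le.1 h)).2
      simp only [Set.mem_ofPred_eq] at hω ⊢
      linarith
  have h3 := abs_le.1 (hA (t + ε))
  have h4 := abs_le.1 (hA (t - ε))
  have h5 := ncdf_le_add (t := t) hε0.le
  have h6 := ncdf_le_add (t := t - ε) hε0.le
  rw [sub_add_cancel] at h6
  rw [abs_le]
  constructor <;> linarith

/-! ### The degenerate part of the U-statistic -/

section degenerate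

variable {𝒳 : Type u} {𝒴 : Type v} [MeasurableSpace 𝒳] [MeasurableSpace 𝒴]
  {P : Measure (𝒳 × 𝒴)} {r : ℕ} [NeZero r] {ℓ : (Fin r → 𝒴) → ℝ}
  {n m : ℕ}

lemma Mf_eq_lintegral {f : 𝒳 → ℝ} (hf : Measurable f) (p : ℕ) :
    Mf P f p = ∫⁻ z, ‖cF P f z‖ₑ ^ p ∂P :=
  (measurePreserving_fst'.lintegral_comp ((hf.sub_const _).enorm.pow_const p)).symm

variable [IsProbabilityMeasure P]

lemma lintegral_uRem_labelsY (hrn : r < n) (hℓ : Measurable ℓ)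
    (hsymm : ∀ (τ : Equiv.Perm (Fin r)) (y : Fin r → 𝒴), ℓ (y ∘ τ) = ℓ y)
    (hℓ2 : MemLp ℓ 2 (Measure.pi fun _ : Fin r => P.snd)) :
    ∫⁻ D, ‖uRem P.snd ℓ (labelsY D)‖ₑ ^ 2 ∂(Measure.pi fun _ : Fin n ⊕ Fin m => P) ≤
      ENNReal.ofReal (2 * r ^ 4 * ((1 + r) * sigmaEll P ℓ) ^ 2 / n ^ 2) :=
  (measurePreserving_labelsY.lintegral_comp
    ((measurable_uRem (Q := P.snd) (n := n) hℓ).enorm.pow_const 2)).trans_le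
    (uRem_second_moment hrn hℓ hsymm hℓ2)

lemma lintegral_uRem_labelsY_increment (hrn : r < n) (hℓ : Measurable ℓ)
    (hsymm : ∀ (τ : Equiv.Perm (Fin r)) (y : Fin r → 𝒴), ℓ (y ∘ τ) = ℓ y)
    (hℓ2 : MemLp ℓ 2 (Measure.pi fun _ : Fin r => P.snd)) (i : Fin n ⊕ Fin m) :
    ∫⁻ p, ‖uRem P.snd ℓ (labelsY p.1) - uRem P.snd ℓ (labelsY (Function.update p.1 i p.2))‖ₑ ^ 2
        ∂((Measure.pi fun _ : Fin n ⊕ Fin m => P).prod P) ≤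
      ENNReal.ofReal (8 * r ^ 4 * ((1 + r) * sigmaEll P ℓ) ^ 2 / n * bw n m i ^ 2) := by
  rcases i with i | i
  · have hmp : MeasurePreserving (fun p : (Fin n ⊕ Fin m → 𝒳 × 𝒴) × 𝒳 × 𝒴 => (labelsY p.1, p.2.2))
        ((Measure.pi fun _ => P).prod P) ((Measure.pi fun _ : Fin n => P.snd).prod P.snd) :=
      measurePreserving_labelsY.prod measurePreserving_snd'
    have hg : Measurable fun q : (Fin n → 𝒴) × 𝒴 =>
        ‖uRem P.snd ℓ q.1 - uRem P.snd ℓ (Function.update q.1 i q.2)‖ₑ ^ 2 :=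
      (((measurable_uRem hℓ).comp measurable_fst).sub ((measurable_uRem hℓ).comp
        (measurePreserving_update P.snd i).measurable)).enorm.pow_const 2
    simp only [labelsY_update_inl]
    refine (hmp.lintegral_comp hg).trans_le ((uRem_increment hrn hℓ hsymm hℓ2 i).trans_eq ?_)
    congr 1
    simp only [degBound, sigmaEll, bw, Sum.elim_inl]
    field_simp
  · simp [labelsY_update_inr]

lemma integrable_abs_cube {α : Type*} [MeasurableSpace α] {μ : Measure α} {g : α → ℝ}
    (h : MemLp g 3 μ) : Integrable (fun x => |g x| ^ 3) μ := by
  simpa using h.integrable_norm_pow (by norm_num)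

lemma memLp_three_of_lintegral {α : Type*} [MeasurableSpace α] {μ : Measure α} {g : α → ℝ}
    (hg : AEStronglyMeasurable g μ) (h : ∫⁻ x, ‖g x‖ₑ ^ 3 ∂μ ≠ ⊤) : MemLp g 3 μ := by
  refine ⟨hg, (eLpNorm_lt_top_iff_lintegral_rpow_enorm_lt_top (by norm_num) (by norm_num)).2 ?_⟩
  refine lt_of_eq_of_lt ?_ h.lt_top
  refine lintegral_congr fun x => ?_
  rw [ENNReal.toReal_ofNat, ← ENNReal.rpow_natCast]
  norm_num

lemma ofReal_integral_abs_cube {α : Type*} [MeasurableSpace α] {μ : Measure α} {g : α → ℝ}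
    (h : MemLp g 3 μ) : ENNReal.ofReal (∫ x, |g x| ^ 3 ∂μ) = ∫⁻ x, ‖g x‖ₑ ^ 3 ∂μ := by
  rw [ofReal_integral_eq_lintegral_ofReal (integrable_abs_cube h)
    (Filter.Eventually.of_forall fun x => by positivity)]
  refine lintegral_congr fun x => ?_
  rw [ENNReal.ofReal_pow (abs_nonneg _), Real.enorm_eq_ofReal_abs]

lemma Mell_eq_lintegral (hℓ : Measurable ℓ)
    (hℓ2 : MemLp ℓ 2 (Measure.pi fun _ : Fin r => P.snd)) (p : ℕ) :
    Mell P ℓ p = ∫⁻ z, ‖cEll P ℓ z‖ₑ ^ p ∂P := by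
  rw [Mell, centralMoment, integral_ell1 hℓ hℓ2]
  exact (measurePreserving_snd'.lintegral_comp
    (((measurable_ell1 hℓ).sub_const _).enorm.pow_const p)).symm

end degenerate

/-! ### The standardized statistic -/

section standardized

variable {𝒳 : Type u} {𝒴 : Type v} [MeasurableSpace 𝒳] [MeasurableSpace 𝒴]
  {P : Measure (𝒳 × 𝒴)} {r : ℕ} [NeZero r] {ℓ : (Fin r → 𝒴) → ℝ}
  {f : 𝒳 → ℝ} {n m : ℕ}
  {fhat1 : (Fold1 n → 𝒳 × 𝒴) → 𝒳 → ℝ} {fhat2 : (Fold2 n → 𝒳 × 𝒴) → 𝒳 → ℝ}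

/-- The standardizing factor of the statistic. -/
def scale (P : Measure (𝒳 × 𝒴)) (ℓ : (Fin r → 𝒴) → ℝ) (f : 𝒳 → ℝ) (n m : ℕ) : ℝ :=
  √(n : ℝ) / √(Lam P ℓ f n m)

/-- The standardized linear part. -/
def stdPart (P : Measure (𝒳 × 𝒴)) (ℓ : (Fin r → 𝒴) → ℝ) (f : 𝒳 → ℝ) (n m : ℕ)
    (i : Fin n ⊕ Fin m) (z : 𝒳 × 𝒴) : ℝ := scale P ℓ f n m * r * linPart P ℓ f n m i z

lemma scale_nonneg : 0 ≤ scale P ℓ f n m := by rw [scale]; positivity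

lemma sigma1_pos (hs : 0 < sigma1Sq P ℓ) : 0 < sigma1 P ℓ := Real.sqrt_pos.2 hs

lemma rCast_pos : (0 : ℝ) < r := by exact_mod_cast Nat.pos_of_ne_zero (NeZero.ne r)

lemma memLp_stdPart (hℓ3 : MemLp (cEll P ℓ) 3 P) (hf3 : MemLp (cF P f) 3 P) (i : Fin n ⊕ Fin m) :
    MemLp (stdPart P ℓ f n m i) 3 P := by
  have h : MemLp (linPart P ℓ f n m i) 3 P := (hℓ3.const_mul _).sub (hf3.const_mul _)
  exact h.const_mul _

/-- The standardized degenerate part. -/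
def stdDeg (P : Measure (𝒳 × 𝒴)) (ℓ : (Fin r → 𝒴) → ℝ) (f : 𝒳 → ℝ)
    (D : Fin n ⊕ Fin m → 𝒳 × 𝒴) : ℝ := scale P ℓ f n m * uRem P.snd ℓ (labelsY D)

/-- The standardized part that is due to the trained functions. -/
def stdFit (P : Measure (𝒳 × 𝒴)) (ℓ : (Fin r → 𝒴) → ℝ) (f : 𝒳 → ℝ)
    (fhat1 : (Fold1 n → 𝒳 × 𝒴) → 𝒳 → ℝ) (fhat2 : (Fold2 n → 𝒳 × 𝒴) → 𝒳 → ℝ)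
    (D : Fin n ⊕ Fin m → 𝒳 × 𝒴) : ℝ := -(scale P ℓ f n m * r) * fitRem f fhat1 fhat2 D

lemma measurable_stdFit (hf : Measurable f) (h1 : Measurable (Function.uncurry fhat1))
    (h2 : Measurable (Function.uncurry fhat2)) :
    Measurable (stdFit P ℓ f fhat1 fhat2 : (Fin n ⊕ Fin m → 𝒳 × 𝒴) → ℝ) :=
  (measurable_fitRem hf h1 h2).const_mul _

lemma standardized_eq (hrn : r < n) (D : Fin n ⊕ Fin m → 𝒳 × 𝒴) :
    √(n : ℝ) * (UCross ℓ fhat1 fhat2 (labeled D) (fun j => (D (Sum.inr j)).1) - psi P ℓ) /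
      √(Lam P ℓ f n m) =
    ∑ i, stdPart P ℓ f n m i (D i) + stdDeg P ℓ f D + stdFit P ℓ f fhat1 fhat2 D := by
  rw [UCross_sub_eq P ℓ f fhat1 fhat2 hrn D]
  simp only [stdPart, ← Finset.mul_sum, stdDeg, stdFit, fitRem, scale]
  ring

variable [IsProbabilityMeasure P]

section kernel

variable (hℓ : Measurable ℓ) (hℓ2 : MemLp ℓ 2 (Measure.pi fun _ : Fin r => P.snd))
  (hs : 0 < sigma1Sq P ℓ) (hf : Measurable f) (hf2 : MemLp f 2 P.fst) (hn : 0 < n)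

include hℓ hℓ2 hs hf hf2 hn

lemma Lam_pos : 0 < Lam P ℓ f n m :=
  (mul_pos (pow_pos rCast_pos 2) hs).trans_le (sigma1Sq_mul_le_Lam hℓ hℓ2 hf hf2 hn)

lemma scale_mul_le : scale P ℓ f n m * r ≤ √(n : ℝ) / sigma1 P ℓ := by
  have hr : (0 : ℝ) < r := rCast_pos
  have hΛ := Lam_pos (m := m) hℓ hℓ2 hs hf hf2 hn
  have h : r * sigma1 P ℓ ≤ √(Lam P ℓ f n m) := by
    refine Real.le_sqrt_of_sq_le ?_
    rw [mul_pow, sigma1, Real.sq_sqrt hs.le]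
    exact sigma1Sq_mul_le_Lam hℓ hℓ2 hf hf2 hn
  rw [scale, div_mul_eq_mul_div, div_le_div_iff₀ (Real.sqrt_pos.2 hΛ) (sigma1_pos hs), mul_assoc]
  gcongr

lemma scale_mul_sq_le : (scale P ℓ f n m * r) ^ 2 ≤ n / sigma1 P ℓ ^ 2 := by
  have h0 : 0 ≤ scale P ℓ f n m * r := mul_nonneg scale_nonneg (Nat.cast_nonneg _)
  refine (pow_le_pow_left₀ h0 (scale_mul_le hℓ hℓ2 hs hf hf2 hn) 2).trans_eq ?_
  rw [div_pow, Real.sq_sqrt (Nat.cast_nonneg _)]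

lemma sum_integral_stdPart_sq : ∑ i, ∫ z, stdPart P ℓ f n m i z ^ 2 ∂P = 1 := by
  have hΛ := Lam_pos (m := m) hℓ hℓ2 hs hf hf2 hn
  have h := sum_integral_linPart_sq (m := m) hℓ hℓ2 hf hf2 hn
  simp only [stdPart, mul_pow _ (linPart P ℓ f n m _ _), integral_const_mul]
  rw [← Finset.mul_sum, scale, mul_pow, div_pow, Real.sq_sqrt (Nat.cast_nonneg _),
    Real.sq_sqrt hΛ.le]
  field_simp
  linarith

lemma sqrt_integral_stdPart_sq_le (i : Fin n ⊕ Fin m) :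
    √(∫ z, stdPart P ℓ f n m i z ^ 2 ∂P) ≤
      √(n : ℝ) / sigma1 P ℓ * (kw n m i * (√(vEll P ℓ) + √(vF P f))) := by
  have h0 : 0 ≤ scale P ℓ f n m * r := mul_nonneg scale_nonneg (Nat.cast_nonneg _)
  simp only [stdPart, mul_pow _ (linPart P ℓ f n m _ _), integral_const_mul]
  rw [Real.sqrt_mul (sq_nonneg _), Real.sqrt_sq h0]
  exact mul_le_mul (scale_mul_le hℓ hℓ2 hs hf hf2 hn) (sqrt_integral_linPart_sq_le hℓ hℓ2 hf2 hn i)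
    (Real.sqrt_nonneg _) (div_nonneg (Real.sqrt_nonneg _) (sigma1_pos hs).le)

lemma sum_integral_stdPart_cube_le (hℓ3 : MemLp (cEll P ℓ) 3 P) (hf3 : MemLp (cF P f) 3 P) :
    ∑ i, ∫ z, |stdPart P ℓ f n m i z| ^ 3 ∂P ≤
      8 * ((tEll P ℓ + tF P f) / (√(n : ℝ) * sigma1 P ℓ ^ 3)) := by
  have hn' : (0 : ℝ) < n := by exact_mod_cast hn
  have hσ := sigma1_pos hs
  have h0 : 0 ≤ scale P ℓ f n m * r := mul_nonneg scale_nonneg (Nat.cast_nonneg _)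
  have h := sum_integral_linPart_cube_le (m := m) hℓ3 hf3 hn
  have hT : 0 ≤ tEll P ℓ + tF P f := add_nonneg tEll_nonneg tF_nonneg
  simp only [stdPart, abs_mul _ (linPart P ℓ f n m _ _), abs_of_nonneg h0,
    mul_pow _ |linPart P ℓ f n m _ _|, integral_const_mul]
  rw [← Finset.mul_sum]
  calc _ ≤ (√(n : ℝ) / sigma1 P ℓ) ^ 3 * (8 * (tEll P ℓ + tF P f) / n ^ 2) := by
        gcongr
        exact scale_mul_le hℓ hℓ2 hs hf hf2 hn
    _ = _ := by
      have e : (n : ℝ) = √(n : ℝ) ^ 2 := (Real.sq_sqrt hn'.le).symm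
      have hq : 0 < √(n : ℝ) := Real.sqrt_pos.2 hn'
      rw [div_pow]
      generalize √(n : ℝ) = q at *
      rw [e]
      field_simp

end kernel

lemma measurable_stdPart (hℓ : Measurable ℓ) (hf : Measurable f) (i : Fin n ⊕ Fin m) :
    Measurable (stdPart P ℓ f n m i) := (measurable_linPart hℓ hf i).const_mul _

lemma integral_stdPart (hℓ : Measurable ℓ)
    (hℓ2 : MemLp ℓ 2 (Measure.pi fun _ : Fin r => P.snd))
    (hf : Measurable f) (hf2 : MemLp f 2 P.fst) (i : Fin n ⊕ Fin m) :
    ∫ z, stdPart P ℓ f n m i z ∂P = 0 := by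
  simp only [stdPart]
  rw [integral_const_mul, integral_linPart hℓ hℓ2 hf hf2, mul_zero]

lemma measurable_stdDeg (hℓ : Measurable ℓ) :
    Measurable (stdDeg P ℓ f : (Fin n ⊕ Fin m → 𝒳 × 𝒴) → ℝ) :=
  ((measurable_uRem hℓ).comp measurable_labelsY).const_mul _

section bounds

variable (hrn : r < n) (hℓ : Measurable ℓ)
  (hsymm : ∀ (τ : Equiv.Perm (Fin r)) (y : Fin r → 𝒴), ℓ (y ∘ τ) = ℓ y)
  (hℓ2 : MemLp ℓ 2 (Measure.pi fun _ : Fin r => P.snd))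
  (hs : 0 < sigma1Sq P ℓ) (hf : Measurable f) (hf2 : MemLp f 2 P.fst)

include hrn hℓ hsymm hℓ2 hs hf hf2 in
lemma lintegral_stdDeg_sq_le :
    ∫⁻ D, ‖stdDeg P ℓ f D‖ₑ ^ 2 ∂(Measure.pi fun _ : Fin n ⊕ Fin m => P) ≤
      ENNReal.ofReal (2 * (r * (1 + r) * sigmaEll P ℓ / (√(n : ℝ) * sigma1 P ℓ)) ^ 2) := by
  have hn : 0 < n := (Nat.zero_le r).trans_lt hrn
  have hn' : (0 : ℝ) < n := by exact_mod_cast hn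
  have h := scale_mul_sq_le (m := m) hℓ hℓ2 hs hf hf2 hn
  have hσ := sigma1_pos hs
  simp only [stdDeg]
  rw [lintegral_enorm_const_mul_sq]
  refine (mul_le_mul_right (lintegral_uRem_labelsY hrn hℓ hsymm hℓ2) _).trans ?_
  rw [← ENNReal.ofReal_mul (sq_nonneg _)]
  refine ENNReal.ofReal_le_ofReal ?_
  calc _ = (scale P ℓ f n m * r) ^ 2 * (2 * (r * (1 + r) * sigmaEll P ℓ) ^ 2 / n ^ 2) := by ring
    _ ≤ n / sigma1 P ℓ ^ 2 * (2 * (r * (1 + r) * sigmaEll P ℓ) ^ 2 / n ^ 2) := by gcongr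
    _ = _ := by
      rw [div_pow, mul_pow √(n : ℝ), Real.sq_sqrt hn'.le]
      field_simp

include hrn hℓ hsymm hℓ2 hs hf hf2 in
lemma lintegral_stdDeg_increment_le (i : Fin n ⊕ Fin m) :
    ∫⁻ p, ‖stdDeg P ℓ f p.1 - stdDeg P ℓ f (Function.update p.1 i p.2)‖ₑ ^ 2
        ∂((Measure.pi fun _ : Fin n ⊕ Fin m => P).prod P) ≤
      ENNReal.ofReal (8 * (r * (1 + r) * sigmaEll P ℓ * bw n m i / sigma1 P ℓ) ^ 2) := by
  have hn : 0 < n := (Nat.zero_le r).trans_lt hrn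
  have hn' : (0 : ℝ) < n := by exact_mod_cast hn
  have h := scale_mul_sq_le (m := m) hℓ hℓ2 hs hf hf2 hn
  have hσ := sigma1_pos hs
  simp only [stdDeg, ← mul_sub]
  rw [lintegral_enorm_const_mul_sq]
  refine (mul_le_mul_right (lintegral_uRem_labelsY_increment hrn hℓ hsymm hℓ2 i) _).trans ?_
  rw [← ENNReal.ofReal_mul (sq_nonneg _)]
  refine ENNReal.ofReal_le_ofReal ?_
  calc _ = (scale P ℓ f n m * r) ^ 2 * (8 * (r * (1 + r) * sigmaEll P ℓ * bw n m i) ^ 2 / n) := by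
        ring
    _ ≤ n / sigma1 P ℓ ^ 2 * (8 * (r * (1 + r) * sigmaEll P ℓ * bw n m i) ^ 2 / n) := by gcongr
    _ = _ := by field_simp

variable (h1 : Measurable (Function.uncurry fhat1)) (h2 : Measurable (Function.uncurry fhat2))
  (hM : mspe P f fhat1 fhat2 ≠ ⊤)

include hrn hℓ hℓ2 hs hf hf2 h1 h2 hM in
lemma lintegral_stdFit_sq_le :
    ∫⁻ D, ‖stdFit P ℓ f fhat1 fhat2 D‖ₑ ^ 2 ∂(Measure.pi fun _ : Fin n ⊕ Fin m => P) ≤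
      ENNReal.ofReal (4 * ((mspe P f fhat1 fhat2).toReal / sigma1 P ℓ ^ 2)) := by
  have hn : 0 < n := (Nat.zero_le r).trans_lt hrn
  have hn' : (0 : ℝ) < n := by exact_mod_cast hn
  have h := scale_mul_sq_le (m := m) hℓ hℓ2 hs hf hf2 hn
  have hσ := sigma1_pos hs
  have hk : 0 ≤ kap n m := kap_nonneg
  simp only [stdFit]
  rw [lintegral_enorm_const_mul_sq, neg_sq]
  refine (mul_le_mul_right (fitRem_second_moment (P := P) hn hf h1 h2) _).trans ?_
  nth_rw 1 [← ENNReal.ofReal_toReal hM]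
  rw [← ENNReal.ofReal_mul (by positivity), ← ENNReal.ofReal_mul (sq_nonneg _)]
  refine ENNReal.ofReal_le_ofReal ?_
  have hM0 : 0 ≤ (mspe P f fhat1 fhat2).toReal := ENNReal.toReal_nonneg
  generalize (mspe P f fhat1 fhat2).toReal = M at *
  calc _ ≤ n / sigma1 P ℓ ^ 2 * (4 * kap n m * M) := by gcongr
    _ = 4 * (n * kap n m * (M / sigma1 P ℓ ^ 2)) := by ring
    _ ≤ _ := by
      gcongr
      exact mul_le_of_le_one_left (by positivity) (n_mul_kap_le_one hn)

include hrn hℓ hℓ2 hs hf hf2 h1 h2 hM in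
lemma lintegral_stdFit_increment_le (i : Fin n ⊕ Fin m) :
    ∫⁻ p, ‖stdFit P ℓ f fhat1 fhat2 p.1 - stdFit P ℓ f fhat1 fhat2 (Function.update p.1 i p.2)‖ₑ ^ 2
        ∂((Measure.pi fun _ : Fin n ⊕ Fin m => P).prod P) ≤
      ENNReal.ofReal (n / sigma1 P ℓ ^ 2 * (8 * cw n m i ^ 2 * (mspe P f fhat1 fhat2).toReal +
        4 * kap n m * (looSum P fhat1 fhat2 i).toReal)) := by
  have hn : 0 < n := (Nat.zero_le r).trans_lt hrn
  have h := scale_mul_sq_le (m := m) hℓ hℓ2 hs hf hf2 hn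
  have hk : 0 ≤ kap n m := kap_nonneg
  have hL : looSum P fhat1 fhat2 i ≠ ⊤ :=
    ((looSum_le hf h1 h2 i).trans_lt (ENNReal.mul_lt_top (by norm_num) hM.lt_top)).ne
  simp only [stdFit, ← mul_sub]
  rw [lintegral_enorm_const_mul_sq, neg_sq]
  refine (mul_le_mul_right (fitRem_increment (P := P) hn hf h1 h2 i) _).trans ?_
  nth_rw 1 [← ENNReal.ofReal_toReal hM, ← ENNReal.ofReal_toReal hL]
  rw [← ENNReal.ofReal_mul (by positivity), ← ENNReal.ofReal_mul (by positivity),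
    ← ENNReal.ofReal_add (by positivity) (by positivity), ← ENNReal.ofReal_mul (sq_nonneg _)]
  refine ENNReal.ofReal_le_ofReal ?_
  gcongr

end bounds

end standardized

/-! ### Normal approximation on the product space -/

lemma lintegral_enorm_add_sq_le_ofReal {Ω : Type*} [MeasurableSpace Ω] {μ : Measure Ω}
    {X Y : Ω → ℝ} (hX : Measurable X) (hY : Measurable Y) {a b : ℝ} (ha : 0 ≤ a) (hb : 0 ≤ b)
    (h1 : ∫⁻ ω, ‖X ω‖ₑ ^ 2 ∂μ ≤ ENNReal.ofReal a) (h2 : ∫⁻ ω, ‖Y ω‖ₑ ^ 2 ∂μ ≤ ENNReal.ofReal b) :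
    ∫⁻ ω, ‖X ω + Y ω‖ₑ ^ 2 ∂μ ≤ ENNReal.ofReal (2 * a + 2 * b) := by
  refine (lintegral_enorm_add_sq_le hX hY).trans ?_
  rw [ENNReal.ofReal_add (by positivity) (by positivity), ENNReal.ofReal_mul zero_le_two,
    ENNReal.ofReal_mul zero_le_two, ENNReal.ofReal_ofNat]
  gcongr

/-- The closing arithmetic of `normal_approx_stdDeg_add_stdFit`: `p₀` is the third moment term, `p₁`
and `p₂` come from the degenerate part, `B`, `p₃`, `p₄`, `p₅` from the trained functions, and `ρ`
stands for `r (1 + r)`. -/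
lemma combine_bounds {c s ρ p₀ p₁ p₂ p₃ p₄ p₅ B : ℝ} (hρ : 0 ≤ ρ) (h₀ : 0 ≤ p₀) (h₁ : 0 ≤ p₁)
    (h₂ : 0 ≤ p₂) (h₄ : 0 ≤ p₄) (h₅ : 0 ≤ p₅) (hB : 0 ≤ B) (hc : c ≤ 8 * p₀)
    (hs : s ≤ 4 * (ρ * p₂) + (8 * p₃ + 3 * p₄)) :
    64 * c + 2 * (2 * (ρ * p₁) + 3 * B) + 2 * s ≤
      (512 + 8 * ρ) * (p₀ + (p₁ + p₂)) + 16 * (B + p₃ + p₄ + p₅) := by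
  linarith [mul_nonneg hρ h₀, mul_nonneg hρ h₁, mul_nonneg hρ h₂]

section approximation

variable {𝒳 : Type u} {𝒴 : Type v} [MeasurableSpace 𝒳] [MeasurableSpace 𝒴]
  {P : Measure (𝒳 × 𝒴)} {r : ℕ} [NeZero r] {ℓ : (Fin r → 𝒴) → ℝ}
  {f : 𝒳 → ℝ} {n m : ℕ}
  {fhat1 : (Fold1 n → 𝒳 × 𝒴) → 𝒳 → ℝ} {fhat2 : (Fold2 n → 𝒳 × 𝒴) → 𝒳 → ℝ}

/-- The sum of the standard deviations in the bound. -/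
def devSum (P : Measure (𝒳 × 𝒴)) (ℓ : (Fin r → 𝒴) → ℝ) (f : 𝒳 → ℝ) : ℝ :=
  √(vEll P ℓ) + √(vF P f) + sigma1 P ℓ

/-- A real version of the first term of the bound. -/
def rate (P : Measure (𝒳 × 𝒴)) (ℓ : (Fin r → 𝒴) → ℝ) (f : 𝒳 → ℝ) (n : ℕ) : ℝ :=
  (tEll P ℓ + tF P f) / (√(n : ℝ) * sigma1 P ℓ ^ 3) +
    devSum P ℓ f * sigmaEll P ℓ / (√(n : ℝ) * sigma1 P ℓ ^ 2)

lemma sum_kw_mul_bw (hn : 0 < n) : ∑ i, kw n m i * bw n m i = 1 / n := by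
  have hn' : (0 : ℝ) < n := by exact_mod_cast hn
  simp [kw, bw]
  field_simp

/-- Cauchy–Schwarz over the labeled observations turns the sum of individual root errors into the
root of the total, which is what `Δ_Stability` contains. -/
lemma sum_kw_mul_sqrt_le (hn : 0 < n) {L : Fin n ⊕ Fin m → ℝ} (hL : ∀ i, 0 ≤ L i)
    (hLr : ∀ j, L (Sum.inr j) = 0) :
    ∑ i, kw n m i * √(L i) ≤ √(∑ i, L i) / √(n : ℝ) := by
  have hn' : (0 : ℝ) < n := by exact_mod_cast hn
  have hq : 0 < √(n : ℝ) := Real.sqrt_pos.2 hn'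
  have hcs : ∑ i : Fin n, √(L (Sum.inl i)) ≤ √(n : ℝ) * √(∑ i : Fin n, L (Sum.inl i)) := by
    have := Real.sum_sqrt_mul_sqrt_le (Finset.univ : Finset (Fin n)) (f := fun _ => (1 : ℝ))
      (g := fun i => L (Sum.inl i)) (fun _ => zero_le_one) (fun i => hL _)
    simpa using this
  have hc0 : 0 ≤ ∑ i : Fin n, √(L (Sum.inl i)) := Finset.sum_nonneg fun _ _ => Real.sqrt_nonneg _
  rw [Fintype.sum_sum_type, Fintype.sum_sum_type]
  simp only [hLr, Real.sqrt_zero, mul_zero, Finset.sum_const_zero, add_zero, kw, Sum.elim_inl,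
    ← Finset.mul_sum]
  rw [le_div_iff₀ hq, one_div, inv_mul_eq_div, div_mul_eq_mul_div, div_le_iff₀ hn']
  calc _ ≤ √(n : ℝ) * √(∑ i : Fin n, L (Sum.inl i)) * √(n : ℝ) := by gcongr
    _ = √(∑ i : Fin n, L (Sum.inl i)) * √(n : ℝ) ^ 2 := by ring
    _ = _ := by rw [Real.sq_sqrt hn'.le]

variable [IsProbabilityMeasure P] (hrn : r < n) (hℓ : Measurable ℓ)
  (hsymm : ∀ (τ : Equiv.Perm (Fin r)) (y : Fin r → 𝒴), ℓ (y ∘ τ) = ℓ y)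
  (hℓ2 : MemLp ℓ 2 (Measure.pi fun _ : Fin r => P.snd))
  (hs : 0 < sigma1Sq P ℓ) (hf : Measurable f) (hf2 : MemLp f 2 P.fst)
  (hℓ3 : MemLp (cEll P ℓ) 3 P) (hf3 : MemLp (cF P f) 3 P)

include hrn hℓ hsymm hℓ2 hs hf hf2 hℓ3 hf3

lemma normal_approx_stdDeg (t : ℝ) :
    |(Measure.pi fun _ : Fin n ⊕ Fin m => P).real
        {D | ∑ i, stdPart P ℓ f n m i (D i) + stdDeg P ℓ f D ≤ t} - ncdf t| ≤
      (512 + 8 * (r * (1 + r))) * rate P ℓ f n := by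
  have hn : 0 < n := (Nat.zero_le r).trans_lt hrn
  have hn' : (0 : ℝ) < n := by exact_mod_cast hn
  have hq : 0 < √(n : ℝ) := Real.sqrt_pos.2 hn'
  have hσ := sigma1_pos hs
  have hE : 0 ≤ sigmaEll P ℓ := Real.sqrt_nonneg _
  have hx : 0 ≤ √(vEll P ℓ) := Real.sqrt_nonneg _
  have hy : 0 ≤ √(vF P f) := Real.sqrt_nonneg _
  have hcube := sum_integral_stdPart_cube_le (m := m) hℓ hℓ2 hs hf hf2 hn hℓ3 hf3
  have hsqrt := sqrt_integral_stdPart_sq_le (m := m) hℓ hℓ2 hs hf hf2 hn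
  have hb0 : ∀ i, 0 ≤ bw n m i := bw_nonneg
  set K := r * (1 + r) * sigmaEll P ℓ with hK
  have hK0 : 0 ≤ K := by positivity
  have main := berry_esseen_nonlinear (P := P) (w := stdPart P ℓ f n m)
    (measurable_stdPart hℓ hf) (memLp_stdPart hℓ3 hf3) (integral_stdPart hℓ hℓ2 hf hf2)
    (sum_integral_stdPart_sq hℓ hℓ2 hs hf hf2 hn) (measurable_stdDeg hℓ)
    -- Here and in `e` below, the factors `2` and `3` are convenient upper bounds for `√2` and `√8`.
    (d := 2 * (K / (√(n : ℝ) * sigma1 P ℓ))) (by positivity)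
    ((lintegral_stdDeg_sq_le hrn hℓ hsymm hℓ2 hs hf hf2).trans (ENNReal.ofReal_le_ofReal (by
      rw [mul_pow]; nlinarith [sq_nonneg (K / (√(n : ℝ) * sigma1 P ℓ))])))
    (e := fun i => 3 * (K * bw n m i / sigma1 P ℓ)) (fun i => by have := hb0 i; positivity)
    (fun i => (lintegral_stdDeg_increment_le hrn hℓ hsymm hℓ2 hs hf hf2 i).trans
      (ENNReal.ofReal_le_ofReal (by
        rw [mul_pow]; nlinarith [sq_nonneg (K * bw n m i / sigma1 P ℓ)]))) t
  have hsum : ∑ i, √(∫ z, stdPart P ℓ f n m i z ^ 2 ∂P) * (3 * (K * bw n m i / sigma1 P ℓ)) ≤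
      3 * K * (√(vEll P ℓ) + √(vF P f)) / (√(n : ℝ) * sigma1 P ℓ ^ 2) := by
    calc _ ≤ ∑ i, √(n : ℝ) / sigma1 P ℓ * (kw n m i * (√(vEll P ℓ) + √(vF P f))) *
          (3 * (K * bw n m i / sigma1 P ℓ)) := by
          refine Finset.sum_le_sum fun i _ => mul_le_mul_of_nonneg_right (hsqrt i) ?_
          have := hb0 i
          positivity
      _ = √(n : ℝ) * (3 * K * (√(vEll P ℓ) + √(vF P f)) / sigma1 P ℓ ^ 2) *
          ∑ i, kw n m i * bw n m i := by
          rw [Finset.mul_sum]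
          refine Finset.sum_congr rfl fun i _ => ?_
          field_simp
      _ = _ := by
          rw [sum_kw_mul_bw hn]
          nth_rw 2 [← Real.sq_sqrt hn'.le]
          field_simp
  refine main.trans ?_
  have e1 : K / (√(n : ℝ) * sigma1 P ℓ) =
      r * (1 + r) * (sigma1 P ℓ * sigmaEll P ℓ / (√(n : ℝ) * sigma1 P ℓ ^ 2)) := by
    rw [hK]; field_simp
  have e2 : 3 * K * (√(vEll P ℓ) + √(vF P f)) / (√(n : ℝ) * sigma1 P ℓ ^ 2) = 3 * (r * (1 + r)) *
      ((√(vEll P ℓ) + √(vF P f)) * sigmaEll P ℓ / (√(n : ℝ) * sigma1 P ℓ ^ 2)) := by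
    rw [hK]; ring
  have e3 : devSum P ℓ f * sigmaEll P ℓ / (√(n : ℝ) * sigma1 P ℓ ^ 2) =
      sigma1 P ℓ * sigmaEll P ℓ / (√(n : ℝ) * sigma1 P ℓ ^ 2) +
      (√(vEll P ℓ) + √(vF P f)) * sigmaEll P ℓ / (√(n : ℝ) * sigma1 P ℓ ^ 2) := by
    rw [devSum]; ring
  have hT : 0 ≤ tEll P ℓ + tF P f := add_nonneg tEll_nonneg tF_nonneg
  have p0 : 0 ≤ (tEll P ℓ + tF P f) / (√(n : ℝ) * sigma1 P ℓ ^ 3) := by positivity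
  have p1 : 0 ≤ sigma1 P ℓ * sigmaEll P ℓ / (√(n : ℝ) * sigma1 P ℓ ^ 2) := by positivity
  have p2 : 0 ≤ (√(vEll P ℓ) + √(vF P f)) * sigmaEll P ℓ / (√(n : ℝ) * sigma1 P ℓ ^ 2) := by
    positivity
  have hρ : (0 : ℝ) ≤ r * (1 + r) := by positivity
  rw [e1]
  rw [e2] at hsum
  rw [rate, e3]
  generalize (r : ℝ) * (1 + r) = ρ at *
  nlinarith [mul_nonneg hρ p0, mul_nonneg hρ p1, mul_nonneg hρ p2]

set_option maxHeartbeats 1000000 in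
-- Both remainders are put into the nonlinear term `Δ`, so that the trained functions enter through
-- square roots of `Δ_MSPE` and of the stability errors instead of a cube root.
lemma normal_approx_stdDeg_add_stdFit (h1 : Measurable (Function.uncurry fhat1))
    (h2 : Measurable (Function.uncurry fhat2)) (hM : mspe P f fhat1 fhat2 ≠ ⊤) (t : ℝ) :
    |(Measure.pi fun _ : Fin n ⊕ Fin m => P).real {D | ∑ i, stdPart P ℓ f n m i (D i) +
        (stdDeg P ℓ f D + stdFit P ℓ f fhat1 fhat2 D) ≤ t} - ncdf t| ≤
      (512 + 8 * (r * (1 + r))) * rate P ℓ f n +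
        16 * (devSum P ℓ f / sigma1 P ℓ ^ 2 * (√(mspe P f fhat1 fhat2).toReal +
          √(n * kap n m * ∑ i : Fin n ⊕ Fin m, (looSum P fhat1 fhat2 i).toReal))) := by
  have hn : 0 < n := (Nat.zero_le r).trans_lt hrn
  have hn' : (0 : ℝ) < n := by exact_mod_cast hn
  have hq : 0 < √(n : ℝ) := Real.sqrt_pos.2 hn'
  have hσ := sigma1_pos hs
  have hE : 0 ≤ sigmaEll P ℓ := Real.sqrt_nonneg _
  have hx : 0 ≤ √(vEll P ℓ) := Real.sqrt_nonneg _
  have hy : 0 ≤ √(vF P f) := Real.sqrt_nonneg _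
  have hk : 0 ≤ kap n m := kap_nonneg
  have hcube := sum_integral_stdPart_cube_le (m := m) hℓ hℓ2 hs hf hf2 hn hℓ3 hf3
  have hsqrt := sqrt_integral_stdPart_sq_le (m := m) hℓ hℓ2 hs hf hf2 hn
  have hb0 : ∀ i, 0 ≤ bw n m i := bw_nonneg
  have hfit := lintegral_stdFit_sq_le (m := m) hrn hℓ hℓ2 hs hf hf2 h1 h2 hM
  have hfitinc := lintegral_stdFit_increment_le (m := m) hrn hℓ hℓ2 hs hf hf2 h1 h2 hM
  have hM0 : 0 ≤ (mspe P f fhat1 fhat2).toReal := ENNReal.toReal_nonneg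
  have hL0 : ∀ i : Fin n ⊕ Fin m, 0 ≤ (looSum P fhat1 fhat2 i).toReal :=
    fun i => ENNReal.toReal_nonneg
  have hLr : ∀ j : Fin m, (looSum P fhat1 fhat2 (Sum.inr j : Fin n ⊕ Fin m)).toReal = 0 :=
    fun _ => rfl
  set K := r * (1 + r) * sigmaEll P ℓ with hK
  have hK0 : 0 ≤ K := by positivity
  obtain ⟨L, hL⟩ : ∃ L : Fin n ⊕ Fin m → ℝ, ∀ i, (looSum P fhat1 fhat2 i).toReal = L i :=
    ⟨_, fun _ => rfl⟩
  simp only [hL] at hfitinc hL0 hLr ⊢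
  generalize (mspe P f fhat1 fhat2).toReal = M at *
  have hMs := Real.sq_sqrt hM0
  have hκ : 0 ≤ n * kap n m := mul_nonneg hn'.le hk
  set B := √M / sigma1 P ℓ with hB
  have hB0 : 0 ≤ B := by positivity
  have hBs : B ^ 2 = M / sigma1 P ℓ ^ 2 := by rw [hB, div_pow, hMs]
  set A := K / (√(n : ℝ) * sigma1 P ℓ) with hA
  have hA0 : 0 ≤ A := by positivity
  have mD : Measurable (stdDeg P ℓ f : (Fin n ⊕ Fin m → 𝒳 × 𝒴) → ℝ) := measurable_stdDeg hℓ
  have mF : Measurable (stdFit P ℓ f fhat1 fhat2 : (Fin n ⊕ Fin m → 𝒳 × 𝒴) → ℝ) :=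
    measurable_stdFit hf h1 h2
  have hd : ∫⁻ D, ‖stdDeg P ℓ f D + stdFit P ℓ f fhat1 fhat2 D‖ₑ ^ 2
      ∂(Measure.pi fun _ : Fin n ⊕ Fin m => P) ≤ ENNReal.ofReal ((2 * A + 3 * B) ^ 2) := by
    refine (lintegral_enorm_add_sq_le_ofReal mD mF (by positivity) (by positivity)
      (lintegral_stdDeg_sq_le hrn hℓ hsymm hℓ2 hs hf hf2) hfit).trans
      (ENNReal.ofReal_le_ofReal ?_)
    rw [← hBs]
    nlinarith [mul_nonneg hA0 hB0, sq_nonneg B]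
  -- The three sources of the increment: `e1` from the degenerate part, `e2` from moving an
  -- evaluation point, `e3` from retraining.
  set e1 : Fin n ⊕ Fin m → ℝ := fun i => K * bw n m i / sigma1 P ℓ with he1
  set e2 : Fin n ⊕ Fin m → ℝ := fun i => √(n : ℝ) * |cw n m i| * B with he2
  set e3 : Fin n ⊕ Fin m → ℝ := fun i => √(n * kap n m) * √(L i) / sigma1 P ℓ with he3
  have he1' : ∀ i, 0 ≤ e1 i := fun i => by have := hb0 i; positivity
  have he2' : ∀ i, 0 ≤ e2 i := fun i => by positivity
  have he3' : ∀ i, 0 ≤ e3 i := fun i => by positivity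
  have hinc : ∀ i, ∫⁻ p, ‖(stdDeg P ℓ f p.1 + stdFit P ℓ f fhat1 fhat2 p.1) -
      (stdDeg P ℓ f (Function.update p.1 i p.2) +
        stdFit P ℓ f fhat1 fhat2 (Function.update p.1 i p.2))‖ₑ ^ 2
        ∂((Measure.pi fun _ : Fin n ⊕ Fin m => P).prod P) ≤
      ENNReal.ofReal ((4 * e1 i + (4 * e2 i + 3 * e3 i)) ^ 2) := by
    intro i
    have hv : Measurable fun q : (Fin n ⊕ Fin m → 𝒳 × 𝒴) × 𝒳 × 𝒴 => Function.update q.1 i q.2 :=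
      (measurePreserving_update P i).measurable
    have hLi := hL0 i
    simp only [add_sub_add_comm]
    refine (lintegral_enorm_add_sq_le_ofReal ((mD.comp measurable_fst).sub (mD.comp hv))
      ((mF.comp measurable_fst).sub (mF.comp hv)) (by positivity) (by positivity)
      (lintegral_stdDeg_increment_le hrn hℓ hsymm hℓ2 hs hf hf2 i) (hfitinc i)).trans
      (ENNReal.ofReal_le_ofReal ?_)
    have q2 : e2 i ^ 2 = n / sigma1 P ℓ ^ 2 * (cw n m i ^ 2 * M) := by
      simp only [he2]
      rw [mul_pow, mul_pow, Real.sq_sqrt hn'.le, sq_abs, hBs]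
      ring
    have q3 : e3 i ^ 2 = n / sigma1 P ℓ ^ 2 * (kap n m * L i) := by
      simp only [he3]
      rw [div_pow, mul_pow, Real.sq_sqrt hκ, Real.sq_sqrt hLi]
      ring
    have q : 2 * (8 * (K * bw n m i / sigma1 P ℓ) ^ 2) +
        2 * (n / sigma1 P ℓ ^ 2 * (8 * cw n m i ^ 2 * M + 4 * kap n m * L i)) =
        16 * e1 i ^ 2 + 16 * e2 i ^ 2 + 8 * e3 i ^ 2 := by
      rw [q2, q3]; ring
    rw [q]
    nlinarith [mul_nonneg (he1' i) (he2' i), mul_nonneg (he1' i) (he3' i),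
      mul_nonneg (he2' i) (he3' i), sq_nonneg (e3 i)]
  have main := berry_esseen_nonlinear (P := P) (w := stdPart P ℓ f n m)
    (measurable_stdPart hℓ hf) (memLp_stdPart hℓ3 hf3) (integral_stdPart hℓ hℓ2 hf hf2)
    (sum_integral_stdPart_sq hℓ hℓ2 hs hf hf2 hn) (mD.add mF) (by positivity) hd
    (fun i => by have := he1' i; have := he2' i; have := he3' i; positivity) hinc t
  set V := √(vEll P ℓ) + √(vF P f) with hV
  have hV0 : 0 ≤ V := add_nonneg hx hy
  have hsum : ∑ i, √(∫ z, stdPart P ℓ f n m i z ^ 2 ∂P) * (4 * e1 i + (4 * e2 i + 3 * e3 i)) ≤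
      4 * (K * V / (√(n : ℝ) * sigma1 P ℓ ^ 2)) + (8 * (V / sigma1 P ℓ * B) +
        3 * (V / sigma1 P ℓ ^ 2 * √(n * kap n m * ∑ i, L i))) := by
    have t1 : ∑ i, √(n : ℝ) / sigma1 P ℓ * (kw n m i * V) * e1 i =
        K * V / (√(n : ℝ) * sigma1 P ℓ ^ 2) := by
      calc _ = √(n : ℝ) * (K * V / sigma1 P ℓ ^ 2) * ∑ i, kw n m i * bw n m i := by
            rw [Finset.mul_sum]
            refine Finset.sum_congr rfl fun i _ => ?_
            simp only [he1]; field_simp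
        _ = _ := by
          rw [sum_kw_mul_bw hn]
          nth_rw 2 [← Real.sq_sqrt hn'.le]
          field_simp
    have t2 : ∑ i, √(n : ℝ) / sigma1 P ℓ * (kw n m i * V) * e2 i ≤ 2 * (V / sigma1 P ℓ * B) := by
      calc _ = V / sigma1 P ℓ * B * (√(n : ℝ) ^ 2 * ∑ i, kw n m i * |cw n m i|) := by
            rw [Finset.mul_sum, Finset.mul_sum]
            refine Finset.sum_congr rfl fun i _ => ?_
            simp only [he2]; ring
        _ ≤ V / sigma1 P ℓ * B * 2 := by
          rw [Real.sq_sqrt hn'.le]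
          gcongr
          exact n_mul_sum_kw_cw_le hn
        _ = _ := by ring
    have t3 : ∑ i, √(n : ℝ) / sigma1 P ℓ * (kw n m i * V) * e3 i ≤
        V / sigma1 P ℓ ^ 2 * √(n * kap n m * ∑ i, L i) := by
      calc _ = V / sigma1 P ℓ ^ 2 * (√(n * kap n m) * (√(n : ℝ) * ∑ i, kw n m i * √(L i))) := by
            rw [Finset.mul_sum, Finset.mul_sum, Finset.mul_sum]
            refine Finset.sum_congr rfl fun i _ => ?_
            simp only [he3]; field_simp
        _ ≤ V / sigma1 P ℓ ^ 2 * (√(n * kap n m) * (√(n : ℝ) * (√(∑ i, L i) / √(n : ℝ)))) := by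
          gcongr
          exact sum_kw_mul_sqrt_le hn hL0 hLr
        _ = _ := by
          rw [mul_div_cancel₀ _ hq.ne', Real.sqrt_mul hκ]
    calc _ ≤ ∑ i, √(n : ℝ) / sigma1 P ℓ * (kw n m i * V) * (4 * e1 i + (4 * e2 i + 3 * e3 i)) := by
          refine Finset.sum_le_sum fun i _ => mul_le_mul_of_nonneg_right (hsqrt i) ?_
          have := he1' i; have := he2' i; have := he3' i; positivity
      _ = 4 * ∑ i, √(n : ℝ) / sigma1 P ℓ * (kw n m i * V) * e1 i +
          (4 * ∑ i, √(n : ℝ) / sigma1 P ℓ * (kw n m i * V) * e2 i +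
          3 * ∑ i, √(n : ℝ) / sigma1 P ℓ * (kw n m i * V) * e3 i) := by
          rw [Finset.mul_sum, Finset.mul_sum, Finset.mul_sum, ← Finset.sum_add_distrib,
            ← Finset.sum_add_distrib]
          exact Finset.sum_congr rfl fun i _ => by ring
      _ ≤ _ := by linarith
  refine main.trans ?_
  set S := √(n * kap n m * ∑ i, L i) with hS
  have hS0 : 0 ≤ S := Real.sqrt_nonneg _
  have hT : 0 ≤ tEll P ℓ + tF P f := add_nonneg tEll_nonneg tF_nonneg
  have hρ : (0 : ℝ) ≤ r * (1 + r) := by positivity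
  have f1 : A = r * (1 + r) * (sigma1 P ℓ * sigmaEll P ℓ / (√(n : ℝ) * sigma1 P ℓ ^ 2)) := by
    rw [hA, hK]; field_simp
  have f2 : K * V / (√(n : ℝ) * sigma1 P ℓ ^ 2) =
      r * (1 + r) * (V * sigmaEll P ℓ / (√(n : ℝ) * sigma1 P ℓ ^ 2)) := by
    rw [hK]; ring
  have f3 : devSum P ℓ f * sigmaEll P ℓ / (√(n : ℝ) * sigma1 P ℓ ^ 2) =
      sigma1 P ℓ * sigmaEll P ℓ / (√(n : ℝ) * sigma1 P ℓ ^ 2) +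
      V * sigmaEll P ℓ / (√(n : ℝ) * sigma1 P ℓ ^ 2) := by
    rw [devSum]; ring
  have f4 : devSum P ℓ f / sigma1 P ℓ ^ 2 * (√M + S) =
      B + V / sigma1 P ℓ * B + V / sigma1 P ℓ ^ 2 * S + S / sigma1 P ℓ := by
    rw [devSum, ← hV, hB]; field_simp; ring
  have p0 : 0 ≤ (tEll P ℓ + tF P f) / (√(n : ℝ) * sigma1 P ℓ ^ 3) := by positivity
  have p1 : 0 ≤ sigma1 P ℓ * sigmaEll P ℓ / (√(n : ℝ) * sigma1 P ℓ ^ 2) := by positivity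
  have p2 : 0 ≤ V * sigmaEll P ℓ / (√(n : ℝ) * sigma1 P ℓ ^ 2) := by positivity
  have p4 : 0 ≤ V / sigma1 P ℓ ^ 2 * S := by positivity
  have p5 : 0 ≤ S / sigma1 P ℓ := by positivity
  rw [f2] at hsum
  rw [rate, f3, f4, f1]
  exact combine_bounds hρ p0 p1 p2 p4 p5 hB0 hcube hsum

end approximation

/-! ### The bound as a real number -/

section omega

variable {𝒳 : Type u} {𝒴 : Type v} [MeasurableSpace 𝒳] [MeasurableSpace 𝒴]
  {P : Measure (𝒳 × 𝒴)} {r : ℕ} {ℓ : (Fin r → 𝒴) → ℝ}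
  {f : 𝒳 → ℝ} {n m : ℕ}
  {fhat1 : (Fold1 n → 𝒳 × 𝒴) → 𝒳 → ℝ} {fhat2 : (Fold2 n → 𝒳 × 𝒴) → 𝒳 → ℝ}

lemma ofReal_rpow_half {a : ℝ} (ha : 0 ≤ a) :
    ENNReal.ofReal a ^ (1 / 2 : ℝ) = ENNReal.ofReal √a := by
  rw [ENNReal.ofReal_rpow_of_nonneg ha (by norm_num), Real.sqrt_eq_rpow]

lemma measurable_UCross (hℓ : Measurable ℓ) (h1 : Measurable (Function.uncurry fhat1))
    (h2 : Measurable (Function.uncurry fhat2)) :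
    Measurable fun q : (Fin n → 𝒳 × 𝒴) × (Fin m → 𝒳) => UCross ℓ fhat1 fhat2 q.1 q.2 := by
  have hc : ∀ {k : ℕ} {x : (Fin n → 𝒳 × 𝒴) × (Fin m → 𝒳) → Fin k → 𝒳}, Measurable x →
      ∀ i, Measurable fun q => crossFit (fhat1 (half1 q.1)) (fhat2 (half2 q.1)) (x q) i := by
    intro k x hx i
    have hxi : Measurable fun q => (q.1, x q i) :=
      measurable_fst.prodMk ((measurable_pi_apply i).comp hx)
    unfold crossFit
    split_ifs
    · exact (measurable_half2 h2).comp hxi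
    · exact (measurable_half1 h1).comp hxi
  have hx1 : Measurable fun (q : (Fin n → 𝒳 × 𝒴) × (Fin m → 𝒳)) i => (q.1 i).1 :=
    measurable_pi_lambda _ fun i =>
      measurable_fst.comp ((measurable_pi_apply i).comp measurable_fst)
  have hU : Measurable fun q : (Fin n → 𝒳 × 𝒴) × (Fin m → 𝒳) => UStat ℓ fun i => (q.1 i).2 :=
    (Finset.measurable_fun_sum _ fun i _ => hℓ.comp (measurable_pi_lambda _ fun k =>
      measurable_snd.comp ((measurable_pi_apply (i k)).comp measurable_fst))).const_mul _
  have hS1 := Finset.measurable_fun_sum Finset.univ fun i _ => hc hx1 i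
  have hS2 := Finset.measurable_fun_sum Finset.univ fun j _ =>
    hc (x := fun q => q.2) measurable_snd j
  exact (hU.sub (hS1.const_mul _)).add ((hS1.add hS2).const_mul _)

variable [NeZero r]

lemma Omega1_eq_top (h : Mell P ℓ 3 + Mf P f 3 = ⊤) : Omega1 P ℓ f n = ⊤ := by
  simp only [Omega1]
  rw [h, ENNReal.top_div_of_ne_top, top_add]
  exact ENNReal.mul_ne_top ENNReal.ofReal_ne_top (ENNReal.pow_ne_top ENNReal.ofReal_ne_top)

lemma Omega2_eq_top (hs : 0 < sigma1Sq P ℓ) (h : mspe P f fhat1 fhat2 = ⊤) :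
    Omega2 P ℓ f m fhat1 fhat2 = ⊤ := by
  have hσ := sigma1_pos hs
  simp only [Omega2]
  rw [h, ENNReal.top_rpow_of_pos (by norm_num), ENNReal.top_rpow_of_pos (by norm_num), top_add,
    ENNReal.top_div_of_ne_top, ENNReal.mul_top, min_self]
  · refine (ENNReal.div_pos ?_ (ENNReal.pow_ne_top ENNReal.ofReal_ne_top)).ne'
    simp [hσ]
  · exact ENNReal.rpow_ne_top_of_nonneg (by norm_num) ENNReal.ofReal_ne_top

lemma ofReal_cbrt (hs : 0 < sigma1Sq P ℓ) (hM : mspe P f fhat1 fhat2 ≠ ⊤) :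
    mspe P f fhat1 fhat2 ^ (1 / 3 : ℝ) / ENNReal.ofReal (sigma1 P ℓ) ^ (2 / 3 : ℝ) =
      ENNReal.ofReal (((mspe P f fhat1 fhat2).toReal / sigma1 P ℓ ^ 2) ^ (1 / 3 : ℝ)) := by
  have hσ := sigma1_pos hs
  have hM0 : 0 ≤ (mspe P f fhat1 fhat2).toReal := ENNReal.toReal_nonneg
  nth_rw 1 [← ENNReal.ofReal_toReal hM]
  rw [ENNReal.ofReal_rpow_of_nonneg hM0 (by norm_num), ENNReal.ofReal_rpow_of_pos hσ,
    ← ENNReal.ofReal_div_of_pos (Real.rpow_pos_of_pos hσ _),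
    Real.div_rpow hM0 (sq_nonneg _), ← Real.rpow_natCast, ← Real.rpow_mul hσ.le]
  norm_num

variable [IsProbabilityMeasure P]

lemma devSum_eq (hℓ : Measurable ℓ) (hℓ2 : MemLp ℓ 2 (Measure.pi fun _ : Fin r => P.snd))
    (hf : Measurable f) (hf2 : MemLp f 2 P.fst) :
    Mell P ℓ 2 ^ (1 / 2 : ℝ) + Mf P f 2 ^ (1 / 2 : ℝ) + ENNReal.ofReal (sigma1 P ℓ) =
      ENNReal.ofReal (devSum P ℓ f) := by
  have e1 : Mell P ℓ 2 = ENNReal.ofReal (vEll P ℓ) := by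
    rw [Mell_eq_lintegral hℓ hℓ2, ← ofReal_integral_sq (memLp_cEll hℓ hℓ2), vEll]
  have e2 : Mf P f 2 = ENNReal.ofReal (vF P f) := by
    rw [Mf_eq_lintegral hf, ← ofReal_integral_sq (memLp_cF hf2), vF]
  rw [e1, e2, ofReal_rpow_half vEll_nonneg, ofReal_rpow_half vF_nonneg,
    ← ENNReal.ofReal_add (Real.sqrt_nonneg _) (Real.sqrt_nonneg _),
    ← ENNReal.ofReal_add (by positivity) (q := sigma1 P ℓ) (Real.sqrt_nonneg _)]
  rfl

/-- The only loss is the replacement of `√n` by `√(n - r)` in one denominator. -/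
lemma ofReal_rate_le (hrn : r < n) (hℓ : Measurable ℓ)
    (hℓ2 : MemLp ℓ 2 (Measure.pi fun _ : Fin r => P.snd)) (hs : 0 < sigma1Sq P ℓ)
    (hf : Measurable f) (hf2 : MemLp f 2 P.fst)
    (hℓ3 : MemLp (cEll P ℓ) 3 P) (hf3 : MemLp (cF P f) 3 P) :
    ENNReal.ofReal (rate P ℓ f n) ≤ Omega1 P ℓ f n := by
  have hn : (0 : ℝ) < n := by exact_mod_cast (Nat.zero_le r).trans_lt hrn
  have hnr : (0 : ℝ) < n - r := sub_pos.2 (by exact_mod_cast hrn)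
  have hσ := sigma1_pos hs
  have hE : 0 ≤ sigmaEll P ℓ := Real.sqrt_nonneg _
  have hD : 0 ≤ devSum P ℓ f := by
    have := hσ.le; rw [devSum]; positivity
  have hT1 : 0 ≤ tEll P ℓ := tEll_nonneg
  have hT2 : 0 ≤ tF P f := tF_nonneg
  have hq : 0 < √(n - r : ℝ) := Real.sqrt_pos.2 hnr
  have hle : √(n - r : ℝ) ≤ √(n : ℝ) := Real.sqrt_le_sqrt (by linarith [rCast_pos (r := r)])
  have hq' : 0 < √(n : ℝ) := hq.trans_le hle
  have e3 : Mell P ℓ 3 = ENNReal.ofReal (tEll P ℓ) := by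
    rw [Mell_eq_lintegral hℓ hℓ2, ← ofReal_integral_abs_cube hℓ3, tEll]
  have e4 : Mf P f 3 = ENNReal.ofReal (tF P f) := by
    rw [Mf_eq_lintegral hf, ← ofReal_integral_abs_cube hf3, tF]
  have e : Omega1 P ℓ f n = ENNReal.ofReal ((tEll P ℓ + tF P f) / (√(n : ℝ) * sigma1 P ℓ ^ 3) +
      devSum P ℓ f * sigmaEll P ℓ / (√(n - r : ℝ) * sigma1 P ℓ ^ 2)) := by
    simp only [Omega1]
    rw [devSum_eq hℓ hℓ2 hf hf2, e3, e4, ← ENNReal.ofReal_add hT1 hT2, ← ENNReal.ofReal_pow hσ.le, ← ENNReal.ofReal_pow hσ.le,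
      ← ENNReal.ofReal_mul hq'.le, ← ENNReal.ofReal_mul hq.le, ← ENNReal.ofReal_mul hD,
      ← ENNReal.ofReal_div_of_pos (by positivity), ← ENNReal.ofReal_div_of_pos (by positivity),
      ← ENNReal.ofReal_add (by positivity) (by positivity)]
  rw [e, rate]
  refine ENNReal.ofReal_le_ofReal ?_
  gcongr

lemma stability_eq (hn : 0 < n) (hf : Measurable f) (h1 : Measurable (Function.uncurry fhat1))
    (h2 : Measurable (Function.uncurry fhat2)) (hM : mspe P f fhat1 fhat2 ≠ ⊤) :
    stability P m fhat1 fhat2 = ENNReal.ofReal (((min m n : ℕ) : ℝ) / n *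
      ∑ i : Fin n ⊕ Fin m, (looSum P fhat1 fhat2 i).toReal) := by
  have hn' : (0 : ℝ) < n := by exact_mod_cast hn
  have hL : ∀ i ∈ (Finset.univ : Finset (Fin n ⊕ Fin m)), looSum P fhat1 fhat2 i ≠ ⊤ :=
    fun i _ => ((looSum_le hf h1 h2 i).trans_lt (ENNReal.mul_lt_top (by norm_num) hM.lt_top)).ne
  have hS : ∑ i : Fin n ⊕ Fin m, looSum P fhat1 fhat2 i =
      (∑ i : Fin n, looError P (fun D => fhat1 (half1 D)) i) +
      ∑ i : Fin n, looError P (fun D => fhat2 (half2 D)) i := by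
    simp [looSum, Finset.sum_add_distrib]
  rw [stability, ← ENNReal.add_div, ← hS, ← ENNReal.toReal_sum hL,
    ENNReal.ofReal_mul (by positivity), ENNReal.ofReal_div_of_pos hn', ENNReal.ofReal_natCast,
    ENNReal.ofReal_natCast, ENNReal.ofReal_toReal (ENNReal.sum_ne_top.2 hL), div_eq_mul_inv,
    div_eq_mul_inv]
  ring

lemma ofReal_fit_le (hn : 0 < n) (hs : 0 < sigma1Sq P ℓ) (hℓ : Measurable ℓ)
    (hℓ2 : MemLp ℓ 2 (Measure.pi fun _ : Fin r => P.snd)) (hf : Measurable f)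
    (hf2 : MemLp f 2 P.fst) (h1 : Measurable (Function.uncurry fhat1))
    (h2 : Measurable (Function.uncurry fhat2)) (hM : mspe P f fhat1 fhat2 ≠ ⊤) :
    ENNReal.ofReal (devSum P ℓ f / sigma1 P ℓ ^ 2 * (√(mspe P f fhat1 fhat2).toReal +
          √(n * kap n m * ∑ i : Fin n ⊕ Fin m, (looSum P fhat1 fhat2 i).toReal))) ≤
      (Mell P ℓ 2 ^ (1 / 2 : ℝ) + Mf P f 2 ^ (1 / 2 : ℝ) + ENNReal.ofReal (sigma1 P ℓ)) /
        ENNReal.ofReal (sigma1 P ℓ) ^ 2 *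
      (mspe P f fhat1 fhat2 ^ (1 / 2 : ℝ) + stability P m fhat1 fhat2 ^ (1 / 2 : ℝ)) := by
  have hσ := sigma1_pos hs
  have hD : 0 ≤ devSum P ℓ f := by
    have := hσ.le; rw [devSum]; positivity
  have hM0 : 0 ≤ (mspe P f fhat1 fhat2).toReal := ENNReal.toReal_nonneg
  have hL0 : 0 ≤ ∑ i : Fin n ⊕ Fin m, (looSum P fhat1 fhat2 i).toReal :=
    Finset.sum_nonneg fun _ _ => ENNReal.toReal_nonneg
  rw [stability_eq hn hf h1 h2 hM, devSum_eq hℓ hℓ2 hf hf2]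
  nth_rw 2 [← ENNReal.ofReal_toReal hM]
  rw [ofReal_rpow_half hM0, ofReal_rpow_half (by positivity), ← ENNReal.ofReal_pow hσ.le,
    ← ENNReal.ofReal_div_of_pos (by positivity),
    ← ENNReal.ofReal_add (Real.sqrt_nonneg _) (Real.sqrt_nonneg _),
    ← ENNReal.ofReal_mul (by positivity)]
  refine ENNReal.ofReal_le_ofReal ?_
  gcongr
  exact n_mul_kap_le hn

end omega

end

end SemiU

/-! ### Assembly of the final bound -/

theorem mainTheorem3 (r : ℕ) [NeZero r] :
    ∃ C : ℝ, 0 < C ∧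
      ∀ (𝒳 : Type u) (𝒴 : Type v) (Ω : Type w)
        [MeasurableSpace 𝒳] [MeasurableSpace 𝒴] [MeasurableSpace Ω]
        (μ : Measure Ω) [IsProbabilityMeasure μ]
        (P : Measure (𝒳 × 𝒴)) [IsProbabilityMeasure P]
        (ℓ : (Fin r → 𝒴) → ℝ) (f : 𝒳 → ℝ)
        (n m : ℕ) (Z : Fin n → Ω → 𝒳 × 𝒴) (X' : Fin m → Ω → 𝒳)
        (fhat1 : (SemiU.Fold1 n → 𝒳 × 𝒴) → 𝒳 → ℝ)
        (fhat2 : (SemiU.Fold2 n → 𝒳 × 𝒴) → 𝒳 → ℝ),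
        r < n →
        Measurable ℓ →
        (∀ (τ : Equiv.Perm (Fin r)) (y : Fin r → 𝒴), ℓ (y ∘ τ) = ℓ y) →
        MemLp ℓ 2 (Measure.pi fun _ : Fin r => P.snd) →
        0 < SemiU.sigma1Sq P ℓ →
        Measurable f →
        MemLp f 2 P.fst →
        Measurable (Function.uncurry fhat1) →
        Measurable (Function.uncurry fhat2) →
        SemiU.IsSample μ P Z X' →
        ⨆ t : ℝ, ENNReal.ofReal
            |μ.real {ω | √(n : ℝ) *
                (SemiU.UCross ℓ fhat1 fhat2 (fun i => Z i ω) (fun j => X' j ω) - SemiU.psi P ℓ) /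
                  √(SemiU.Lam P ℓ f n m) ≤ t} - cdf (gaussianReal 0 1) t|
          ≤ ENNReal.ofReal C *
              (SemiU.Omega1 P ℓ f n + SemiU.Omega2 P ℓ f m fhat1 fhat2) := by
  -- `512 = 64 * 8` combines the Berry–Esseen constant with the third moment bound; the part
  -- depending on `r` comes from the degenerate remainder.
  set C : ℝ := 512 + 8 * (r * (1 + r)) with hC
  have hC0 : 512 ≤ C := by
    have : (0 : ℝ) ≤ 8 * (r * (1 + r)) := by positivity
    linarith
  refine ⟨C, by linarith, ?_⟩
  intro 𝒳 𝒴 Ω _ _ _ μ _ P _ ℓ f n m Z X' fhat1 fhat2 hrn hℓ hsymm hℓ2 hs hf hf2 h1 h2 hZ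
  have hn : 0 < n := (Nat.zero_le r).trans_lt hrn
  have hσ := SemiU.sigma1_pos hs
  have hCtop : ENNReal.ofReal C ≠ 0 := (ENNReal.ofReal_pos.2 (by linarith)).ne'
  -- An infinite third moment or an infinite `Δ_MSPE` makes the right side infinite. From here on
  -- these quantities are real.
  by_cases h3 : SemiU.Mell P ℓ 3 + SemiU.Mf P f 3 = ⊤
  · rw [SemiU.Omega1_eq_top h3, top_add, ENNReal.mul_top hCtop]
    exact le_top
  by_cases hM : SemiU.mspe P f fhat1 fhat2 = ⊤
  · rw [SemiU.Omega2_eq_top hs hM, add_top, ENNReal.mul_top hCtop]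
    exact le_top
  rw [ENNReal.add_eq_top, not_or] at h3
  have hℓ3 : MemLp (SemiU.cEll P ℓ) 3 P := SemiU.memLp_three_of_lintegral
    (SemiU.measurable_cEll hℓ).aestronglyMeasurable (by
      rw [← SemiU.Mell_eq_lintegral hℓ hℓ2]; exact h3.1)
  have hf3 : MemLp (SemiU.cF P f) 3 P := SemiU.memLp_three_of_lintegral
    (SemiU.measurable_cF hf).aestronglyMeasurable (by
      rw [← SemiU.Mf_eq_lintegral hf]; exact h3.2)
  refine iSup_le fun t => ?_
  have hS : MeasurableSet {q : (Fin n → 𝒳 × 𝒴) × (Fin m → 𝒳) | √(n : ℝ) *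
      (SemiU.UCross ℓ fhat1 fhat2 q.1 q.2 - SemiU.psi P ℓ) / √(SemiU.Lam P ℓ f n m) ≤ t} := by
    refine measurableSet_le ?_ measurable_const
    refine (((SemiU.measurable_UCross hℓ h1 h2).sub_const _).const_mul _).div_const _
  have key := hZ.measure_eq hS
  simp only [Set.mem_ofPred_eq] at key
  rw [key]
  simp only [SemiU.standardized_eq (f := f) hrn]
  have hO1 := SemiU.ofReal_rate_le hrn hℓ hℓ2 hs hf hf2 hℓ3 hf3
  have hrate : 0 ≤ SemiU.rate P ℓ f n := by
    have hT1 : 0 ≤ SemiU.tEll P ℓ := SemiU.tEll_nonneg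
    have hT2 : 0 ≤ SemiU.tF P f := SemiU.tF_nonneg
    have hE : 0 ≤ SemiU.sigmaEll P ℓ := Real.sqrt_nonneg _
    rw [SemiU.rate, SemiU.devSum]
    positivity
  have finish : ∀ {x a : ℝ} {b : ℝ≥0∞}, 0 ≤ a → x ≤ C * SemiU.rate P ℓ f n + C * a →
      ENNReal.ofReal a ≤ b → ENNReal.ofReal x ≤ ENNReal.ofReal C * (SemiU.Omega1 P ℓ f n + b) := by
    intro x a b ha hx hb
    calc ENNReal.ofReal x ≤ ENNReal.ofReal (C * (SemiU.rate P ℓ f n + a)) :=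
          ENNReal.ofReal_le_ofReal (by rw [mul_add]; exact hx)
      _ ≤ _ := by
        rw [ENNReal.ofReal_mul (by linarith), ENNReal.ofReal_add hrate ha]
        gcongr
  rw [SemiU.Omega2]
  rcases min_choice (SemiU.mspe P f fhat1 fhat2 ^ (1 / 3 : ℝ) /
      ENNReal.ofReal (SemiU.sigma1 P ℓ) ^ (2 / 3 : ℝ))
    ((SemiU.Mell P ℓ 2 ^ (1 / 2 : ℝ) + SemiU.Mf P f 2 ^ (1 / 2 : ℝ) +
      ENNReal.ofReal (SemiU.sigma1 P ℓ)) / ENNReal.ofReal (SemiU.sigma1 P ℓ) ^ 2 *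
      (SemiU.mspe P f fhat1 fhat2 ^ (1 / 2 : ℝ) +
        SemiU.stability P m fhat1 fhat2 ^ (1 / 2 : ℝ))) with hmin | hmin
  -- The cube root term is the minimum: the linear and degenerate parts are approximated first and
  -- the trained functions are added as a perturbation with `q = (Δ_MSPE / σ₁²)^(1/3)`.
  · simp only [hmin]
    have hM0 : 0 ≤ (SemiU.mspe P f fhat1 fhat2).toReal / SemiU.sigma1 P ℓ ^ 2 :=
      div_nonneg ENNReal.toReal_nonneg (sq_nonneg _)
    have hq : 0 ≤ ((SemiU.mspe P f fhat1 fhat2).toReal / SemiU.sigma1 P ℓ ^ 2) ^ (1 / 3 : ℝ) :=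
      Real.rpow_nonneg hM0 _
    refine finish hq ?_ (SemiU.ofReal_cbrt hs hM).ge
    refine (SemiU.abs_measureReal_sub_ncdf_le (SemiU.measurable_stdFit hf h1 h2)
      (SemiU.normal_approx_stdDeg hrn hℓ hsymm hℓ2 hs hf hf2 hℓ3 hf3) hq
      (SemiU.lintegral_stdFit_sq_le hrn hℓ hℓ2 hs hf hf2 h1 h2 hM) ?_ t).trans ?_
    · rw [← Real.rpow_natCast (_ ^ (1 / 3 : ℝ)), ← Real.rpow_mul hM0]
      norm_num
    · have := mul_le_mul_of_nonneg_right hC0 hq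
      linarith
  · simp only [hmin]
    have hfit := SemiU.ofReal_fit_le (m := m) hn hs hℓ hℓ2 hf hf2 h1 h2 hM
    have ha : 0 ≤ SemiU.devSum P ℓ f / SemiU.sigma1 P ℓ ^ 2 *
        (√(SemiU.mspe P f fhat1 fhat2).toReal + √(n * SemiU.kap n m *
          ∑ i : Fin n ⊕ Fin m, (SemiU.looSum P fhat1 fhat2 i).toReal)) := by
      rw [SemiU.devSum]
      positivity
    refine finish ha ?_ hfit
    have := SemiU.normal_approx_stdDeg_add_stdFit (m := m) hrn hℓ hsymm hℓ2 hs hf hf2 hℓ3 hf3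
      h1 h2 hM t
    simp only [← add_assoc] at this
    refine this.trans ?_
    have := mul_le_mul_of_nonneg_right hC0 ha
    linarith
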